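/- Let $p(s,t)=\sum_{|\alpha|\ge 1}c_\alpha (s,t)^\alpha$ be a real polynomial in two variables without constant term, such that some $c_{(n,0)}\neq 0$ and some $c_{(0,n)}\ne 0$; let $a$ (resp. $b$) be the least integer with $c_{(a,0)}\neq 0$ (resp. $c_{(0,b)}\ne 0$), and assume $b\le a$. Kernels. On $\mathbb{R}^2$ use the dilations $(\delta_1,\delta_2)(s,t)=(\delta_1 s,\delta_2 t)$, i.e. $e=((1,0),(0,1))$, put $\mathcal{A}=\{(\delta_1,\delta_2)\in[0,1]^2:\delta_1\le\delta_2\}$ and $-\log_2\mathcal{A}=\{j\in\mathbb{N}^2: 2^{-j}\in\mathcal{A}\}=\{j\in\mathbb{N}^2:j_1\ge j_2\}$ (with $0\in\mathbb{N}$), and write $\varsigma^{(2^j)}(s,t)=2^{j_1+j_2}\varsigma(2^{j_1}s,2^{j_2}t)$. For $j\in-\log_2\mathcal A$ and $C\ge1$: $\mu\in\{1,2\}$ is $j$-minimal if no $k\in-\log_2\mathcal{A}$ has $k_\mu<j_\mu$; $\mu_1\preceq_{j,C}\mu_2$ means that $j_{\mu_1}-k_{\mu_1}\le C(j_{\mu_2}-k_{\mu_2})$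 for all $k\in-\log_2\mathcal{A}$ with $k_{\mu_1}<j_{\mu_1}$; $\mu_1\prec_{j,C}\mu_2$ means $\mu_1\preceq_{j,C}\mu_2$ and not $\mu_2\preceq_{j,C}\mu_1$; $[\mu]_{j,C}$ is the set of $\mu'$ with $\mu\preceq_{j,C}\mu'\preceq_{j,C}\mu$. For $a_0>0$, $\mathcal{K}(2,e,a_0,\mathcal{A})$ is the set of complex-valued distributions $K$ on $\mathbb{R}^2$ for which there are $C\ge 1$ and a bounded family $\{\varsigma_j\}_{j\in-\log_2\mathcal{A}}$ in $C_0^\infty(B^2(a_0))$ (supports in a common compact subset of the open Euclidean ball $B^2(a_0)$, derivatives of each order uniformly bounded) with $K=\sum_{j\in-\log_2\mathcal{A}}\varsigma_j^{(2^j)}$ in the sense of distributions, such that, for every $j$ and every $\mu$ that is not $j$-minimal and for which there is no $\mu'$ with $\mu\prec_{j,C}\mu'$, the integral of $\varsigma_j$ over the coordinates with index in $[\mu]_{j,C}$ vanishes for every value of the remaining coordinates. Operators. For such $K$ and $f\in C_0^\infty(\mathbb{R})$ let $T_Kf(x)=\int f(x-p(s,t))K(s,t)\,ds\,dt$, the pairing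 of the compactly supported distribution $K$ with the smooth function $(s,t)\mapsto f(x-p(s,t))$. Say that $T_K$ is bounded on $L^2$ if it extends to a bounded operator $L^2(\mathbb{R})\to L^2(\mathbb{R})$. Theorem. There is $\varepsilon>0$ such that for every $a_0\in(0,\varepsilon]$ the following are equivalent: (i) $T_K$ is bounded on $L^2$ for every $K\in\mathcal{K}(2,e,a_0,\mathcal{A})$; (ii) every multi-index $\alpha$ with $c_\alpha\ne 0$ lies on or above the line through $(b,0)$ and $(0,b)$. -/

import Mathlib

open MeasureTheory TopologicalSpace
open scoped Distributions ContDiff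

noncomputable section

namespace MultiParam

/-! ### Multi-parameter dilations and the class of kernels `𝒦(N, e, a, 𝒜)` -/

/-- The `ν`-parameter dilations on `ℝ^N` given by the exponents `e`:
`δ t = (δ^{e_1} t_1, …, δ^{e_N} t_N)`, where `δ^{e_i} = ∏ μ, δ_μ ^ (e_i^μ)`. -/
def dilate {N ν : ℕ} (e : Fin N → Fin ν → ℝ) (δ : Fin ν → ℝ)
    (t : EuclideanSpace ℝ (Fin N)) : EuclideanSpace ℝ (Fin N) :=
  WithLp.toLp 2 fun i => (∏ μ, δ μ ^ e i μ) * t i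

/-- The `L¹`-normalized dilate
`ς^{(2^j)}(t) = 2^{j·e_1 + ⋯ + j·e_N} ς(2^j t)` of a function `ς` on `ℝ^N`. -/
def dilFun {N ν : ℕ} (e : Fin N → Fin ν → ℝ) (j : Fin ν → ℕ)
    (ς : EuclideanSpace ℝ (Fin N) → ℂ) : EuclideanSpace ℝ (Fin N) → ℂ :=
  fun t => (((2 : ℝ) ^ (∑ i, ∑ μ, (j μ : ℝ) * e i μ) : ℝ) : ℂ) *
    ς (dilate e (fun μ => (2 : ℝ) ^ j μ) t)

/-- `-log₂ 𝒜 = {j ∈ ℕ^ν : 2^{-j} ∈ 𝒜}`. -/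
def negLog {ν : ℕ} (A : Set (Fin ν → ℝ)) : Set (Fin ν → ℕ) :=
  {j | (fun μ => ((2 : ℝ) ^ j μ)⁻¹) ∈ A}

/-- `μ` is `j,𝒜`-minimal: no `k ∈ -log₂ 𝒜` has `j_μ > k_μ`. -/
def IsMinimalIndex {ν : ℕ} (A : Set (Fin ν → ℝ)) (j : Fin ν → ℕ) (μ : Fin ν) : Prop :=
  ¬ ∃ k ∈ negLog A, k μ < j μ

/-- The relation `μ₁ ≼_{j,C,𝒜} μ₂`. -/
def Prec {ν : ℕ} (A : Set (Fin ν → ℝ)) (C : ℝ) (j : Fin ν → ℕ) (μ₁ μ₂ : Fin ν) : Prop :=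
  ∀ k ∈ negLog A, k μ₁ < j μ₁ →
    (j μ₁ : ℝ) - (k μ₁ : ℝ) ≤ C * ((j μ₂ : ℝ) - (k μ₂ : ℝ))

/-- The strict relation `μ₁ ≺_{j,C,𝒜} μ₂`. -/
def StrictPrec {ν : ℕ} (A : Set (Fin ν → ℝ)) (C : ℝ) (j : Fin ν → ℕ) (μ₁ μ₂ : Fin ν) :
    Prop :=
  Prec A C j μ₁ μ₂ ∧ ¬ Prec A C j μ₂ μ₁

/-- The class `[μ]_{j,C,𝒜}`. -/
def indexClass {ν : ℕ} (A : Set (Fin ν → ℝ)) (C : ℝ) (j : Fin ν → ℕ) (μ : Fin ν) :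
    Set (Fin ν) :=
  {μ' | Prec A C j μ μ' ∧ Prec A C j μ' μ}

open Classical in
/-- The coordinates of `t` that make up `t_1^{[μ]_{j,C,𝒜}}`: those `i` such that
`e_i^{μ'} ≠ 0` for some `μ' ∈ [μ]_{j,C,𝒜}`. -/
def classCoords {N ν : ℕ} (e : Fin N → Fin ν → ℝ) (A : Set (Fin ν → ℝ)) (C : ℝ)
    (j : Fin ν → ℕ) (μ : Fin ν) : Finset (Fin N) :=
  {i | ∃ μ' ∈ indexClass A C j μ, e i μ' ≠ 0}

/-- `∫ ς(t) dt_S = 0`: the integral of `ς` over the coordinates in `S` vanishes for every value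
of the remaining coordinates. -/
def CancelsIn {N : ℕ} (S : Finset (Fin N)) (ς : EuclideanSpace ℝ (Fin N) → ℂ) : Prop :=
  ∀ t : Fin N → ℝ, ∫ u : S → ℝ, ς (WithLp.toLp 2 (Function.updateFinset t S u)) = 0

/-- `{ς_j : j ∈ J}` is a bounded subset of `C_0^∞(B^N(a))`: smooth functions, all supported in
one compact subset of the open ball `B^N(a)`, with each order of derivatives bounded uniformly
in `j`. -/
def IsBoundedFamily {N ν : ℕ} (a : ℝ) (J : Set (Fin ν → ℕ))
    (ς : (Fin ν → ℕ) → EuclideanSpace ℝ (Fin N) → ℂ) : Prop :=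
  (∀ j ∈ J, ContDiff ℝ ∞ (ς j)) ∧
  (∃ r < a, ∀ j ∈ J, tsupport (ς j) ⊆ Metric.closedBall 0 r) ∧
  ∀ m : ℕ, ∃ M : ℝ, ∀ j ∈ J, ∀ t, ‖iteratedFDeriv ℝ m (ς j) t‖ ≤ M

/-- The class `𝒦(N, e, a, 𝒜)` of distributions `K = ∑_{j ∈ -log₂ 𝒜} ς_j^{(2^j)}` on `ℝ^N`
(convergence in the sense of distributions), with `{ς_j}` bounded in `C_0^∞(B^N(a))` and, for some
`C ≥ 1`, with `∫ ς_j dt_1^{[μ]_{j,C,𝒜}} = 0` whenever `μ` is not `j,𝒜`-minimal and there is no `μ'`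
with `μ ≺_{j,C,𝒜} μ'`. -/
def kernelClass (N : ℕ) {ν : ℕ} (e : Fin N → Fin ν → ℝ) (a : ℝ) (A : Set (Fin ν → ℝ)) :
    Set 𝓓'((⊤ : Opens (EuclideanSpace ℝ (Fin N))), ℂ) :=
  {K | ∃ C : ℝ, 1 ≤ C ∧ ∃ ς : (Fin ν → ℕ) → EuclideanSpace ℝ (Fin N) → ℂ,
    IsBoundedFamily a (negLog A) ς ∧
    (∀ j ∈ negLog A, ∀ μ, ¬ IsMinimalIndex A j μ → (¬ ∃ μ', StrictPrec A C j μ μ') →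
      CancelsIn (classCoords e A C j μ) (ς j)) ∧
    ∀ φ : 𝓓((⊤ : Opens (EuclideanSpace ℝ (Fin N))), ℝ),
      HasSum (fun j : negLog A => ∫ t, dilFun e j.1 (ς j.1) t * (φ t : ℂ)) (K φ)}

/-- Elements of `𝒦(N, e, a, 𝒜)` are supported in `B^N(a)`: they annihilate each test function that
vanishes there. In particular pairings with smooth functions do not depend on the cutoff used. -/
theorem kernelClass_apply_eq_zero {N ν : ℕ} (e : Fin N → Fin ν → ℝ) (he : ∀ i μ, 0 ≤ e i μ) (a : ℝ)
    (A : Set (Fin ν → ℝ)) (K : 𝓓'((⊤ : Opens (EuclideanSpace ℝ (Fin N))), ℂ))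
    (hK : K ∈ kernelClass N e a A)
    (φ : 𝓓((⊤ : Opens (EuclideanSpace ℝ (Fin N))), ℝ)) (hφ : ∀ t ∈ Metric.ball 0 a, φ t = 0) :
    K φ = 0 := by
  obtain ⟨C, -, ς, ⟨-, ⟨r, hr, hs⟩, -⟩, -, hsum⟩ := hK
  refine (hsum φ).unique ?_
  have : (fun j : negLog A => ∫ t, dilFun e j.1 (ς j.1) t * (φ t : ℂ)) = fun _ => 0 := by
    funext j
    rw [← integral_zero (EuclideanSpace ℝ (Fin N)) ℂ (μ := volume)]
    congr 1; funext t
    by_cases ht : t ∈ Metric.ball 0 a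
    · simp [hφ t ht]
    · have hle : ‖t‖ ≤ ‖dilate e (fun μ => (2 : ℝ) ^ j.1 μ) t‖ := by
        rw [EuclideanSpace.norm_eq, EuclideanSpace.norm_eq]
        apply Real.sqrt_le_sqrt
        apply Finset.sum_le_sum
        intro i _
        apply pow_le_pow_left₀ (norm_nonneg _)
        simp only [dilate, norm_mul]
        apply le_mul_of_one_le_left (norm_nonneg _)
        rw [Real.norm_of_nonneg (by positivity)]
        apply Finset.one_le_prod
        intro μ _
        exact Real.one_le_rpow (one_le_pow₀ (by norm_num)) (he i μ)
      have h0 : ς j.1 (dilate e (fun μ => (2 : ℝ) ^ j.1 μ) t) = 0 := by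
        apply image_eq_zero_of_notMem_tsupport
        intro hm
        have := hs j.1 j.2 hm
        simp at this ht
        linarith
      simp [dilFun, h0]
  rw [this]; exact hasSum_zero

/-! ### The pairing of a compactly supported distribution with a smooth function -/

/-- A smooth compactly supported function on `ℝ^N` that equals `1` on the ball `B^N(a)`. -/
def cutoff (N : ℕ) (a : ℝ) : ContDiffBump (0 : EuclideanSpace ℝ (Fin N)) where
  rIn := |a| + 1
  rOut := |a| + 2
  rIn_pos := by positivity
  rIn_lt_rOut := by linarith

/-- The test function `χ g`, where `χ` is `cutoff N a` and `g` is smooth. -/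
def cutoffMul {N : ℕ} (a : ℝ) (g : EuclideanSpace ℝ (Fin N) → ℝ) (hg : ContDiff ℝ ∞ g) :
    𝓓((⊤ : Opens (EuclideanSpace ℝ (Fin N))), ℝ) where
  toFun t := cutoff N a t * g t
  contDiff' := (cutoff N a).contDiff.mul hg
  hasCompactSupport' := (cutoff N a).hasCompactSupport.mul_right
  tsupport_subset' := by simp

/-- The pairing `∫ g(t) K(t) dt` of a distribution `K` whose support is a compact subset of
`B^N(a)` with a smooth complex-valued function `g`, that is `⟨K, χ g⟩` for a cutoff function `χ`
equal to `1` on `B^N(a)`. (Distributions act on real test functions, so that real and imaginary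
parts are paired separately.) -/
def pairSmooth {N : ℕ} (a : ℝ) (K : 𝓓'((⊤ : Opens (EuclideanSpace ℝ (Fin N))), ℂ))
    (g : EuclideanSpace ℝ (Fin N) → ℂ) (hg : ContDiff ℝ ∞ g) : ℂ :=
  K (cutoffMul a (fun t => (g t).re) (Complex.reCLM.contDiff.comp hg)) +
    Complex.I * K (cutoffMul a (fun t => (g t).im) (Complex.imCLM.contDiff.comp hg))

/-! ### The translation-invariant operators on `ℝ` -/

/-- The value at `(s, t)` of a polynomial in two variables is smooth. -/
theorem contDiff_eval (p : MvPolynomial (Fin 2) ℝ) :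
    ContDiff ℝ ∞ fun t : EuclideanSpace ℝ (Fin 2) => MvPolynomial.eval (fun i => t i) p := by
  induction p using MvPolynomial.induction_on with
  | C c => simpa using contDiff_const
  | add p q hp hq => simpa using hp.add hq
  | mul_X p i hp =>
    have hi : ContDiff ℝ ∞ fun t : EuclideanSpace ℝ (Fin 2) => t i := by fun_prop
    simpa using hp.mul hi

theorem contDiff_translate (p : MvPolynomial (Fin 2) ℝ)
    (f : 𝓓((⊤ : Opens ℝ), ℂ)) (x : ℝ) :
    ContDiff ℝ ∞ fun t : EuclideanSpace ℝ (Fin 2) =>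
      f (x - MvPolynomial.eval (fun i => t i) p) :=
  f.contDiff.comp (contDiff_const.sub (contDiff_eval p))

/-- `T_K f(x) = ∫ f(x - p(s, t)) K(s, t) ds dt` for a distribution `K` whose support is a compact
subset of `B²(a₀)` and `f ∈ C_0^∞(ℝ)`. -/
def opT (a₀ : ℝ) (p : MvPolynomial (Fin 2) ℝ)
    (K : 𝓓'((⊤ : Opens (EuclideanSpace ℝ (Fin 2))), ℂ)) (f : 𝓓((⊤ : Opens ℝ), ℂ)) (x : ℝ) : ℂ :=
  pairSmooth a₀ K (fun t => f (x - MvPolynomial.eval (fun i => t i) p))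
    (contDiff_translate p f x)

/-- The class in `L²(ℝ)` of a test function. -/
def testToL2 (f : 𝓓((⊤ : Opens ℝ), ℂ)) : Lp ℂ 2 (volume : Measure ℝ) :=
  (f.continuous.memLp_of_hasCompactSupport (μ := volume) (p := 2) f.hasCompactSupport).toLp f

/-- `T_K`, initially defined on `C_0^∞(ℝ)`, extends to a bounded operator
`L²(ℝ) → L²(ℝ)`. -/
def IsL2Bounded (a₀ : ℝ) (p : MvPolynomial (Fin 2) ℝ)
    (K : 𝓓'((⊤ : Opens (EuclideanSpace ℝ (Fin 2))), ℂ)) : Prop :=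
  ∃ T : Lp ℂ 2 (volume : Measure ℝ) →L[ℂ] Lp ℂ 2 (volume : Measure ℝ),
    ∀ f : 𝓓((⊤ : Opens ℝ), ℂ), T (testToL2 f) =ᵐ[volume] opT a₀ p K f

/-- The exponents `e = ((1,0), (0,1))`, that is, the dilations
`(δ₁, δ₂)(s, t) = (δ₁ s, δ₂ t)`. -/
def stdExp : Fin 2 → Fin 2 → ℝ := ![![1, 0], ![0, 1]]

/-- The set `𝒜 = {(δ₁, δ₂) ∈ [0,1]² : δ₁ ≤ δ₂}`. -/
def flagSet : Set (Fin 2 → ℝ) :=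
  {δ | (∀ μ, δ μ ∈ Set.Icc (0 : ℝ) 1) ∧ δ 0 ≤ δ 1}

/-- The multi-index `α`, as a point of the plane, lies on or above the line through `P` and `Q`:
some point of that line lies at or vertically below `α`. -/
def OnOrAboveLine (P Q : ℝ × ℝ) (α : Fin 2 →₀ ℕ) : Prop :=
  ∃ y : ℝ, ((α 0 : ℝ), y) ∈ line[ℝ, P, Q] ∧ y ≤ (α 1 : ℝ)

end MultiParam

end

/-! On the flag write `j = (k + l, k)` with `k, l ≥ 0`. Whatever `C` is, a piece `ς_j` has mean zero
in `s` when `l > 0` and in `t` when `k > 0`. The operator is a convolution, with multiplier `Σ_j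
m_j`, where `m_j(ξ) = ∫ ς_j(t) e^{-2πiξ p(2^{-j} t)} dt` (`pieceMul`). The condition on the line
says that all monomials of `p` have degree at least `b` (`onOrAboveLine_iff`).

Sufficiency. If all degrees are at least `b`, then `2^{kb} p(2^{-k-l} s, 2^{-k} t)` has bounded
coefficients, its coefficient of `t^b` is a fixed nonzero number, and the terms containing `s` are
`O(2^{-l})`. With `L = 2π|ξ| 2^{-kb}`, cancellation gives `|m_j| ≲ L 2^{-l}` for `j ≠ 0`. A van der
Corput estimate in `t` gives `|m_j| ≲ L^{-θ}` when `L ≥ 1`. It needs the `b`-th derivative in `t`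
bounded below, hence small supports; this is the source of `ε` (`exists_norm_pieceMul_le_rpow`).
Together these give geometric decay in `|log₂ L| + l`. As `k` varies, `log₂ L` runs through an
arithmetic progression, so `Σ_j |m_j(ξ)|` is bounded uniformly in `ξ`
(`exists_sum_norm_pieceMul_le`), and Plancherel finishes.

Necessity. Fix one bump `ς` with cancellation in both variables. Every bounded sequence `ε_j`
supported in the interior of the flag gives an admissible kernel `Σ ε_j ς^{(2^j)}`. If all these
operators are bounded, Banach–Steinhaus on `ℓ^∞` bounds `Σ_j |m_j(ξ)|` uniformly in `ξ`
(`exists_sum_norm_pieceMul_le_of_isL2Bounded`). Suppose that the least degree `d` in `p` is below `b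
≤ a`. The monomial `β` of degree `d` with least exponent of `s` is then mixed. At scales with `l`
large and `k` much larger than `l` it dominates `p`, and `p(2^{-j}·)` is essentially `2^{-W}` times
that monomial, with `W = kd + lβ₀`. Arbitrarily many such pairs `(k, l)` share the same `W`, so at
one frequency of size about `2^W` arbitrarily many `|m_j|` exceed a fixed constant: a contradiction
(`exists_not_isL2Bounded`). -/

namespace MultiParam

/-! ### One-dimensional oscillatory integrals -/

/-- Integration by parts against an amplitude that is damped near the critical points. -/
lemma norm_integral_damped_le {g₁ g₂ : ℝ → ℝ} {w κ ψ ψ' : ℝ → ℂ} {B W M r δ : ℝ}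
    (hr : 0 < r) (hr1 : r ≤ 1) (hδ : 0 < δ) (hδ1 : δ ≤ 1) (hM : 0 ≤ M)
    (hg : ∀ x, HasDerivAt g₁ (g₂ x) x) (hg₂ : Continuous g₂)
    (hB : ∀ x ∈ Set.Icc (-r) r, |g₂ x| ≤ B)
    (hw : ∀ x, HasDerivAt w (g₁ x * κ x) x) (hκ : Continuous κ)
    (hW : ∀ x ∈ Set.Icc (-r) r, ‖w x‖ ≤ W)
    (hψ : ∀ x, HasDerivAt ψ (ψ' x) x) (hψ' : Continuous ψ')
    (hψM : ∀ x, ‖ψ x‖ ≤ M) (hψ'M : ∀ x, ‖ψ' x‖ ≤ M) :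
    ‖∫ x in (-r)..r, κ x * ((g₁ x ^ 2 / (g₁ x ^ 2 + δ ^ 2) : ℝ) : ℂ) * ψ x‖ ≤
      W * M * (2 * B + 4) / δ ^ 2 := by
  have hg₁ : Continuous g₁ := continuous_iff_continuousAt.2 fun x => (hg x).continuousAt
  have hpos : ∀ x, 0 < g₁ x ^ 2 + δ ^ 2 := fun x => by positivity
  -- Since `w' = g₁ κ`, the integrand is `w' · (q ψ)`; the damping removes the singularity that
  -- dividing by `g₁` would create at critical points.
  set q : ℝ → ℝ := fun x => g₁ x / (g₁ x ^ 2 + δ ^ 2) with hq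
  set q' : ℝ → ℝ := fun x => g₂ x * (δ ^ 2 - g₁ x ^ 2) / (g₁ x ^ 2 + δ ^ 2) ^ 2 with hq'
  have hqd : ∀ x, HasDerivAt q (q' x) x := by
    intro x
    have h1 : HasDerivAt (fun x => g₁ x ^ 2 + δ ^ 2) (2 * g₁ x * g₂ x) x := by
      simpa using ((hg x).pow 2).add_const (δ ^ 2)
    convert! (hg x).div h1 (hpos x).ne' using 1
    simp only [hq']
    congr 1
    ring
  have hq'c : Continuous q' :=
    (hg₂.mul (continuous_const.sub (hg₁.pow 2))).div (((hg₁.pow 2).add continuous_const).pow 2)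
      fun x => (pow_pos (hpos x) 2).ne'
  have hB0 : 0 ≤ B := (abs_nonneg _).trans (hB 0 ⟨by linarith, hr.le⟩)
  have hW0 : 0 ≤ W := (norm_nonneg _).trans (hW 0 ⟨by linarith, hr.le⟩)
  have hδ2 : 0 < δ ^ 2 := by positivity
  have hqb : ∀ x, |q x| ≤ 1 / δ ^ 2 := by
    intro x
    rw [hq]
    simp only
    rw [abs_div, abs_of_pos (hpos x), div_le_div_iff₀ (hpos x) hδ2]
    -- The true bound for `q` is of order `1 / δ`; the weaker `1 / δ ^ 2`, which uses `δ ≤ 1`, puts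
    -- all terms over the same power.
    have h2 : |g₁ x| * δ ≤ g₁ x ^ 2 + δ ^ 2 := by
      nlinarith [sq_nonneg (|g₁ x| - δ), sq_abs (g₁ x), sq_nonneg (g₁ x)]
    nlinarith [mul_nonneg (abs_nonneg (g₁ x)) hδ.le]
  have hq'b : ∀ x ∈ Set.Icc (-r) r, |q' x| ≤ B / δ ^ 2 := by
    intro x hx
    rw [hq']
    simp only
    rw [abs_div, abs_mul, abs_of_pos (pow_pos (hpos x) 2), div_le_div_iff₀ (pow_pos (hpos x) 2) hδ2]
    have h3 : |δ ^ 2 - g₁ x ^ 2| ≤ g₁ x ^ 2 + δ ^ 2 := by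
      rw [abs_le]; constructor <;> nlinarith [sq_nonneg (g₁ x)]
    calc |g₂ x| * |δ ^ 2 - g₁ x ^ 2| * δ ^ 2
        ≤ B * (g₁ x ^ 2 + δ ^ 2) * (g₁ x ^ 2 + δ ^ 2) := by
          gcongr
          · exact hB x hx
          · nlinarith [sq_nonneg (g₁ x)]
      _ = B * (g₁ x ^ 2 + δ ^ 2) ^ 2 := by ring
  set V : ℝ → ℂ := fun x => (q x : ℂ) * ψ x with hV
  set V' : ℝ → ℂ := fun x => (q' x : ℂ) * ψ x + (q x : ℂ) * ψ' x with hV'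
  have hVd : ∀ x, HasDerivAt V (V' x) x := fun x => (hqd x).ofReal_comp.mul (hψ x)
  have hψc : Continuous ψ := continuous_iff_continuousAt.2 fun x => (hψ x).continuousAt
  have hqc : Continuous q := continuous_iff_continuousAt.2 fun x => (hqd x).continuousAt
  have hV'c : Continuous V' := by fun_prop
  have hparts := intervalIntegral.integral_mul_deriv_eq_deriv_mul (a := -r) (b := r)
    (fun x _ => hVd x) (fun x _ => hw x) (hV'c.intervalIntegrable _ _)
    ((by fun_prop : Continuous fun x => (g₁ x : ℂ) * κ x).intervalIntegrable _ _)
  have heq : (∫ x in (-r)..r, κ x * ((g₁ x ^ 2 / (g₁ x ^ 2 + δ ^ 2) : ℝ) : ℂ) * ψ x) =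
      ∫ x in (-r)..r, V x * ((g₁ x : ℂ) * κ x) := by
    congr 1; funext x
    simp only [hV, hq]; push_cast; ring
  have hVb : ∀ x, ‖V x‖ ≤ M / δ ^ 2 := by
    intro x
    rw [hV]; simp only
    rw [norm_mul, Complex.norm_real, Real.norm_eq_abs]
    calc |q x| * ‖ψ x‖ ≤ 1 / δ ^ 2 * M := by gcongr; exacts [hqb x, hψM x]
      _ = M / δ ^ 2 := by ring
  have hV'b : ∀ x ∈ Set.Icc (-r) r, ‖V' x‖ ≤ M * (B + 1) / δ ^ 2 := by
    intro x hx
    rw [hV']; simp only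
    refine (norm_add_le _ _).trans ?_
    rw [norm_mul, norm_mul, Complex.norm_real, Complex.norm_real, Real.norm_eq_abs,
      Real.norm_eq_abs]
    calc |q' x| * ‖ψ x‖ + |q x| * ‖ψ' x‖ ≤ B / δ ^ 2 * M + 1 / δ ^ 2 * M := by
          gcongr; exacts [hq'b x hx, hψM x, hqb x, hψ'M x]
      _ = M * (B + 1) / δ ^ 2 := by ring
  have hint : ‖∫ x in (-r)..r, V' x * w x‖ ≤ M * (B + 1) / δ ^ 2 * W * |r - -r| := by
    apply intervalIntegral.norm_integral_le_of_norm_le_const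
    intro x hx
    rw [Set.uIoc_of_le (by linarith)] at hx
    have hx' : x ∈ Set.Icc (-r) r := ⟨hx.1.le, hx.2⟩
    rw [norm_mul]
    gcongr
    exacts [hV'b x hx', hW x hx']
  rw [heq, hparts]
  have hend : ∀ x ∈ Set.Icc (-r) r, ‖V x * w x‖ ≤ M / δ ^ 2 * W := by
    intro x hx
    rw [norm_mul]
    gcongr
    exacts [hVb x, hW x hx]
  have e1 := hend r ⟨by linarith, le_rfl⟩
  have e2 := hend (-r) ⟨le_rfl, by linarith⟩
  have habs : |r - -r| ≤ 2 := by rw [abs_of_nonneg] <;> linarith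
  have hnn : 0 ≤ M * (B + 1) / δ ^ 2 * W := by positivity
  calc ‖V r * w r - V (-r) * w (-r) - ∫ x in (-r)..r, V' x * w x‖
      ≤ ‖V r * w r‖ + ‖V (-r) * w (-r)‖ + ‖∫ x in (-r)..r, V' x * w x‖ :=
        (norm_sub_le _ _).trans (by gcongr; exact norm_sub_le _ _)
    _ ≤ M / δ ^ 2 * W + M / δ ^ 2 * W + M * (B + 1) / δ ^ 2 * W * 2 := by
        gcongr
        exact hint.trans (by gcongr)
    _ = W * M * (2 * B + 4) / δ ^ 2 := by ring

/-- A sublevel set estimate, in smoothed form: if the `n`-th derivative of `g 0` is bounded below,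
then `g 0` is rarely small. -/
lemma integral_saturation_le (n : ℕ) (B c : ℝ) (hc : 0 < c) :
    ∃ θ : ℝ, 0 < θ ∧ ∃ C ≥ 0, ∀ r : ℝ, 0 < r → r ≤ 1 → ∀ g : ℕ → ℝ → ℝ,
      (∀ k x, HasDerivAt (g k) (g (k + 1) x) x) →
      (∀ k ≤ n + 1, ∀ x ∈ Set.Icc (-r) r, |g k x| ≤ B) →
      (∀ x ∈ Set.Icc (-r) r, c ≤ |g n x|) →
      ∀ η : ℝ, 0 < η → η ≤ 1 →
        ∫ x in (-r)..r, η ^ 2 / (g 0 x ^ 2 + η ^ 2) ≤ C * η ^ θ := by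
  induction n with
  | zero =>
    refine ⟨1, one_pos, 2 / c ^ 2, by positivity, fun r hr hr1 g hg _ hlow η hη hη1 => ?_⟩
    have hgc : Continuous (g 0) := continuous_iff_continuousAt.2 fun x => (hg 0 x).continuousAt
    have hle : ∫ x in (-r)..r, η ^ 2 / (g 0 x ^ 2 + η ^ 2) ≤ ∫ x in (-r)..r, η / c ^ 2 := by
      apply intervalIntegral.integral_mono_on (by linarith)
      · exact (Continuous.div (by fun_prop) (by fun_prop)
          fun x => by positivity).intervalIntegrable _ _
      · simp
      · intro x hx
        have h1 := hlow x hx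
        have h2 : c ^ 2 ≤ g 0 x ^ 2 := by
          rw [← sq_abs (g 0 x)]; gcongr
        have h3 : η ^ 2 ≤ η := by nlinarith
        gcongr
        nlinarith [sq_nonneg η]
    refine hle.trans ?_
    rw [intervalIntegral.integral_const, smul_eq_mul, Real.rpow_one]
    have : (r - -r) ≤ 2 := by linarith
    calc (r - -r) * (η / c ^ 2) ≤ 2 * (η / c ^ 2) := by gcongr
      _ = 2 / c ^ 2 * η := by ring
  | succ n ih =>
    obtain ⟨θ, hθ, C, hC, H⟩ := ih
    -- The cutoff `δ = η^{1/4}` makes the set where `g 1` is small contribute `δ^θ = η^{θ/4}` by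
    -- induction, and the integration by parts contribute `η / δ² = η^{1/2}`.
    refine ⟨min (θ / 4) (1 / 2), by positivity, C + 2 * (2 * |B| + 4), by positivity,
      fun r hr hr1 g hg hB hlow η hη hη1 => ?_⟩
    have hgc : ∀ k, Continuous (g k) :=
      fun k => continuous_iff_continuousAt.2 fun x => (hg k x).continuousAt
    set δ : ℝ := η ^ (1 / 4 : ℝ) with hδdef
    have hδ : 0 < δ := by positivity
    have hδ1 : δ ≤ 1 := Real.rpow_le_one hη.le hη1 (by norm_num)
    have hI := H r hr hr1 (fun k => g (k + 1)) (fun k x => hg (k + 1) x)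
      (fun k hk x hx => hB (k + 1) (by omega) x hx) hlow δ hδ hδ1
    simp only [zero_add] at hI
    have hpos : ∀ x, 0 < g 0 x ^ 2 + η ^ 2 := fun x => by positivity
    have hpos1 : ∀ x, 0 < g 1 x ^ 2 + δ ^ 2 := fun x => by positivity
    -- The primitive `η arctan(g 0 / η)` is at most `2η` in size, so the saturated weight behaves
    -- like an oscillating factor of frequency `1 / η`.
    have hJ := norm_integral_damped_le (g₁ := g 1) (g₂ := g 2)
      (w := fun x => ((η * Real.arctan (g 0 x / η) : ℝ) : ℂ))
      (κ := fun x => ((η ^ 2 / (g 0 x ^ 2 + η ^ 2) : ℝ) : ℂ)) (ψ := fun _ => 1)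
      (ψ' := fun _ => 0) (B := |B|) (W := 2 * η) (M := 1) (r := r) (δ := δ) hr hr1 hδ hδ1
      zero_le_one (hg 1) (hgc 2) (fun x hx => (hB 2 (by omega) x hx).trans (le_abs_self B))
      (fun x => by
        have h := (((hg 0 x).div_const η).arctan.const_mul η).ofReal_comp
        convert! h using 1
        rw [← Complex.ofReal_mul]
        congr 1
        have := hpos x
        field_simp
        ring)
      (Complex.continuous_ofReal.comp (Continuous.div (by fun_prop) (by fun_prop)
        fun x => (hpos x).ne'))
      (fun x _ => by
        rw [Complex.norm_real, Real.norm_eq_abs, abs_mul, abs_of_pos hη, mul_comm]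
        gcongr
        have h1 := Real.arctan_lt_pi_div_two (g 0 x / η)
        have h2 := Real.neg_pi_div_two_lt_arctan (g 0 x / η)
        have h3 := Real.pi_lt_four
        rw [abs_le]; constructor <;> linarith)
      (fun x => hasDerivAt_const x 1) continuous_const (by simp) (by simp)
    simp only [mul_one] at hJ
    set F : ℝ → ℝ := fun x => η ^ 2 / (g 0 x ^ 2 + η ^ 2) with hF
    set G : ℝ → ℝ := fun x => g 1 x ^ 2 / (g 1 x ^ 2 + δ ^ 2) with hG
    set D : ℝ → ℝ := fun x => δ ^ 2 / (g 1 x ^ 2 + δ ^ 2) with hD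
    have hFc : Continuous F := Continuous.div (by fun_prop) (by fun_prop) fun x => (hpos x).ne'
    have hGc : Continuous G := Continuous.div (by fun_prop) (by fun_prop) fun x => (hpos1 x).ne'
    have hDc : Continuous D := Continuous.div (by fun_prop) (by fun_prop) fun x => (hpos1 x).ne'
    -- Split with `1 = D + G` and use `F ≤ 1` on the part carrying `D`.
    have hsplit : ∫ x in (-r)..r, F x ≤ (∫ x in (-r)..r, D x) + ∫ x in (-r)..r, F x * G x := by
      rw [← intervalIntegral.integral_add (hDc.intervalIntegrable _ _)
        ((by fun_prop : Continuous fun x => F x * G x).intervalIntegrable _ _)]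
      apply intervalIntegral.integral_mono_on (by linarith) (hFc.intervalIntegrable _ _)
        ((hDc.add (hFc.mul hGc)).intervalIntegrable _ _)
      intro x _
      have h1 : D x = 1 - G x := by
        simp only [hD, hG]; have := hpos1 x; field_simp; ring
      have h2 : F x ≤ 1 := by
        simp only [hF]; rw [div_le_one (hpos x)]; nlinarith [sq_nonneg (g 0 x)]
      have h3 : 0 ≤ D x := by simp only [hD]; have := hpos1 x; positivity
      change F x ≤ D x + F x * G x
      nlinarith
    have hJ' : ∫ x in (-r)..r, F x * G x ≤ 2 * η * (2 * |B| + 4) / δ ^ 2 := by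
      have hcast : (∫ x in (-r)..r, ((F x : ℝ) : ℂ) * ((G x : ℝ) : ℂ)) =
          ((∫ x in (-r)..r, F x * G x : ℝ) : ℂ) := by
        rw [← intervalIntegral.integral_ofReal]; congr 1; funext x; push_cast; rfl
      rw [hcast, Complex.norm_real] at hJ
      exact (le_abs_self _).trans hJ
    have hδ2 : δ ^ 2 = η ^ (1 / 2 : ℝ) := by
      rw [hδdef, ← Real.rpow_natCast, ← Real.rpow_mul hη.le]; norm_num
    have hdiv : η / δ ^ 2 = η ^ (1 / 2 : ℝ) := by
      rw [hδ2]
      nth_rewrite 1 [← Real.rpow_one η]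
      rw [← Real.rpow_sub hη]; norm_num
    have hδθ : δ ^ θ = η ^ (θ / 4) := by
      rw [hδdef, ← Real.rpow_mul hη.le]; congr 1; ring
    have hm1 : η ^ (θ / 4) ≤ η ^ min (θ / 4) (1 / 2) :=
      Real.rpow_le_rpow_of_exponent_ge hη hη1 (min_le_left _ _)
    have hm2 : η ^ (1 / 2 : ℝ) ≤ η ^ min (θ / 4) (1 / 2) :=
      Real.rpow_le_rpow_of_exponent_ge hη hη1 (min_le_right _ _)
    calc ∫ x in (-r)..r, F x ≤ C * δ ^ θ + 2 * η * (2 * |B| + 4) / δ ^ 2 := by linarith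
      _ = C * η ^ (θ / 4) + 2 * (2 * |B| + 4) * η ^ (1 / 2 : ℝ) := by
        rw [hδθ, ← hdiv]; ring
      _ ≤ C * η ^ min (θ / 4) (1 / 2) + 2 * (2 * |B| + 4) * η ^ min (θ / 4) (1 / 2) := by
        gcongr
      _ = _ := by ring

/-- A van der Corput estimate with an unspecified power of decay. -/
lemma norm_oscillatory_integral_le (n : ℕ) (B c : ℝ) (hc : 0 < c) :
    ∃ θ : ℝ, 0 < θ ∧ ∃ C ≥ 0, ∀ r : ℝ, 0 < r → r ≤ 1 → ∀ g : ℕ → ℝ → ℝ,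
      (∀ k x, HasDerivAt (g k) (g (k + 1) x) x) →
      (∀ k ≤ n + 2, ∀ x ∈ Set.Icc (-r) r, |g k x| ≤ B) →
      (∀ x ∈ Set.Icc (-r) r, c ≤ |g (n + 1) x|) →
      ∀ (ψ ψ' : ℝ → ℂ) (M : ℝ), 0 ≤ M → (∀ x, HasDerivAt ψ (ψ' x) x) → Continuous ψ' →
      (∀ x, ‖ψ x‖ ≤ M) → (∀ x, ‖ψ' x‖ ≤ M) → ∀ lam : ℝ, 1 ≤ |lam| →
        ‖∫ x in (-r)..r, Complex.exp (((lam * g 0 x : ℝ) : ℂ) * Complex.I) * ψ x‖ ≤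
          C * M * |lam| ^ (-θ) := by
  obtain ⟨θ, hθ, C, hC, H⟩ := integral_saturation_le n B c hc
  refine ⟨min (θ / 4) (1 / 2), by positivity, C + (2 * |B| + 4), by positivity, ?_⟩
  intro r hr hr1 g hg hB hlow ψ ψ' M hM hψ hψ' hψM hψ'M lam hlam
  have hgc : ∀ k, Continuous (g k) :=
    fun k => continuous_iff_continuousAt.2 fun x => (hg k x).continuousAt
  have hψc : Continuous ψ := continuous_iff_continuousAt.2 fun x => (hψ x).continuousAt
  have hl0 : 0 < |lam| := by linarith
  have hlne : lam ≠ 0 := by simpa using hl0.ne'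
  -- The same splitting as for the sublevel estimate, with `1 / |lam|` in the role of `η`: the part
  -- near critical points of `g 0` is the sublevel estimate for `g 1`, the rest is an integration by
  -- parts with primitive `κ / (i lam)`.
  set δ : ℝ := |lam| ^ (-(1 / 4) : ℝ) with hδdef
  have hδ : 0 < δ := by positivity
  have hδ1 : δ ≤ 1 := Real.rpow_le_one_of_one_le_of_nonpos hlam (by norm_num)
  have hI := H r hr hr1 (fun k => g (k + 1)) (fun k x => hg (k + 1) x)
    (fun k hk x hx => hB (k + 1) (by omega) x hx) hlow δ hδ hδ1
  simp only [zero_add] at hI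
  have hpos1 : ∀ x, 0 < g 1 x ^ 2 + δ ^ 2 := fun x => by positivity
  set κ : ℝ → ℂ := fun x => Complex.exp (((lam * g 0 x : ℝ) : ℂ) * Complex.I) with hκ
  have hκc : Continuous κ := by fun_prop
  have hκn : ∀ x, ‖κ x‖ = 1 := fun x => Complex.norm_exp_ofReal_mul_I _
  have hJ := norm_integral_damped_le (g₁ := g 1) (g₂ := g 2)
    (w := fun x => κ x / (lam * Complex.I)) (κ := κ) (ψ := ψ) (ψ' := ψ') (B := |B|)
    (W := 1 / |lam|) (M := M) (r := r) (δ := δ) hr hr1 hδ hδ1 hM (hg 1) (hgc 2)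
    (fun x hx => (hB 2 (by omega) x hx).trans (le_abs_self B))
    (fun x => by
      have h := ((((hg 0 x).const_mul lam).ofReal_comp.mul_const Complex.I).cexp).div_const
        ((lam : ℂ) * Complex.I)
      convert! h using 1
      simp only [hκ]
      have hl' : (lam : ℂ) ≠ 0 := by exact_mod_cast hlne
      push_cast
      field_simp)
    hκc
    (fun x _ => by rw [norm_div, hκn, norm_mul, Complex.norm_I, mul_one, Complex.norm_real,
      Real.norm_eq_abs]) hψ hψ' hψM hψ'M
  set G : ℝ → ℝ := fun x => g 1 x ^ 2 / (g 1 x ^ 2 + δ ^ 2) with hG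
  set D : ℝ → ℝ := fun x => δ ^ 2 / (g 1 x ^ 2 + δ ^ 2) with hD
  have hGc : Continuous G := Continuous.div (by fun_prop) (by fun_prop) fun x => (hpos1 x).ne'
  have hDc : Continuous D := Continuous.div (by fun_prop) (by fun_prop) fun x => (hpos1 x).ne'
  have hsum : ∀ x, D x + G x = 1 := fun x => by
    simp only [hD, hG]; have := hpos1 x; field_simp; ring
  have hsplit : (∫ x in (-r)..r, κ x * ψ x) = (∫ x in (-r)..r, (D x : ℂ) * (κ x * ψ x)) +
      ∫ x in (-r)..r, κ x * (G x : ℂ) * ψ x := by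
    rw [← intervalIntegral.integral_add
      ((by fun_prop : Continuous fun x => (D x : ℂ) * (κ x * ψ x)).intervalIntegrable _ _)
      ((by fun_prop : Continuous fun x => κ x * (G x : ℂ) * ψ x).intervalIntegrable _ _)]
    congr 1; funext x
    have h1 : (D x : ℂ) + (G x : ℂ) = 1 := by exact_mod_cast hsum x
    linear_combination (-(κ x * ψ x)) * h1
  have hD' : ‖∫ x in (-r)..r, (D x : ℂ) * (κ x * ψ x)‖ ≤ (∫ x in (-r)..r, D x) * M := by
    rw [← intervalIntegral.integral_mul_const]
    apply intervalIntegral.norm_integral_le_of_norm_le (by linarith)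
    · refine Filter.Eventually.of_forall fun x _ => ?_
      have h3 : 0 ≤ D x := by simp only [hD]; have := hpos1 x; positivity
      rw [norm_mul, norm_mul, hκn, one_mul, Complex.norm_real, Real.norm_of_nonneg h3]
      gcongr
      exact hψM x
    · exact ((hDc.mul continuous_const).intervalIntegrable _ _)
  have hδθ : δ ^ θ = |lam| ^ (-(θ / 4)) := by
    rw [hδdef, ← Real.rpow_mul hl0.le]; congr 1; ring
  have hδ2 : 1 / |lam| / δ ^ 2 = |lam| ^ (-(1 / 2) : ℝ) := by
    have : δ ^ 2 = |lam| ^ (-(1 / 2) : ℝ) := by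
      rw [hδdef, ← Real.rpow_natCast, ← Real.rpow_mul hl0.le]; norm_num
    rw [this, one_div, ← Real.rpow_neg_one, ← Real.rpow_sub hl0]; norm_num
  have hm1 : |lam| ^ (-(θ / 4)) ≤ |lam| ^ (-min (θ / 4) (1 / 2)) :=
    Real.rpow_le_rpow_of_exponent_le hlam (neg_le_neg (min_le_left _ _))
  have hm2 : |lam| ^ (-(1 / 2) : ℝ) ≤ |lam| ^ (-min (θ / 4) (1 / 2)) :=
    Real.rpow_le_rpow_of_exponent_le hlam (neg_le_neg (min_le_right _ _))
  rw [hsplit]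
  calc _ ≤ ‖∫ x in (-r)..r, (D x : ℂ) * (κ x * ψ x)‖ +
        ‖∫ x in (-r)..r, κ x * (G x : ℂ) * ψ x‖ := norm_add_le _ _
    _ ≤ C * δ ^ θ * M + 1 / |lam| * M * (2 * |B| + 4) / δ ^ 2 := by
        gcongr
        exact hD'.trans (by gcongr)
    _ = C * M * δ ^ θ + (2 * |B| + 4) * M * (1 / |lam| / δ ^ 2) := by ring
    _ ≤ C * M * |lam| ^ (-min (θ / 4) (1 / 2)) +
        (2 * |B| + 4) * M * |lam| ^ (-min (θ / 4) (1 / 2)) := by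
        rw [hδθ, hδ2]; gcongr
    _ = _ := by ring

/-! ### The combinatorics of the flag `{δ₁ ≤ δ₂}` -/

lemma mem_negLog_flagSet {j : Fin 2 → ℕ} : j ∈ negLog flagSet ↔ j 1 ≤ j 0 := by
  have h2 : (1 : ℝ) < 2 := by norm_num
  constructor
  · rintro ⟨-, h⟩
    have h' := (inv_le_inv₀ (by positivity) (by positivity)).1 h
    exact (pow_le_pow_iff_right₀ h2).1 h'
  · intro h
    refine ⟨fun μ => ⟨by positivity, inv_le_one_of_one_le₀ (one_le_pow₀ h2.le)⟩, ?_⟩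
    exact (inv_le_inv₀ (by positivity) (by positivity)).2 ((pow_le_pow_iff_right₀ h2).2 h)

lemma isMinimalIndex_flagSet {j : Fin 2 → ℕ} {μ : Fin 2} :
    IsMinimalIndex flagSet j μ ↔ j μ = 0 := by
  constructor
  · intro h
    by_contra h0
    exact h ⟨0, mem_negLog_flagSet.2 le_rfl, Nat.pos_of_ne_zero h0⟩
  · rintro h ⟨k, -, hk⟩
    omega

lemma prec_refl {ν : ℕ} {A : Set (Fin ν → ℝ)} {C : ℝ} (hC : 1 ≤ C) (j : Fin ν → ℕ) (μ : Fin ν) :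
    Prec A C j μ μ := by
  intro k _ hk
  have : (k μ : ℝ) < j μ := by exact_mod_cast hk
  nlinarith

/-- Strictly below the diagonal of the flag, `j 0` can be lowered by one while `j 1` stays fixed,
which defeats every constant `C`. -/
lemma not_prec_zero_one {C : ℝ} {j : Fin 2 → ℕ} (hj : j 1 < j 0) :
    ¬ Prec flagSet C j 0 1 := by
  intro h
  have := h ![j 0 - 1, j 1] (mem_negLog_flagSet.2 (by simp; omega)) (by simp; omega)
  simp at this
  omega

/-- `j 1` can always be lowered to `0` without moving `j 0`, so this holds on the diagonal `j 0 = j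
1` as well. -/
lemma not_prec_one_zero {C : ℝ} {j : Fin 2 → ℕ} (hj : 0 < j 1) :
    ¬ Prec flagSet C j 1 0 := by
  intro h
  have := h ![j 0, 0] (mem_negLog_flagSet.2 (by simp)) (by simpa using hj)
  simp at this
  omega

/-- There are only two indices, and no index strictly precedes itself. -/
lemma not_exists_strictPrec {A : Set (Fin 2 → ℝ)} {C : ℝ} {j : Fin 2 → ℕ} {μ ν : Fin 2}
    (hμν : μ ≠ ν) (h : ¬ Prec A C j μ ν) : ¬ ∃ μ', StrictPrec A C j μ μ' := by
  rintro ⟨μ', h1, h2⟩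
  by_cases hμ : μ' = μ
  · subst hμ; exact h2 h1
  · have : μ' = ν := by omega
    subst this; exact h h1

lemma classCoords_stdExp {A : Set (Fin 2 → ℝ)} {C : ℝ} (hC : 1 ≤ C) {j : Fin 2 → ℕ}
    {μ ν : Fin 2} (hμν : μ ≠ ν) (h : ¬ Prec A C j μ ν) : classCoords stdExp A C j μ = {μ} := by
  have hstd : ∀ i k : Fin 2, stdExp i k ≠ 0 ↔ i = k := by
    intro i k; fin_cases i <;> fin_cases k <;> simp [stdExp]
  ext i
  simp only [classCoords, Finset.mem_filter, Finset.mem_univ, true_and, Finset.mem_singleton,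
    hstd]
  constructor
  · rintro ⟨μ', ⟨h1, -⟩, rfl⟩
    by_contra hμ
    have : i = ν := by omega
    subst this; exact h h1
  · rintro rfl
    exact ⟨i, ⟨prec_refl hC j i, prec_refl hC j i⟩, rfl⟩

/-- The cancellation conditions of the class `𝒦(N, e, a, 𝒜)`. -/
def HasClassCancellation {N ν : ℕ} (e : Fin N → Fin ν → ℝ) (A : Set (Fin ν → ℝ)) (C : ℝ)
    (j : Fin ν → ℕ) (ς : EuclideanSpace ℝ (Fin N) → ℂ) : Prop :=
  ∀ μ, ¬ IsMinimalIndex A j μ → (¬ ∃ μ', StrictPrec A C j μ μ') →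
    CancelsIn (classCoords e A C j μ) ς

lemma HasClassCancellation.cancelsIn_zero {C : ℝ} (hC : 1 ≤ C) {j : Fin 2 → ℕ}
    {ς : EuclideanSpace ℝ (Fin 2) → ℂ} (h : HasClassCancellation stdExp flagSet C j ς)
    (hj : j 1 < j 0) : CancelsIn {0} ς := by
  have hp := not_prec_zero_one (C := C) hj
  have := h 0 (by rw [isMinimalIndex_flagSet]; omega) (not_exists_strictPrec (by decide) hp)
  rwa [classCoords_stdExp hC (by decide) hp] at this

lemma HasClassCancellation.cancelsIn_one {C : ℝ} (hC : 1 ≤ C) {j : Fin 2 → ℕ}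
    {ς : EuclideanSpace ℝ (Fin 2) → ℂ} (h : HasClassCancellation stdExp flagSet C j ς)
    (hj : 0 < j 1) : CancelsIn {1} ς := by
  have hp := not_prec_one_zero (C := C) hj
  have := h 1 (by rw [isMinimalIndex_flagSet]; omega) (not_exists_strictPrec (by decide) hp)
  rwa [classCoords_stdExp hC (by decide) hp] at this

lemma hasClassCancellation_of_cancelsIn {C : ℝ} (hC : 1 ≤ C) {j : Fin 2 → ℕ}
    {ς : EuclideanSpace ℝ (Fin 2) → ℂ} (hj : j 1 < j 0) (hj1 : 0 < j 1)
    (h0 : CancelsIn {0} ς) (h1 : CancelsIn {1} ς) :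
    HasClassCancellation stdExp flagSet C j ς := by
  intro μ _ _
  fin_cases μ
  · simpa [classCoords_stdExp hC (by decide) (not_prec_zero_one hj)] using h0
  · simpa [classCoords_stdExp hC (by decide) (not_prec_one_zero hj1)] using h1

/-! ### Integration in the plane -/

lemma measurePreserving_toLp_pair :
    MeasurePreserving
      (fun z : ℝ × ℝ => (WithLp.toLp 2 ![z.1, z.2] : EuclideanSpace ℝ (Fin 2))) := by
  have h1 := (volume_preserving_finTwoArrow ℝ).symm
  have h2 := (EuclideanSpace.volume_preserving_symm_measurableEquiv_toLp (Fin 2)).symm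
  have := h2.comp h1
  have heq : (fun z : ℝ × ℝ => (WithLp.toLp 2 ![z.1, z.2] : EuclideanSpace ℝ (Fin 2))) =
      (MeasurableEquiv.toLp 2 (Fin 2 → ℝ)).symm.symm ∘
        (MeasurableEquiv.finTwoArrow (α := ℝ)).symm :=
    rfl
  rw [heq]
  exact this

lemma continuous_toLp_pair :
    Continuous (fun z : ℝ × ℝ => (WithLp.toLp 2 ![z.1, z.2] : EuclideanSpace ℝ (Fin 2))) := by
  apply (PiLp.continuous_toLp 2 _).comp
  refine continuous_pi fun i => ?_
  fin_cases i
  · exact continuous_fst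
  · exact continuous_snd

lemma measurableEmbedding_toLp_pair :
    MeasurableEmbedding
      (fun z : ℝ × ℝ => (WithLp.toLp 2 ![z.1, z.2] : EuclideanSpace ℝ (Fin 2))) := by
  refine continuous_toLp_pair.measurableEmbedding fun x y h => ?_
  have h' := congrArg WithLp.ofLp h
  simp only at h'
  have h0 := congrFun h' 0
  have h1 := congrFun h' 1
  simp at h0 h1
  exact Prod.ext h0 h1

lemma integral_plane_eq {F : EuclideanSpace ℝ (Fin 2) → ℂ} (hF : Integrable F) :
    ∫ t, F t = ∫ x : ℝ, ∫ y : ℝ, F (WithLp.toLp 2 ![x, y]) := by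
  rw [← measurePreserving_toLp_pair.integral_comp measurableEmbedding_toLp_pair F]
  exact integral_prod _ ((measurePreserving_toLp_pair.integrable_comp_emb
    measurableEmbedding_toLp_pair).2 hF)

lemma integral_plane_eq_symm {F : EuclideanSpace ℝ (Fin 2) → ℂ} (hF : Integrable F) :
    ∫ t, F t = ∫ y : ℝ, ∫ x : ℝ, F (WithLp.toLp 2 ![x, y]) := by
  rw [← measurePreserving_toLp_pair.integral_comp measurableEmbedding_toLp_pair F]
  exact integral_prod_symm _ ((measurePreserving_toLp_pair.integrable_comp_emb
    measurableEmbedding_toLp_pair).2 hF)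

lemma cancelsIn_singleton_iff {N : ℕ} {i : Fin N} {ς : EuclideanSpace ℝ (Fin N) → ℂ} :
    CancelsIn {i} ς ↔
      ∀ t : Fin N → ℝ, ∫ x : ℝ, ς (WithLp.toLp 2 (Function.update t i x)) = 0 := by
  have key : ∀ t : Fin N → ℝ,
      ∫ u : ({i} : Finset (Fin N)) → ℝ, ς (WithLp.toLp 2 (Function.updateFinset t {i} u)) =
        ∫ x : ℝ, ς (WithLp.toLp 2 (Function.update t i x)) := by
    intro t
    have hu : Unique ({i} : Finset (Fin N)) := inferInstance
    have h := (volume_preserving_funUnique ({i} : Finset (Fin N)) ℝ).integral_comp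
      (MeasurableEquiv.measurableEmbedding _)
      (fun x : ℝ => ς (WithLp.toLp 2 (Function.update t i x)))
    rw [← h]
    have hfun : ∀ u : ({i} : Finset (Fin N)) → ℝ, Function.updateFinset t {i} u =
        Function.update t i (MeasurableEquiv.funUnique ({i} : Finset (Fin N)) ℝ u) := by
      intro u
      funext k
      by_cases hk : k = i
      · subst hk
        simp only [Function.updateFinset, Finset.mem_singleton, dif_pos, Function.update_self]
        exact congrArg u (Subsingleton.elim _ _)
      · simp [Function.updateFinset, hk, Function.update_of_ne]
    simp only [hfun]
    congr!
  simp only [CancelsIn, key]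

lemma cancelsIn_zero_iff {ς : EuclideanSpace ℝ (Fin 2) → ℂ} :
    CancelsIn {0} ς ↔ ∀ y : ℝ, ∫ x : ℝ, ς (WithLp.toLp 2 ![x, y]) = 0 := by
  rw [cancelsIn_singleton_iff]
  have : ∀ (t : Fin 2 → ℝ) (x : ℝ), Function.update t 0 x = ![x, t 1] := by
    intro t x; funext k; fin_cases k <;> simp
  simp only [this]
  exact ⟨fun h y => by simpa using h ![0, y], fun h t => h (t 1)⟩

lemma cancelsIn_one_iff {ς : EuclideanSpace ℝ (Fin 2) → ℂ} :
    CancelsIn {1} ς ↔ ∀ x : ℝ, ∫ y : ℝ, ς (WithLp.toLp 2 ![x, y]) = 0 := by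
  rw [cancelsIn_singleton_iff]
  have : ∀ (t : Fin 2 → ℝ) (x : ℝ), Function.update t 1 x = ![t 0, x] := by
    intro t x; funext k; fin_cases k <;> simp
  simp only [this]
  exact ⟨fun h y => by simpa using h ![y, 0], fun h t => h (t 0)⟩

/-- Fubini with the first coordinate integrated first. This is what allows a phase depending on the
second coordinate alone to be subtracted at no cost. -/
lemma integral_mul_eq_zero_of_cancelsIn_zero {ς : EuclideanSpace ℝ (Fin 2) → ℂ}
    (h : CancelsIn {0} ς) (hς : Continuous ς) (hc : HasCompactSupport ς) {g : ℝ → ℂ}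
    (hg : Continuous g) : ∫ t, ς t * g (t 1) = 0 := by
  have hint : Integrable fun t : EuclideanSpace ℝ (Fin 2) => ς t * g (t 1) :=
    Continuous.integrable_of_hasCompactSupport (by fun_prop) hc.mul_right
  rw [integral_plane_eq_symm hint]
  simp [integral_mul_const, cancelsIn_zero_iff.1 h]

lemma integral_eq_zero_of_cancelsIn_one {ς : EuclideanSpace ℝ (Fin 2) → ℂ}
    (h : CancelsIn {1} ς) (hς : Continuous ς) (hc : HasCompactSupport ς) : ∫ t, ς t = 0 := by
  rw [integral_plane_eq (hς.integrable_of_hasCompactSupport hc)]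
  simp [cancelsIn_one_iff.1 h]

/-! ### Dyadic dilations -/

/-- The dilation by `2^{-j}`. -/
noncomputable def contract {N : ℕ} (j : Fin N → ℕ) (t : EuclideanSpace ℝ (Fin N)) :
    EuclideanSpace ℝ (Fin N) :=
  WithLp.toLp 2 fun i => ((2 : ℝ) ^ j i)⁻¹ * t i

@[simp] lemma contract_apply {N : ℕ} (j : Fin N → ℕ) (t : EuclideanSpace ℝ (Fin N)) (i : Fin N) :
    contract j t i = ((2 : ℝ) ^ j i)⁻¹ * t i := rfl

lemma contDiff_contract {N : ℕ} (j : Fin N → ℕ) : ContDiff ℝ ∞ (contract j) := by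
  rw [contDiff_euclidean]
  intro i
  simp only [contract_apply]
  fun_prop

lemma continuous_contract {N : ℕ} (j : Fin N → ℕ) : Continuous (contract j) :=
  (contDiff_contract j).continuous

lemma norm_contract_le {N : ℕ} (j : Fin N → ℕ) (t : EuclideanSpace ℝ (Fin N)) :
    ‖contract j t‖ ≤ ‖t‖ := by
  rw [EuclideanSpace.norm_eq, EuclideanSpace.norm_eq]
  gcongr with i
  rw [contract_apply, norm_mul]
  refine mul_le_of_le_one_left (norm_nonneg _) ?_
  rw [Real.norm_of_nonneg (by positivity)]
  exact inv_le_one_of_one_le₀ (one_le_pow₀ (by norm_num))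

lemma dilate_stdExp (δ : Fin 2 → ℝ) (t : EuclideanSpace ℝ (Fin 2)) (i : Fin 2) :
    dilate stdExp δ t i = δ i * t i := by
  fin_cases i <;> simp [dilate, stdExp]

lemma contract_dilate (j : Fin 2 → ℕ) (t : EuclideanSpace ℝ (Fin 2)) :
    contract j (dilate stdExp (fun μ => (2 : ℝ) ^ j μ) t) = t := by
  ext i
  rw [contract_apply, dilate_stdExp]
  field_simp

/-- The normalizing factor is the determinant of the dilation. The change of variables is by a
measurable embedding, so no integrability is needed. -/
lemma integral_dilFun_mul (j : Fin 2 → ℕ) (ς φ : EuclideanSpace ℝ (Fin 2) → ℂ) :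
    ∫ t, dilFun stdExp j ς t * φ t = ∫ t, ς t * φ (contract j t) := by
  let L : EuclideanSpace ℝ (Fin 2) →ₗ[ℝ] EuclideanSpace ℝ (Fin 2) :=
    Matrix.toLin (EuclideanSpace.basisFun (Fin 2) ℝ).toBasis
      (EuclideanSpace.basisFun (Fin 2) ℝ).toBasis (Matrix.diagonal fun i => (2 : ℝ) ^ j i)
  have hL : ∀ t, L t = dilate stdExp (fun μ => (2 : ℝ) ^ j μ) t := by
    intro t
    ext i
    rw [dilate_stdExp]
    fin_cases i <;> simp [L, Matrix.toLin_apply, Matrix.mulVec_diagonal]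
  have hdet : LinearMap.det L = 2 ^ (j 0 + j 1) := by
    simp [L, LinearMap.det_toLin, Matrix.det_diagonal, Fin.prod_univ_two, pow_add]
  have hdet0 : LinearMap.det L ≠ 0 := by rw [hdet]; positivity
  have hLc : Continuous L := L.continuous_of_finiteDimensional
  have hinj : Function.Injective L := by
    intro x y h
    have := congrArg (contract j) h
    rwa [hL, hL, contract_dilate, contract_dilate] at this
  have hmap := Measure.map_linearMap_addHaar_eq_smul_addHaar
    (volume : Measure (EuclideanSpace ℝ (Fin 2))) hdet0
  have hemb : MeasurableEmbedding L := hLc.measurableEmbedding hinj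
  have h1 := hemb.integral_map (μ := volume) (fun t => ς t * φ (contract j t))
  rw [hmap, integral_smul_measure, hdet] at h1
  have h2 : ∀ t, dilFun stdExp j ς t * φ t =
      (2 : ℂ) ^ (j 0 + j 1) * (ς (L t) * φ (contract j (L t))) := by
    intro t
    rw [hL, contract_dilate, dilFun]
    simp only [stdExp, Fin.sum_univ_two]
    simp
    rw [← Nat.cast_add, Real.rpow_natCast]
    push_cast
    ring
  simp only [h2]
  rw [integral_const_mul, ← h1, abs_of_pos (by positivity), ENNReal.toReal_ofReal (by positivity),
    Complex.real_smul]
  push_cast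
  rw [mul_inv_cancel_left₀ (by simp)]

/-! ### Oscillatory factors -/

/-- The unimodular number `e^{ix}`. -/
noncomputable def cis (x : ℝ) : ℂ := Complex.exp ((x : ℂ) * Complex.I)

@[simp] lemma norm_cis (x : ℝ) : ‖cis x‖ = 1 := Complex.norm_exp_ofReal_mul_I x

@[simp] lemma cis_zero : cis 0 = 1 := by simp [cis]

lemma cis_add (x y : ℝ) : cis (x + y) = cis x * cis y := by
  simp [cis, add_mul, Complex.exp_add]

@[fun_prop]
lemma continuous_cis : Continuous cis := by unfold cis; fun_prop

lemma norm_cis_sub_cis_le (x y : ℝ) : ‖cis x - cis y‖ ≤ |x - y| := by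
  have h : cis x - cis y = cis y * (Complex.exp (Complex.I * ((x - y : ℝ) : ℂ)) - 1) := by
    have : cis x = cis y * cis (x - y) := by rw [← cis_add]; congr 1; ring
    rw [this, cis, cis]
    ring_nf
  rw [h, norm_mul, norm_cis, one_mul]
  exact Real.norm_exp_I_mul_ofReal_sub_one_le

/-- The polynomial `p` at `2^{-j} t`. -/
noncomputable def phase (p : MvPolynomial (Fin 2) ℝ) (j : Fin 2 → ℕ)
    (t : EuclideanSpace ℝ (Fin 2)) : ℝ :=
  MvPolynomial.eval (fun i => contract j t i) p

lemma contDiff_phase (p : MvPolynomial (Fin 2) ℝ) (j : Fin 2 → ℕ) : ContDiff ℝ ∞ (phase p j) :=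
  (contDiff_eval p).comp (contDiff_contract j)

@[fun_prop]
lemma continuous_phase (p : MvPolynomial (Fin 2) ℝ) (j : Fin 2 → ℕ) : Continuous (phase p j) :=
  (contDiff_phase p j).continuous

/-- The contribution of one dyadic piece to the Fourier multiplier of `T_K`. -/
noncomputable def pieceMul (p : MvPolynomial (Fin 2) ℝ) (ς : EuclideanSpace ℝ (Fin 2) → ℂ)
    (j : Fin 2 → ℕ) (ξ : ℝ) : ℂ :=
  ∫ t, ς t * cis (-(2 * Real.pi * ξ) * phase p j t)

/-- The coefficient of `t^α` in `2^{kb} p(2^{-k-l} t₁, 2^{-k} t₂)`. -/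
noncomputable def scaledCoeff (p : MvPolynomial (Fin 2) ℝ) (b k l : ℕ) (α : Fin 2 →₀ ℕ) : ℝ :=
  p.coeff α * (2 ^ (k * b) * (2 ^ ((k + l) * α 0 + k * α 1))⁻¹)

/-- The factor `2^{kb}` makes the coefficient of `t₂^b` independent of `k` and `l`. The integer `b`
is free here: the lower bounds for multipliers use `b = 0`. -/
lemma phase_eq_sum (p : MvPolynomial (Fin 2) ℝ) (b k l : ℕ) (t : EuclideanSpace ℝ (Fin 2)) :
    phase p ![k + l, k] t =
      (2 ^ (k * b))⁻¹ * ∑ α ∈ p.support, scaledCoeff p b k l α * (t 0 ^ α 0 * t 1 ^ α 1) := by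
  rw [phase, MvPolynomial.eval_eq', Finset.mul_sum]
  refine Finset.sum_congr rfl fun α _ => ?_
  simp only [Fin.prod_univ_two, contract_apply, scaledCoeff, Matrix.cons_val_zero,
    Matrix.cons_val_one, mul_pow, inv_pow, pow_add, pow_mul]
  field_simp

lemma abs_scaledCoeff_le {p : MvPolynomial (Fin 2) ℝ} {b : ℕ} {α : Fin 2 →₀ ℕ}
    (h : b ≤ α 0 + α 1) (k l : ℕ) : |scaledCoeff p b k l α| ≤ |p.coeff α| := by
  rw [scaledCoeff, abs_mul]
  refine mul_le_of_le_one_right (abs_nonneg _) ?_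
  rw [abs_of_pos (by positivity), ← div_eq_mul_inv, div_le_one (by positivity)]
  refine pow_le_pow_right₀ (by norm_num) ?_
  have := Nat.mul_le_mul_left k h
  nlinarith [Nat.zero_le (l * α 0)]

/-- The degree condition absorbs the powers of `2^k`, and what is left is `2^{-l α₀} ≤ 2^{-l}`. This
gain makes the sum over `l` converge. -/
lemma abs_scaledCoeff_le_of_pos {p : MvPolynomial (Fin 2) ℝ} {b : ℕ} {α : Fin 2 →₀ ℕ}
    (h : b ≤ α 0 + α 1) (hα : 0 < α 0) (k l : ℕ) :
    |scaledCoeff p b k l α| ≤ |p.coeff α| * (2 ^ l)⁻¹ := by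
  rw [scaledCoeff, abs_mul]
  gcongr
  rw [abs_of_pos (by positivity), ← div_eq_mul_inv, ← one_div, div_le_div_iff₀ (by positivity)
    (by positivity), ← pow_add, one_mul]
  refine pow_le_pow_right₀ (by norm_num) ?_
  have := Nat.mul_le_mul_left k h
  have := Nat.mul_le_mul_left l (Nat.succ_le_of_lt hα)
  nlinarith

lemma abs_coord_le {t : EuclideanSpace ℝ (Fin 2)} {r : ℝ}
    (ht : t ∈ Metric.closedBall (0 : EuclideanSpace ℝ (Fin 2)) r) (i : Fin 2) : |t i| ≤ r :=
  (PiLp.norm_apply_le t i).trans (by simpa using ht)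

/-- The volume of the unit disc. -/
noncomputable def discVol : ℝ :=
  volume.real (Metric.closedBall (0 : EuclideanSpace ℝ (Fin 2)) 1)

lemma discVol_nonneg : 0 ≤ discVol := measureReal_nonneg

lemma norm_integral_le_discVol {F : EuclideanSpace ℝ (Fin 2) → ℂ} {M : ℝ}
    (hsupp : ∀ t ∉ Metric.closedBall (0 : EuclideanSpace ℝ (Fin 2)) 1, F t = 0)
    (hM : ∀ t ∈ Metric.closedBall (0 : EuclideanSpace ℝ (Fin 2)) 1, ‖F t‖ ≤ M) :
    ‖∫ t, F t‖ ≤ M * discVol := by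
  rw [← setIntegral_eq_integral_of_forall_compl_eq_zero hsupp]
  exact norm_setIntegral_le_of_norm_le_const measure_closedBall_lt_top hM

lemma eq_zero_of_notMem_closedBall {N : ℕ} {ς : EuclideanSpace ℝ (Fin N) → ℂ} {r R : ℝ}
    (hrR : r ≤ R) (hs : tsupport ς ⊆ Metric.closedBall 0 r) :
    ∀ t ∉ Metric.closedBall (0 : EuclideanSpace ℝ (Fin N)) R, ς t = 0 := fun _ ht =>
  image_eq_zero_of_notMem_tsupport fun h => ht (Metric.closedBall_subset_closedBall hrR (hs h))

lemma hasCompactSupport_of_tsupport_subset {N : ℕ} {ς : EuclideanSpace ℝ (Fin N) → ℂ} {r : ℝ}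
    (hs : tsupport ς ⊆ Metric.closedBall 0 r) : HasCompactSupport ς :=
  (isCompact_closedBall _ _).of_isClosed_subset (isClosed_tsupport _) hs

/-! ### Multiplier bounds from cancellation -/

section PieceBounds

variable {p : MvPolynomial (Fin 2) ℝ} {ς : EuclideanSpace ℝ (Fin 2) → ℂ} {M : ℝ}

lemma norm_pieceMul_le (hs : tsupport ς ⊆ Metric.closedBall 0 1) (hM : ∀ t, ‖ς t‖ ≤ M)
    (j : Fin 2 → ℕ) (ξ : ℝ) : ‖pieceMul p ς j ξ‖ ≤ M * discVol := by
  refine norm_integral_le_discVol (fun t ht => ?_) fun t _ => ?_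
  · rw [eq_zero_of_notMem_closedBall le_rfl hs t ht, zero_mul]
  · rw [norm_mul, norm_cis, mul_one]; exact hM t

/-- If `ς` is orthogonal to the oscillating factor of the phase `Q`, then its multiplier is
controlled by the distance from the phase of `p` to `Q`. -/
lemma norm_pieceMul_le_of_orthogonal (hc : Continuous ς) (hM0 : 0 ≤ M)
    (hs : tsupport ς ⊆ Metric.closedBall 0 1) (hM : ∀ t, ‖ς t‖ ≤ M) {j : Fin 2 → ℕ} {ξ : ℝ}
    {Q : EuclideanSpace ℝ (Fin 2) → ℝ} {D : ℝ} (hQ : Continuous Q)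
    (hort : ∫ t, ς t * cis (-(2 * Real.pi * ξ) * Q t) = 0)
    (hD : ∀ t ∈ Metric.closedBall (0 : EuclideanSpace ℝ (Fin 2)) 1, |phase p j t - Q t| ≤ D) :
    ‖pieceMul p ς j ξ‖ ≤ M * (2 * Real.pi * |ξ| * D) * discVol := by
  have hcs := hasCompactSupport_of_tsupport_subset hs
  have hsub : pieceMul p ς j ξ = ∫ t, ς t *
      (cis (-(2 * Real.pi * ξ) * phase p j t) - cis (-(2 * Real.pi * ξ) * Q t)) := by
    rw [← sub_zero (pieceMul p ς j ξ), ← hort, pieceMul, ← integral_sub]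
    · congr 1; funext t; ring
    · exact Continuous.integrable_of_hasCompactSupport (by fun_prop) hcs.mul_right
    · exact Continuous.integrable_of_hasCompactSupport (by fun_prop) hcs.mul_right
  rw [hsub]
  refine norm_integral_le_discVol (fun t ht => ?_) fun t ht => ?_
  · rw [eq_zero_of_notMem_closedBall le_rfl hs t ht, zero_mul]
  · rw [norm_mul]
    have h1 := norm_cis_sub_cis_le (-(2 * Real.pi * ξ) * phase p j t) (-(2 * Real.pi * ξ) * Q t)
    rw [← mul_sub, abs_mul, abs_neg, abs_mul, abs_of_pos Real.two_pi_pos] at h1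
    have h2 := Real.pi_pos
    gcongr
    · exact hM t
    · exact h1.trans (by gcongr; exact hD t ht)

/-- The sum of the absolute values of the coefficients. -/
noncomputable def coeffSum (p : MvPolynomial (Fin 2) ℝ) : ℝ := ∑ α ∈ p.support, |p.coeff α|

lemma coeffSum_nonneg (p : MvPolynomial (Fin 2) ℝ) : 0 ≤ coeffSum p :=
  Finset.sum_nonneg fun _ _ => abs_nonneg _

lemma abs_monomial_le_one {t : EuclideanSpace ℝ (Fin 2)}
    (ht : t ∈ Metric.closedBall (0 : EuclideanSpace ℝ (Fin 2)) 1) (m n : ℕ) :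
    |t 0 ^ m * t 1 ^ n| ≤ 1 := by
  rw [abs_mul, abs_pow, abs_pow]
  exact mul_le_one₀ (pow_le_one₀ (abs_nonneg _) (abs_coord_le ht 0)) (by positivity)
    (pow_le_one₀ (abs_nonneg _) (abs_coord_le ht 1))

/-- Comparison with the zero phase: `ς` has total integral zero, and the rescaled phase is bounded
by `coeffSum p` on the unit ball. -/
lemma norm_pieceMul_le_of_cancelsIn_one {b : ℕ} (hdeg : ∀ α ∈ p.support, b ≤ α 0 + α 1)
    (hc : Continuous ς) (hM0 : 0 ≤ M)
    (hs : tsupport ς ⊆ Metric.closedBall 0 1) (hM : ∀ t, ‖ς t‖ ≤ M) (hcan : CancelsIn {1} ς)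
    (k l : ℕ) (ξ : ℝ) :
    ‖pieceMul p ς ![k + l, k] ξ‖ ≤
      coeffSum p * discVol * M * (2 * Real.pi * |ξ| * (2 ^ (k * b))⁻¹) := by
  have hort := integral_eq_zero_of_cancelsIn_one hcan hc (hasCompactSupport_of_tsupport_subset hs)
  have h := norm_pieceMul_le_of_orthogonal (p := p) (j := ![k + l, k]) (ξ := ξ) (Q := fun _ => 0)
    (D := (2 ^ (k * b))⁻¹ * coeffSum p) hc hM0 hs hM continuous_const
    (by simpa using hort)
    (fun t ht => by
      rw [sub_zero, phase_eq_sum p b, abs_mul, abs_of_pos (by positivity)]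
      gcongr
      refine (Finset.abs_sum_le_sum_abs _ _).trans (Finset.sum_le_sum fun α hα => ?_)
      rw [abs_mul]
      exact (mul_le_of_le_one_right (abs_nonneg _) (abs_monomial_le_one ht _ _)).trans
        (abs_scaledCoeff_le (hdeg α hα) k l))
  exact h.trans (le_of_eq (by ring))

/-- Comparison with the phase at `t₁ = 0`: only monomials containing `t₁` survive in the difference,
and each of them carries a factor `2^{-l}`. -/
lemma norm_pieceMul_le_of_cancelsIn_zero {b : ℕ} (hdeg : ∀ α ∈ p.support, b ≤ α 0 + α 1)
    (hc : Continuous ς) (hM0 : 0 ≤ M)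
    (hs : tsupport ς ⊆ Metric.closedBall 0 1) (hM : ∀ t, ‖ς t‖ ≤ M) (hcan : CancelsIn {0} ς)
    (k l : ℕ) (ξ : ℝ) :
    ‖pieceMul p ς ![k + l, k] ξ‖ ≤
      coeffSum p * discVol * M * (2 * Real.pi * |ξ| * (2 ^ (k * b))⁻¹ * (2 ^ l)⁻¹) := by
  -- Here `0 ^ 0 = 1`, so the pure powers of `y` are kept and the other monomials are dropped.
  set Q₁ : ℝ → ℝ := fun y =>
    (2 ^ (k * b))⁻¹ * ∑ α ∈ p.support, scaledCoeff p b k l α * (0 ^ α 0 * y ^ α 1) with hQ₁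
  have hQc : Continuous Q₁ := by fun_prop
  have h := norm_pieceMul_le_of_orthogonal (p := p) (j := ![k + l, k]) (ξ := ξ)
    (Q := fun t => Q₁ (t 1))
    (D := (2 ^ (k * b))⁻¹ * (coeffSum p * (2 ^ l)⁻¹)) hc hM0 hs hM (by fun_prop)
    (integral_mul_eq_zero_of_cancelsIn_zero hcan hc (hasCompactSupport_of_tsupport_subset hs)
      (g := fun y => cis (-(2 * Real.pi * ξ) * Q₁ y)) (by fun_prop))
    (fun t ht => by
      simp only [hQ₁]
      rw [phase_eq_sum p b, ← mul_sub, abs_mul, abs_of_pos (by positivity),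
        ← Finset.sum_sub_distrib, coeffSum, Finset.sum_mul]
      gcongr
      refine (Finset.abs_sum_le_sum_abs _ _).trans (Finset.sum_le_sum fun α hα => ?_)
      rcases Nat.eq_zero_or_pos (α 0) with h0 | h0
      · rw [h0]; simp
      · rw [zero_pow h0.ne', zero_mul, mul_zero, sub_zero, abs_mul]
        exact (mul_le_of_le_one_right (abs_nonneg _) (abs_monomial_le_one ht _ _)).trans
          (abs_scaledCoeff_le_of_pos (hdeg α hα) h0 k l))
  exact h.trans (le_of_eq (by ring))

end PieceBounds

/-! ### Decay of the multipliers at high frequency -/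

/-- The `i`-th derivative in `y` of the rescaled phase `2^{kb} p(2^{-k-l} x, 2^{-k} y)`. -/
noncomputable def scaledDeriv (p : MvPolynomial (Fin 2) ℝ) (b k l : ℕ) (x : ℝ) (i : ℕ)
    (y : ℝ) : ℝ :=
  ∑ α ∈ p.support,
    scaledCoeff p b k l α * x ^ α 0 * (((α 1).descFactorial i : ℝ) * y ^ (α 1 - i))

/-- The truncated exponent `α 1 - i` does no harm: once `i` exceeds `α 1`, the descending factorial
vanishes. -/
lemma hasDerivAt_scaledDeriv (p : MvPolynomial (Fin 2) ℝ) (b k l : ℕ) (x : ℝ) (i : ℕ) (y : ℝ) :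
    HasDerivAt (scaledDeriv p b k l x i) (scaledDeriv p b k l x (i + 1) y) y := by
  unfold scaledDeriv
  refine HasDerivAt.fun_sum fun α _ => HasDerivAt.const_mul _ ?_
  rw [Nat.descFactorial_succ, Nat.cast_mul, ← Nat.sub_sub, mul_comm ((α 1 - i : ℕ) : ℝ), mul_assoc]
  exact (hasDerivAt_pow (α 1 - i) y).const_mul _

/-- A bound for the derivatives of order at most `b + 1` of the rescaled phase. -/
noncomputable def derivBound (p : MvPolynomial (Fin 2) ℝ) (b : ℕ) : ℝ :=
  ∑ α ∈ p.support, |p.coeff α| * ((α 1 : ℝ) + 1) ^ (b + 1)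

lemma descFactorial_le_bound (n i b : ℕ) (hi : i ≤ b + 1) :
    (n.descFactorial i : ℝ) ≤ ((n : ℝ) + 1) ^ (b + 1) := by
  have h1 : n.descFactorial i ≤ (n + 1) ^ (b + 1) :=
    (Nat.descFactorial_le_pow n i).trans ((Nat.pow_le_pow_left (Nat.le_succ n) i).trans
      (Nat.pow_le_pow_right (Nat.succ_pos n) hi))
  exact_mod_cast h1

lemma abs_scaledDeriv_le {p : MvPolynomial (Fin 2) ℝ} {b : ℕ}
    (hdeg : ∀ α ∈ p.support, b ≤ α 0 + α 1) (k l : ℕ) {x y : ℝ} (hx : |x| ≤ 1) (hy : |y| ≤ 1)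
    {i : ℕ} (hi : i ≤ b + 1) : |scaledDeriv p b k l x i y| ≤ derivBound p b := by
  refine (Finset.abs_sum_le_sum_abs _ _).trans (Finset.sum_le_sum fun α hα => ?_)
  rw [abs_mul, abs_mul, abs_mul, abs_pow, abs_pow, Nat.abs_cast]
  have h1 := abs_scaledCoeff_le (p := p) (hdeg α hα) k l
  have h2 : |x| ^ α 0 ≤ 1 := pow_le_one₀ (abs_nonneg _) hx
  have h3 : |y| ^ (α 1 - i) ≤ 1 := pow_le_one₀ (abs_nonneg _) hy
  have h4 := descFactorial_le_bound (α 1) i b hi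
  calc _ ≤ |p.coeff α| * 1 * (((α 1 : ℝ) + 1) ^ (b + 1) * 1) := by gcongr
    _ = _ := by ring

/-- The `b`-th derivative in the second variable of the rescaled phase is bounded below near `0`. -/
lemma le_abs_scaledDeriv {p : MvPolynomial (Fin 2) ℝ} {b : ℕ}
    (hdeg : ∀ α ∈ p.support, b ≤ α 0 + α 1) (k l : ℕ) {x y ε : ℝ}
    (hε : 0 ≤ ε) (hε1 : ε ≤ 1) (hx : |x| ≤ ε) (hy : |y| ≤ ε) :
    |p.coeff (Finsupp.single 1 b)| * b.factorial - ε * derivBound p b ≤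
      |scaledDeriv p b k l x b y| := by
  classical
  by_cases hmem : Finsupp.single 1 b ∈ p.support
  swap
  · have h0 : p.coeff (Finsupp.single 1 b) = 0 := by simpa using hmem
    have : 0 ≤ ε * derivBound p b := mul_nonneg hε (Finset.sum_nonneg fun _ _ => by positivity)
    rw [h0, abs_zero, zero_mul]
    linarith [abs_nonneg (scaledDeriv p b k l x b y)]
  rw [scaledDeriv, ← Finset.add_sum_erase _ _ hmem]
  set R := ∑ α ∈ p.support.erase (Finsupp.single 1 b),
    scaledCoeff p b k l α * x ^ α 0 * (((α 1).descFactorial b : ℝ) * y ^ (α 1 - b)) with hR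
  have hmain : scaledCoeff p b k l (Finsupp.single 1 b) * x ^ (Finsupp.single (1 : Fin 2) b) 0 *
      ((((Finsupp.single (1 : Fin 2) b) 1).descFactorial b : ℝ) *
        y ^ ((Finsupp.single (1 : Fin 2) b) 1 - b)) =
      p.coeff (Finsupp.single 1 b) * b.factorial := by
    simp [scaledCoeff, Nat.descFactorial_self]
  rw [hmain]
  have hRle : |R| ≤ ε * derivBound p b := by
    rw [derivBound, Finset.mul_sum]
    refine (Finset.abs_sum_le_sum_abs _ _).trans ((Finset.sum_le_sum fun α hα => ?_).trans
      (Finset.sum_le_sum_of_subset_of_nonneg (Finset.erase_subset _ _)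
        fun _ _ _ => by positivity))
    obtain ⟨hne, hα⟩ := Finset.mem_erase.1 hα
    have h1 := abs_scaledCoeff_le (p := p) (hdeg α hα) k l
    have h4 := descFactorial_le_bound (α 1) b b (by omega)
    rcases lt_or_ge (α 1) b with hlt | hge
    · rw [Nat.descFactorial_of_lt hlt]
      simp
      positivity
    -- Apart from `(0, b)`, a monomial surviving `b` derivatives in `y` keeps a positive power of
    -- `x` or `y`, hence a factor `ε`.
    · have hpos : 1 ≤ α 0 + (α 1 - b) := by
        by_contra hcon
        refine hne ?_
        ext i
        fin_cases i <;> simp <;> omega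
      have h5 : |x| ^ α 0 * |y| ^ (α 1 - b) ≤ ε := by
        calc |x| ^ α 0 * |y| ^ (α 1 - b) ≤ ε ^ α 0 * ε ^ (α 1 - b) := by gcongr
          _ = ε ^ (α 0 + (α 1 - b)) := (pow_add _ _ _).symm
          _ ≤ ε ^ 1 := pow_le_pow_of_le_one hε hε1 hpos
          _ = ε := pow_one ε
      rw [abs_mul, abs_mul, abs_mul, abs_pow, abs_pow, Nat.abs_cast]
      calc _ = |scaledCoeff p b k l α| * ((α 1).descFactorial b : ℝ) *
            (|x| ^ α 0 * |y| ^ (α 1 - b)) := by ring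
        _ ≤ |p.coeff α| * ((α 1 : ℝ) + 1) ^ (b + 1) * ε := by gcongr
        _ = _ := by ring
  have h6 : |p.coeff (Finsupp.single 1 b) * (b.factorial : ℝ)| =
      |p.coeff (Finsupp.single 1 b)| * b.factorial := by rw [abs_mul, Nat.abs_cast]
  have h7 := abs_sub_abs_le_abs_sub (p.coeff (Finsupp.single 1 b) * (b.factorial : ℝ)) (-R)
  rw [abs_neg, sub_neg_eq_add, h6] at h7
  linarith

/-- The decay of the multipliers of the dyadic pieces, when `p` vanishes to order `b` at `0`. -/
lemma exists_norm_pieceMul_le_rpow {p : MvPolynomial (Fin 2) ℝ} {b : ℕ} (hb : 0 < b)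
    (hcb : p.coeff (Finsupp.single 1 b) ≠ 0) (hdeg : ∀ α ∈ p.support, b ≤ α 0 + α 1) :
    ∃ ε : ℝ, 0 < ε ∧ ε ≤ 1 ∧ ∃ θ : ℝ, 0 < θ ∧ ∃ A ≥ 0,
      ∀ (ς : EuclideanSpace ℝ (Fin 2) → ℂ) (M r : ℝ), r < ε → ContDiff ℝ ∞ ς → 0 ≤ M →
      tsupport ς ⊆ Metric.closedBall 0 r → (∀ t, ‖ς t‖ ≤ M) → (∀ t, ‖fderiv ℝ ς t‖ ≤ M) →
      ∀ (k l : ℕ) (ξ : ℝ), 1 ≤ 2 * Real.pi * |ξ| * (2 ^ (k * b))⁻¹ →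
        ‖pieceMul p ς ![k + l, k] ξ‖ ≤
          A * M * (2 * Real.pi * |ξ| * (2 ^ (k * b))⁻¹) ^ (-θ) := by
  set c := |p.coeff (Finsupp.single 1 b)| * b.factorial with hc
  have hc0 : 0 < c := by positivity
  set B := derivBound p b with hB
  have hB0 : 0 ≤ B := Finset.sum_nonneg fun _ _ => by positivity
  -- The oscillatory estimate takes a lower bound on the derivative of order `n + 1`, which is order
  -- `b`.
  obtain ⟨n, rfl⟩ : ∃ n, b = n + 1 := ⟨b - 1, by omega⟩
  obtain ⟨θ, hθ, A, hA, H⟩ := norm_oscillatory_integral_le n B (c / 2) (by positivity)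
  -- Chosen so that `ε B ≤ c / 2`: on the square `|x|, |y| ≤ ε` the `b`-th derivative in `y` is then
  -- at least `c / 2`, uniformly in `k`, `l` and `x`.
  set ε := min 1 (c / (2 * (B + 1))) with hε
  have hε0 : 0 < ε := by positivity
  have hε1 : ε ≤ 1 := min_le_left _ _
  have hεB : ε * B ≤ c / 2 := by
    have h1 : ε ≤ c / (2 * (B + 1)) := min_le_right _ _
    rw [le_div_iff₀ (by positivity)] at h1
    nlinarith
  refine ⟨ε, hε0, hε1, θ, hθ, 2 * A, by positivity, ?_⟩
  intro ς M r hr hς hM hs hςM hdM k l ξ hL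
  set L := 2 * Real.pi * |ξ| * (2 ^ (k * (n + 1)))⁻¹ with hLdef
  set lam := -(2 * Real.pi * ξ) * (2 ^ (k * (n + 1)))⁻¹ with hlam
  have hlamL : |lam| = L := by
    rw [hlam, hLdef, abs_mul, abs_neg, abs_mul, abs_of_pos Real.two_pi_pos,
      abs_of_pos (by positivity : (0 : ℝ) < (2 ^ (k * (n + 1)))⁻¹)]
  have hcs := hasCompactSupport_of_tsupport_subset hs
  have hcont := hς.continuous
  have hzero : ∀ x y : ℝ, (r < |x| ∨ r < |y|) → ς (WithLp.toLp 2 ![x, y]) = 0 := by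
    intro x y h
    refine eq_zero_of_notMem_closedBall le_rfl hs _ fun hmem => ?_
    have h0 := abs_coord_le hmem 0
    have h1 := abs_coord_le hmem 1
    simp at h0 h1
    rcases h with h | h <;> linarith
  have hint : Integrable fun t => ς t * cis (-(2 * Real.pi * ξ) * phase p ![k + l, k] t) :=
    Continuous.integrable_of_hasCompactSupport (by fun_prop) hcs.mul_right
  have hphase : ∀ x y : ℝ, -(2 * Real.pi * ξ) * phase p ![k + l, k] (WithLp.toLp 2 ![x, y]) =
      lam * scaledDeriv p (n + 1) k l x 0 y := by
    intro x y
    have hsum : scaledDeriv p (n + 1) k l x 0 y = ∑ α ∈ p.support, scaledCoeff p (n + 1) k l α *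
        ((WithLp.toLp 2 ![x, y] : EuclideanSpace ℝ (Fin 2)) 0 ^ α 0 *
          (WithLp.toLp 2 ![x, y] : EuclideanSpace ℝ (Fin 2)) 1 ^ α 1) :=
      Finset.sum_congr rfl fun α _ => by simp [mul_assoc]
    rw [phase_eq_sum p (n + 1), hsum, hlam]
    ring
  -- The decay comes from the `y` integral alone, for each fixed `x`; the `x` integral only costs
  -- the length `2ε ≤ 2`.
  have hinner : ∀ x : ℝ, |x| ≤ ε →
      ‖∫ y : ℝ, ς (WithLp.toLp 2 ![x, y]) *
        cis (-(2 * Real.pi * ξ) * phase p ![k + l, k] (WithLp.toLp 2 ![x, y]))‖ ≤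
      A * M * L ^ (-θ) := by
    intro x hx
    have hlin : ∀ y : ℝ, HasDerivAt
        (fun y : ℝ => (WithLp.toLp 2 ![x, y] : EuclideanSpace ℝ (Fin 2)))
        (EuclideanSpace.single 1 1) y := by
      intro y
      have h : (fun y : ℝ => (WithLp.toLp 2 ![x, y] : EuclideanSpace ℝ (Fin 2))) =
          fun y : ℝ => WithLp.toLp 2 ![x, 0] + y • EuclideanSpace.single (1 : Fin 2) (1 : ℝ) := by
        funext y; ext i; fin_cases i <;> simp
      rw [h]
      have h1 := (hasDerivAt_id y).smul_const
        (EuclideanSpace.single (1 : Fin 2) (1 : ℝ) : EuclideanSpace ℝ (Fin 2))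
      simpa using h1.const_add (WithLp.toLp 2 ![x, 0] : EuclideanSpace ℝ (Fin 2))
    have hψ : ∀ y : ℝ, HasDerivAt (fun y : ℝ => ς (WithLp.toLp 2 ![x, y]))
        (fderiv ℝ ς (WithLp.toLp 2 ![x, y]) (EuclideanSpace.single 1 1)) y := fun y =>
      ((hς.differentiable (by simp)) _).hasFDerivAt.comp_hasDerivAt y (hlin y)
    have hpc : Continuous fun y : ℝ => (WithLp.toLp 2 ![x, y] : EuclideanSpace ℝ (Fin 2)) :=
      continuous_iff_continuousAt.2 fun y => (hlin y).continuousAt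
    have hmain := H ε hε0 hε1 (fun i y => scaledDeriv p (n + 1) k l x i y)
      (fun i y => hasDerivAt_scaledDeriv p (n + 1) k l x i y)
      (fun i hi y hy => abs_scaledDeriv_le hdeg k l (hx.trans hε1)
        ((abs_le.2 hy).trans hε1) hi)
      (fun y hy => le_trans (by linarith) (le_abs_scaledDeriv hdeg k l hε0.le hε1 hx (abs_le.2 hy)))
      (fun y => ς (WithLp.toLp 2 ![x, y]))
      (fun y => fderiv ℝ ς (WithLp.toLp 2 ![x, y]) (EuclideanSpace.single 1 1)) M hM hψ
      (((hς.continuous_fderiv (by simp)).comp hpc).clm_apply continuous_const)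
      (fun y => hςM _)
      (fun y => (ContinuousLinearMap.le_opNorm _ _).trans (by simpa using hdM _)) lam
      (by rw [hlamL]; exact hL)
    rw [hlamL] at hmain
    rw [intervalIntegral.integral_eq_integral_of_support_subset] at hmain
    · refine le_trans (le_of_eq ?_) hmain
      congr 2
      funext y
      rw [hphase, mul_comm, cis]
    · intro y hy
      by_contra hcon
      apply hy
      have : r < |y| := by
        by_contra h'
        rw [not_lt, abs_le] at h'
        exact hcon ⟨by linarith, by linarith⟩
      simp only [hzero x y (Or.inr this), mul_zero]
  rw [pieceMul, integral_plane_eq hint,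
    ← intervalIntegral.integral_eq_integral_of_support_subset (a := -ε) (b := ε)]
  · refine (intervalIntegral.norm_integral_le_of_norm_le_const (C := A * M * L ^ (-θ))
      fun x hx => hinner x ?_).trans ?_
    · rw [Set.uIoc_of_le (by linarith)] at hx
      exact abs_le.2 ⟨hx.1.le, hx.2⟩
    · have hnn : 0 ≤ A * M * L ^ (-θ) := by
        have : 0 ≤ L := by linarith
        positivity
      have h2 : |ε - -ε| ≤ 2 := by rw [abs_of_nonneg] <;> linarith
      calc A * M * L ^ (-θ) * |ε - -ε| ≤ A * M * L ^ (-θ) * 2 := by gcongr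
        _ = _ := by ring
  · intro x hx
    by_contra hcon
    apply hx
    have : r < |x| := by
      by_contra h'
      rw [not_lt, abs_le] at h'
      exact hcon ⟨by linarith, by linarith⟩
    simp only [hzero x _ (Or.inl this), zero_mul, integral_zero]

/-! ### Summing the dyadic pieces -/

lemma summable_pow_natAbs {q : ℝ} (hq : 0 ≤ q) (hq1 : q < 1) :
    Summable fun z : ℤ => q ^ z.natAbs := by
  refine Summable.of_nat_of_neg ?_ ?_ <;>
    simpa using summable_geometric_of_lt_one hq hq1

/-- Enclosing `F` in a rectangle makes the sum factor. Since `k ↦ n - k` is injective into `ℤ`, the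
bound does not depend on `n`. -/
lemma exists_sum_pow_natAbs_mul_pow_le {q : ℝ} (hq : 0 ≤ q) (hq1 : q < 1) :
    ∃ C ≥ 0, ∀ (n : ℤ) (F : Finset (ℕ × ℕ)),
      ∑ z ∈ F, q ^ (n - z.1).natAbs * q ^ z.2 ≤ C := by
  classical
  have hs := summable_pow_natAbs hq hq1
  have hg := summable_geometric_of_lt_one hq hq1
  refine ⟨(∑' z : ℤ, q ^ z.natAbs) * ∑' l : ℕ, q ^ l,
    mul_nonneg (tsum_nonneg fun _ => by positivity) (tsum_nonneg fun _ => by positivity),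
    fun n F => ?_⟩
  have hsub : F ⊆ F.image Prod.fst ×ˢ F.image Prod.snd := by
    intro z hz
    exact Finset.mem_product.2 ⟨Finset.mem_image_of_mem _ hz, Finset.mem_image_of_mem _ hz⟩
  refine (Finset.sum_le_sum_of_subset_of_nonneg hsub fun _ _ _ => by positivity).trans ?_
  have hprod : ∑ z ∈ F.image Prod.fst ×ˢ F.image Prod.snd, q ^ (n - z.1).natAbs * q ^ z.2 =
      (∑ k ∈ F.image Prod.fst, q ^ (n - (k : ℤ)).natAbs) * ∑ l ∈ F.image Prod.snd, q ^ l := by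
    rw [Finset.sum_product, Finset.sum_mul_sum]
  rw [hprod]
  refine mul_le_mul ?_ (hg.sum_le_tsum _ fun _ _ => by positivity)
    (Finset.sum_nonneg fun _ _ => by positivity) (tsum_nonneg fun _ => by positivity)
  have hinj : Set.InjOn (fun k : ℕ => n - (k : ℤ)) (F.image Prod.fst : Finset ℕ) := by
    intro a _ b _ h
    simp only at h
    omega
  rw [← Finset.sum_image (f := fun z : ℤ => q ^ z.natAbs) hinj]
  exact hs.sum_le_tsum _ fun _ _ => by positivity

/-- Combining decay for large frequencies with cancellation for small ones. -/
lemma min_rpow_exponents_le {θ y l : ℝ} (hθ : 0 < θ) (hθ1 : θ ≤ 1) (hl : 0 ≤ l) :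
    (0 ≤ y → min (-θ * y) (y - l) ≤ -(θ / 4) * (|y| + l)) ∧
      (y ≤ 0 → y - l ≤ -(θ / 4) * (|y| + l)) := by
  constructor
  · intro hy
    rw [abs_of_nonneg hy]
    -- If `l ≤ 2y` then `y + l ≤ 3y` and the decay suffices; if `l ≥ 2y` then `l - y ≥ l / 2` and
    -- the cancellation suffices.
    rcases le_total l (2 * y) with h | h
    · refine (min_le_left _ _).trans ?_
      nlinarith
    · refine (min_le_right _ _).trans ?_
      nlinarith
  · intro hy
    rw [abs_of_nonpos hy]
    nlinarith

/-- This replaces the real centre `y / b` by an integer one, at the cost of `1` in the exponent (the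
factor `2 ^ σ` in the summation). -/
lemma natAbs_floor_sub_le {y : ℝ} {b : ℕ} (hb : 0 < b) (k : ℕ) :
    ((⌊y / b⌋ - (k : ℤ)).natAbs : ℝ) - 1 ≤ |y - k * b| := by
  have hb' : (1 : ℝ) ≤ b := by exact_mod_cast hb
  have h1 := Int.floor_le (y / b)
  have h2 := Int.lt_floor_add_one (y / b)
  have h3 : |y - k * b| = b * |y / b - k| := by
    rw [← abs_of_pos (by linarith : (0 : ℝ) < b), ← abs_mul, abs_of_pos (by linarith : (0 : ℝ) < b)]
    congr 1
    field_simp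
  have h4 : |y / b - k| ≤ |y - k * b| := by
    rw [h3]; exact le_mul_of_one_le_left (abs_nonneg _) hb'
  refine le_trans ?_ h4
  have h5 : ((⌊y / b⌋ - (k : ℤ)).natAbs : ℝ) = |(⌊y / b⌋ : ℝ) - k| := by
    rw [Nat.cast_natAbs]; push_cast; rfl
  rw [h5]
  have h6 := abs_sub_abs_le_abs_sub ((⌊y / b⌋ : ℝ) - k) (y / b - k)
  have h7 : |(⌊y / b⌋ : ℝ) - k - (y / b - k)| ≤ 1 := by
    rw [abs_le]; constructor <;> linarith
  linarith

/-- The multipliers of the dyadic pieces of a kernel in the class are absolutely summable,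
uniformly in the frequency. -/
lemma exists_sum_norm_pieceMul_le {p : MvPolynomial (Fin 2) ℝ} {b : ℕ} (hb : 0 < b)
    (hcb : p.coeff (Finsupp.single 1 b) ≠ 0) (hdeg : ∀ α ∈ p.support, b ≤ α 0 + α 1) :
    ∃ ε : ℝ, 0 < ε ∧ ε ≤ 1 ∧
      ∀ (ς : (Fin 2 → ℕ) → EuclideanSpace ℝ (Fin 2) → ℂ) (C M r : ℝ), 1 ≤ C → r < ε → 0 ≤ M →
      (∀ j ∈ negLog flagSet, ContDiff ℝ ∞ (ς j)) →
      (∀ j ∈ negLog flagSet, tsupport (ς j) ⊆ Metric.closedBall 0 r) →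
      (∀ j ∈ negLog flagSet, ∀ t, ‖ς j t‖ ≤ M) →
      (∀ j ∈ negLog flagSet, ∀ t, ‖fderiv ℝ (ς j) t‖ ≤ M) →
      (∀ j ∈ negLog flagSet, HasClassCancellation stdExp flagSet C j (ς j)) →
      ∃ D, ∀ (ξ : ℝ) (F : Finset (negLog flagSet)),
        ∑ j ∈ F, ‖pieceMul p (ς j.1) j.1 ξ‖ ≤ D := by
  classical
  obtain ⟨ε, hε, hε1, θ', hθ', A₁, hA₁, H⟩ := exists_norm_pieceMul_le_rpow hb hcb hdeg
  refine ⟨ε, hε, hε1, ?_⟩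
  intro ς C M r hC hr hM hsm hsupp hςM hdM hcan
  set θ := min θ' 1 with hθdef
  have hθ : 0 < θ := by positivity
  have hθ1 : θ ≤ 1 := min_le_right _ _
  have hVd := discVol_nonneg
  have hS := coeffSum_nonneg p
  set A := A₁ * M + coeffSum p * discVol * M + M * discVol with hA
  have hA0 : 0 ≤ A := by positivity
  set σ := θ / 4 with hσ
  have hσ0 : 0 < σ := by positivity
  set q : ℝ := (2 : ℝ) ^ (-σ) with hq
  have hq0 : 0 < q := by positivity
  have hq1 : q < 1 := Real.rpow_lt_one_of_one_lt_of_neg (by norm_num) (by linarith)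
  obtain ⟨Cq, hCq, hsum⟩ := exists_sum_pow_natAbs_mul_pow_le hq0.le hq1
  refine ⟨A * (1 + 2 ^ σ * Cq), fun ξ F => ?_⟩
  set y₀ := Real.logb 2 (2 * Real.pi * |ξ|) with hy₀
  set n : ℤ := ⌊y₀ / b⌋ with hn
  have hpt : ∀ k l : ℕ, ‖pieceMul p (ς ![k + l, k]) ![k + l, k] ξ‖ ≤
      A * ((if (k, l) = (0, 0) then 1 else 0) + 2 ^ σ * (q ^ (n - (k : ℤ)).natAbs * q ^ l)) := by
    intro k l
    have hj : (![k + l, k] : Fin 2 → ℕ) ∈ negLog flagSet := mem_negLog_flagSet.2 (by simp)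
    have hs1 := (hsupp _ hj).trans (Metric.closedBall_subset_closedBall (hr.le.trans hε1))
    have hcont := (hsm _ hj).continuous
    -- The piece at the origin of the flag has no cancellation and takes the trivial bound; it is a
    -- single term.
    by_cases hkl : (k, l) = (0, 0)
    · rw [if_pos hkl]
      refine (norm_pieceMul_le hs1 (hςM _ hj) _ ξ).trans ?_
      have h1 : M * discVol ≤ A := by
        have h2 : 0 ≤ A₁ * M + coeffSum p * discVol * M := by positivity
        rw [hA]; linarith
      refine h1.trans (le_mul_of_one_le_right hA0 ?_)
      have : 0 ≤ 2 ^ σ * (q ^ (n - (k : ℤ)).natAbs * q ^ l) := by positivity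
      linarith
    · rw [if_neg hkl, zero_add]
      set L := 2 * Real.pi * |ξ| * (2 ^ (k * b))⁻¹ with hL
      have hcancel : ‖pieceMul p (ς ![k + l, k]) ![k + l, k] ξ‖ ≤ A * (L * (2 ^ l)⁻¹) := by
        have hL0 : 0 ≤ L := by have := Real.pi_pos; positivity
        have hle : coeffSum p * discVol * M ≤ A := by
          have h2 : 0 ≤ A₁ * M + M * discVol := by positivity
          rw [hA]; linarith
        -- On the diagonal only the cancellation in `t` is available, but there is no factor
        -- `2^{-l}` to gain.
        rcases Nat.eq_zero_or_pos l with hl0 | hl0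
        · have hk0 : 0 < k := by
            rcases Nat.eq_zero_or_pos k with hk | hk
            · exact absurd (by rw [hk, hl0]) hkl
            · exact hk
          have h := norm_pieceMul_le_of_cancelsIn_one hdeg hcont hM hs1 (hςM _ hj)
            ((hcan _ hj).cancelsIn_one hC (by simpa using hk0)) k l ξ
          refine h.trans ?_
          rw [hl0, pow_zero, inv_one, mul_one]
          gcongr
        · have h := norm_pieceMul_le_of_cancelsIn_zero hdeg hcont hM hs1 (hςM _ hj)
            ((hcan _ hj).cancelsIn_zero hC (by simpa using hl0)) k l ξ
          refine h.trans ?_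
          gcongr
      rcases eq_or_ne ξ 0 with hξ | hξ
      · have hL0 : L = 0 := by rw [hL, hξ]; simp
        rw [hL0, zero_mul, mul_zero] at hcancel
        exact hcancel.trans (by positivity)
      have hξ0 : 0 < 2 * Real.pi * |ξ| := by
        have := Real.pi_pos; have := abs_pos.2 hξ; positivity
      have hL0 : 0 < L := by positivity
      set y := y₀ - k * b with hy
      have hLy : L = (2 : ℝ) ^ y := by
        rw [hy, Real.rpow_sub (by norm_num), hy₀, Real.rpow_logb (by norm_num) (by norm_num) hξ0,
          hL, div_eq_mul_inv, ← Nat.cast_mul, Real.rpow_natCast]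
      have hcancel' : ‖pieceMul p (ς ![k + l, k]) ![k + l, k] ξ‖ ≤ A * (2 : ℝ) ^ (y - l) := by
        rw [Real.rpow_sub (by norm_num), ← hLy, Real.rpow_natCast, div_eq_mul_inv]
        exact hcancel
      have hexp : ‖pieceMul p (ς ![k + l, k]) ![k + l, k] ξ‖ ≤
          A * (2 : ℝ) ^ (-σ * (|y| + l)) := by
        obtain ⟨hm1, hm2⟩ := min_rpow_exponents_le (y := y) (l := (l : ℝ)) hθ hθ1 (by positivity)
        rcases le_total 0 y with hy0 | hy0
        · have hL1 : 1 ≤ L := by rw [hLy]; exact Real.one_le_rpow (by norm_num) hy0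
          have hdecay : ‖pieceMul p (ς ![k + l, k]) ![k + l, k] ξ‖ ≤ A * (2 : ℝ) ^ (-θ * y) := by
            refine (H _ M r hr (hsm _ hj) hM (hsupp _ hj) (hςM _ hj) (hdM _ hj) k l ξ hL1).trans ?_
            have hle : A₁ * M ≤ A := by
              have h2 : 0 ≤ coeffSum p * discVol * M + M * discVol := by positivity
              rw [hA]; linarith
            have h3 : L ^ (-θ') ≤ (2 : ℝ) ^ (-θ * y) := by
              rw [mul_comm, Real.rpow_mul (by norm_num), ← hLy]
              exact Real.rpow_le_rpow_of_exponent_le hL1 (neg_le_neg (min_le_left _ _))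
            gcongr
          have h4 := hm1 hy0
          have : ‖pieceMul p (ς ![k + l, k]) ![k + l, k] ξ‖ ≤
              A * (2 : ℝ) ^ (min (-θ * y) (y - l)) := by
            rcases min_choice (-θ * y) (y - l) with h | h <;> rw [h]
            exacts [hdecay, hcancel']
          refine this.trans ?_
          gcongr
          norm_num
        · refine hcancel'.trans ?_
          have h4 := hm2 hy0
          gcongr
          norm_num
      refine hexp.trans ?_
      gcongr
      rw [hq, ← Real.rpow_natCast, ← Real.rpow_natCast, ← Real.rpow_mul (by norm_num),
        ← Real.rpow_mul (by norm_num), ← Real.rpow_add (by norm_num),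
        ← Real.rpow_add (by norm_num)]
      have h5 := natAbs_floor_sub_le (y := y₀) hb k
      rw [← hn, ← hy] at h5
      refine Real.rpow_le_rpow_of_exponent_le (by norm_num) ?_
      nlinarith
  have hjeq : ∀ j : negLog flagSet, j.1 = ![j.1 1 + (j.1 0 - j.1 1), j.1 1] := by
    intro j
    have := mem_negLog_flagSet.1 j.2
    funext i
    fin_cases i
    · simp; omega
    · simp
  set Φ : negLog flagSet → ℕ × ℕ := fun j => (j.1 1, j.1 0 - j.1 1) with hΦ
  have hinj : Set.InjOn Φ F := by
    intro j _ j' _ h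
    simp only [hΦ, Prod.mk.injEq] at h
    apply Subtype.ext
    rw [hjeq j, hjeq j', h.2, h.1]
  set f : ℕ × ℕ → ℝ := fun z =>
    A * ((if z = (0, 0) then 1 else 0) + 2 ^ σ * (q ^ (n - (z.1 : ℤ)).natAbs * q ^ z.2)) with hf
  calc ∑ j ∈ F, ‖pieceMul p (ς j.1) j.1 ξ‖ ≤ ∑ j ∈ F, f (Φ j) := by
        refine Finset.sum_le_sum fun j _ => ?_
        have := hpt (j.1 1) (j.1 0 - j.1 1)
        rw [← hjeq j] at this
        exact this
    _ = ∑ z ∈ F.image Φ, f z := (Finset.sum_image hinj).symm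
    _ ≤ A * (1 + 2 ^ σ * Cq) := by
        simp only [hf]
        rw [← Finset.mul_sum, Finset.sum_add_distrib, ← Finset.mul_sum]
        have h1 : ∑ z ∈ F.image Φ, (if z = ((0 : ℕ), (0 : ℕ)) then (1 : ℝ) else 0) ≤ 1 := by
          rw [Finset.sum_ite_eq']
          split_ifs <;> norm_num
        have h2 := hsum n (F.image Φ)
        gcongr

/-! ### The operator `T_K` as a sum of dyadic pieces -/

/-- The contraction maps the support of `ς_j` into the ball where the cutoff is `1`, so the cutoff
drops out of every term; real and imaginary parts then recombine. -/
lemma hasSum_pairSmooth {a r : ℝ} {ς : (Fin 2 → ℕ) → EuclideanSpace ℝ (Fin 2) → ℂ}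
    {K : 𝓓'((⊤ : Opens (EuclideanSpace ℝ (Fin 2))), ℂ)}
    (hc : ∀ j ∈ negLog flagSet, Continuous (ς j)) (hra : r < a)
    (hs : ∀ j ∈ negLog flagSet, tsupport (ς j) ⊆ Metric.closedBall 0 r)
    (hK : ∀ φ : 𝓓((⊤ : Opens (EuclideanSpace ℝ (Fin 2))), ℝ),
      HasSum (fun j : negLog flagSet => ∫ t, dilFun stdExp j.1 (ς j.1) t * (φ t : ℂ)) (K φ))
    (g : EuclideanSpace ℝ (Fin 2) → ℂ) (hg : ContDiff ℝ ∞ g) :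
    HasSum (fun j : negLog flagSet => ∫ t, ς j.1 t * g (contract j.1 t)) (pairSmooth a K g hg) := by
  have h1 := hK (cutoffMul a (fun t => (g t).re) (Complex.reCLM.contDiff.comp hg))
  have h2 := hK (cutoffMul a (fun t => (g t).im) (Complex.imCLM.contDiff.comp hg))
  have h := h1.add (h2.mul_left Complex.I)
  have hfun : (fun j : negLog flagSet => ∫ t, ς j.1 t * g (contract j.1 t)) = fun j =>
      (∫ t, dilFun stdExp j.1 (ς j.1) t *
        ((cutoffMul a (fun t => (g t).re) (Complex.reCLM.contDiff.comp hg) t : ℝ) : ℂ)) +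
      Complex.I * ∫ t, dilFun stdExp j.1 (ς j.1) t *
        ((cutoffMul a (fun t => (g t).im) (Complex.imCLM.contDiff.comp hg) t : ℝ) : ℂ) := by
    funext j
    have hcs := hasCompactSupport_of_tsupport_subset (hs j.1 j.2)
    have hcj := hc j.1 j.2
    have hgc := hg.continuous
    have hcon := continuous_contract j.1
    have hcut : ∀ (u : EuclideanSpace ℝ (Fin 2) → ℝ) (hu : ContDiff ℝ ∞ u) t,
        ς j.1 t * ((cutoffMul a u hu (contract j.1 t) : ℝ) : ℂ) =
          ς j.1 t * (u (contract j.1 t) : ℂ) := by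
      intro u hu t
      by_cases ht : t ∈ Metric.closedBall (0 : EuclideanSpace ℝ (Fin 2)) r
      · have hone : cutoff 2 a (contract j.1 t) = 1 := by
          apply ContDiffBump.one_of_mem_closedBall
          rw [mem_closedBall_zero_iff] at ht ⊢
          have := norm_contract_le j.1 t
          have h3 := le_abs_self a
          change _ ≤ |a| + 1
          linarith
        change ς j.1 t * ((cutoff 2 a (contract j.1 t) * u (contract j.1 t) : ℝ) : ℂ) = _
        rw [hone, one_mul]
      · rw [eq_zero_of_notMem_closedBall le_rfl (hs j.1 j.2) t ht, zero_mul, zero_mul]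
    have hre : ContDiff ℝ ∞ fun t => (g t).re := Complex.reCLM.contDiff.comp hg
    have him : ContDiff ℝ ∞ fun t => (g t).im := Complex.imCLM.contDiff.comp hg
    change _ = (∫ t, dilFun stdExp j.1 (ς j.1) t * ((cutoffMul a _ hre t : ℝ) : ℂ)) +
      Complex.I * ∫ t, dilFun stdExp j.1 (ς j.1) t * ((cutoffMul a _ him t : ℝ) : ℂ)
    rw [integral_dilFun_mul j.1 (ς j.1) (fun t => ((cutoffMul a _ hre t : ℝ) : ℂ)),
      integral_dilFun_mul j.1 (ς j.1) (fun t => ((cutoffMul a _ him t : ℝ) : ℂ))]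
    simp only [hcut]
    rw [← integral_const_mul, ← integral_add]
    · congr 1; funext t
      have := Complex.re_add_im (g (contract j.1 t))
      linear_combination (-(ς j.1 t)) * this
    · exact Continuous.integrable_of_hasCompactSupport (by fun_prop) hcs.mul_right
    · exact (Continuous.integrable_of_hasCompactSupport (by fun_prop) hcs.mul_right).const_mul _
  rw [hfun]
  exact h

lemma hasSum_opT {a r : ℝ} {ς : (Fin 2 → ℕ) → EuclideanSpace ℝ (Fin 2) → ℂ}
    {K : 𝓓'((⊤ : Opens (EuclideanSpace ℝ (Fin 2))), ℂ)}
    (hc : ∀ j ∈ negLog flagSet, Continuous (ς j)) (hra : r < a)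
    (hs : ∀ j ∈ negLog flagSet, tsupport (ς j) ⊆ Metric.closedBall 0 r)
    (hK : ∀ φ : 𝓓((⊤ : Opens (EuclideanSpace ℝ (Fin 2))), ℝ),
      HasSum (fun j : negLog flagSet => ∫ t, dilFun stdExp j.1 (ς j.1) t * (φ t : ℂ)) (K φ))
    (p : MvPolynomial (Fin 2) ℝ) (f : 𝓓((⊤ : Opens ℝ), ℂ)) (x : ℝ) :
    HasSum (fun j : negLog flagSet => ∫ t, ς j.1 t * f (x - phase p j.1 t)) (opT a p K f x) :=
  hasSum_pairSmooth hc hra hs hK _ _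

lemma continuous_pieceMul (p : MvPolynomial (Fin 2) ℝ) {ς : EuclideanSpace ℝ (Fin 2) → ℂ}
    (hc : Continuous ς) (hcs : HasCompactSupport ς) (j : Fin 2 → ℕ) :
    Continuous (pieceMul p ς j) := by
  refine continuous_of_dominated (bound := fun t => ‖ς t‖) (fun ξ => ?_) (fun ξ => ?_)
    (hc.integrable_of_hasCompactSupport hcs).norm ?_
  · exact (by fun_prop : Continuous _).aestronglyMeasurable
  · exact Filter.Eventually.of_forall fun t => by simp
  · exact Filter.Eventually.of_forall fun t => by fun_prop

/-! ### L² boundedness from a bounded multiplier -/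

section Fourier

open FourierTransform

lemma integral_fourier_smul_eq_of_integrable {G h : ℝ → ℂ} (hG : Integrable G)
    (hh : Integrable h) : ∫ ξ, 𝓕 G ξ • h ξ = ∫ x, G x • 𝓕 h x := by
  simpa using! VectorFourier.integral_fourierIntegral_smul_eq_flip (L := innerₗ ℝ)
    Real.continuous_fourierChar continuous_inner hG hh

lemma integral_fourierInv_smul_eq_of_integrable {G h : ℝ → ℂ} (hG : Integrable G)
    (hh : Integrable h) : ∫ ξ, 𝓕⁻ G ξ • h ξ = ∫ x, G x • 𝓕⁻ h x := by
  rw [Real.fourierInv_eq_fourier_comp_neg, integral_fourier_smul_eq_of_integrable hG.comp_neg hh,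
    ← integral_neg_eq_self]
  simp only [neg_neg, Real.fourierInv_eq_fourier_neg]

lemma continuous_fourierInv_of_integrable {h : ℝ → ℂ} (hh : Integrable h) :
    Continuous (𝓕⁻ h) := by
  rw [Real.fourierInv_eq_fourier_comp_neg]
  exact VectorFourier.fourierIntegral_continuous (L := innerₗ ℝ) Real.continuous_fourierChar
    continuous_inner hh.comp_neg

/-- On `L¹ ∩ L²`, the inverse Fourier transform of `L²` is given by the integral formula. -/
lemma coeFn_fourierInv_eq (h : Lp ℂ 2 (volume : Measure ℝ)) (hint : Integrable (h : ℝ → ℂ)) :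
    ((𝓕⁻ h : Lp ℂ 2 (volume : Measure ℝ)) : ℝ → ℂ) =ᵐ[volume] 𝓕⁻ (h : ℝ → ℂ) := by
  have hcont : Continuous (𝓕⁻ (h : ℝ → ℂ)) := continuous_fourierInv_of_integrable hint
  have hloc : LocallyIntegrable ((𝓕⁻ h : Lp ℂ 2 (volume : Measure ℝ)) : ℝ → ℂ) :=
    (Lp.memLp _).locallyIntegrable (by norm_num)
  refine ae_eq_of_integral_contDiff_smul_eq hloc hcont.locallyIntegrable fun g hg hgc => ?_
  have hgC : ContDiff ℝ ∞ fun x => (g x : ℂ) := Complex.ofRealCLM.contDiff.comp hg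
  have hgcC : HasCompactSupport fun x => (g x : ℂ) := hgc.comp_left Complex.ofReal_zero
  set G : SchwartzMap ℝ ℂ := hgcC.toSchwartzMap hgC with hG
  -- The `L²` inverse transform agrees with that of tempered distributions; paired with a test
  -- function, the latter moves onto `h` because `h` is integrable.
  have h1 := congrArg (fun T => T G) (Lp.fourierInv_toTemperedDistribution_eq h)
  simp only [TemperedDistribution.fourierInv_apply, Lp.toTemperedDistribution_apply] at h1
  rw [SchwartzMap.fourierInv_coe, integral_fourierInv_smul_eq_of_integrable G.integrable hint] at h1
  exact h1.symm

lemma fourierInv_eq_integral_cis (h : ℝ → ℂ) (x : ℝ) :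
    𝓕⁻ h x = ∫ ξ, cis (2 * Real.pi * ξ * x) * h ξ := by
  rw [Real.fourierInv_eq']
  congr 1; funext ξ
  rw [smul_eq_mul, cis]
  simp only [RCLike.inner_apply, conj_trivial]
  congr 3
  push_cast
  ring

/-- The action of a dyadic piece of `T_K`, in terms of the Fourier transform. -/
lemma integral_mul_translate_eq {p : MvPolynomial (Fin 2) ℝ} {ς : EuclideanSpace ℝ (Fin 2) → ℂ}
    (hc : Continuous ς) (hcs : HasCompactSupport ς) (j : Fin 2 → ℕ) (f : SchwartzMap ℝ ℂ) (x : ℝ) :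
    ∫ t, ς t * f (x - phase p j t) =
      ∫ ξ, cis (2 * Real.pi * ξ * x) * (pieceMul p ς j ξ * 𝓕 (f : ℝ → ℂ) ξ) := by
  have hF : Integrable (𝓕 (f : ℝ → ℂ)) := by
    rw [← SchwartzMap.fourier_coe]; exact (𝓕 f).integrable
  have hinv : ∀ y, f y = ∫ ξ, cis (2 * Real.pi * ξ * y) * 𝓕 (f : ℝ → ℂ) ξ := by
    intro y
    rw [← fourierInv_eq_integral_cis, f.continuous.fourierInv_fourier_eq f.integrable hF]
  have hint : Integrable (fun z : EuclideanSpace ℝ (Fin 2) × ℝ =>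
      ς z.1 * (cis (2 * Real.pi * z.2 * (x - phase p j z.1)) * 𝓕 (f : ℝ → ℂ) z.2))
      (volume.prod volume) := by
    have h1 := (hc.integrable_of_hasCompactSupport (μ := volume) hcs).mul_prod hF
    have h2 := h1.bdd_mul (c := 1)
      (f := fun z : EuclideanSpace ℝ (Fin 2) × ℝ => cis (2 * Real.pi * z.2 * (x - phase p j z.1)))
      (by fun_prop : Continuous _).aestronglyMeasurable
      (Filter.Eventually.of_forall fun z => by simp)
    convert h2 using 1
    funext z
    ring
  calc ∫ t, ς t * f (x - phase p j t)
      = ∫ t, ∫ ξ, ς t * (cis (2 * Real.pi * ξ * (x - phase p j t)) * 𝓕 (f : ℝ → ℂ) ξ) := by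
        congr 1; funext t
        rw [hinv, integral_const_mul]
    _ = ∫ ξ, ∫ t, ς t * (cis (2 * Real.pi * ξ * (x - phase p j t)) * 𝓕 (f : ℝ → ℂ) ξ) :=
        integral_integral_swap hint
    _ = _ := by
        congr 1; funext ξ
        rw [pieceMul, ← integral_mul_const, ← integral_const_mul]
        congr 1; funext t
        have h : cis (2 * Real.pi * ξ * (x - phase p j t)) =
            cis (2 * Real.pi * ξ * x) * cis (-(2 * Real.pi * ξ) * phase p j t) := by
          rw [← cis_add]; congr 1; ring
        rw [h]; ring

/-- If the multipliers of the dyadic pieces are absolutely summable, uniformly in the frequency,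
then `T_K` is bounded on `L²`. -/
lemma isL2Bounded_of_sum_norm_pieceMul_le {a r D : ℝ}
    {ς : (Fin 2 → ℕ) → EuclideanSpace ℝ (Fin 2) → ℂ}
    {K : 𝓓'((⊤ : Opens (EuclideanSpace ℝ (Fin 2))), ℂ)}
    (hc : ∀ j ∈ negLog flagSet, Continuous (ς j)) (hra : r < a)
    (hs : ∀ j ∈ negLog flagSet, tsupport (ς j) ⊆ Metric.closedBall 0 r)
    (hK : ∀ φ : 𝓓((⊤ : Opens (EuclideanSpace ℝ (Fin 2))), ℝ),
      HasSum (fun j : negLog flagSet => ∫ t, dilFun stdExp j.1 (ς j.1) t * (φ t : ℂ)) (K φ))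
    (p : MvPolynomial (Fin 2) ℝ)
    (hD : ∀ (ξ : ℝ) (F : Finset (negLog flagSet)), ∑ j ∈ F, ‖pieceMul p (ς j.1) j.1 ξ‖ ≤ D) :
    IsL2Bounded a p K := by
  have hcs : ∀ j ∈ negLog flagSet, HasCompactSupport (ς j) := fun j hj =>
    hasCompactSupport_of_tsupport_subset (hs j hj)
  have hsn : ∀ ξ, Summable fun j : negLog flagSet => ‖pieceMul p (ς j.1) j.1 ξ‖ := fun ξ =>
    summable_of_sum_le (fun _ => norm_nonneg _) (hD ξ)
  set m : ℝ → ℂ := fun ξ => ∑' j : negLog flagSet, pieceMul p (ς j.1) j.1 ξ with hm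
  have hmD : ∀ ξ, ‖m ξ‖ ≤ D := fun ξ =>
    (norm_tsum_le_tsum_norm (hsn ξ)).trans ((hsn ξ).tsum_le_of_sum_le (hD ξ))
  have hmc : AEStronglyMeasurable m volume := by
    refine aestronglyMeasurable_of_tendsto_ae (Filter.atTop : Filter (Finset (negLog flagSet)))
      (f := fun F ξ => ∑ j ∈ F, pieceMul p (ς j.1) j.1 ξ) (fun F => ?_)
      (Filter.Eventually.of_forall fun ξ => (hsn ξ).of_norm.hasSum)
    exact (continuous_finsetSum _ fun j _ =>
      continuous_pieceMul p (hc j.1 j.2) (hcs j.1 j.2) j.1).aestronglyMeasurable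
  have hmem : MemLp m ⊤ volume := memLp_top_of_bound hmc D (Filter.Eventually.of_forall hmD)
  set mL : Lp ℂ ⊤ (volume : Measure ℝ) := hmem.toLp m with hmL
  set U := Lp.fourierTransformₗᵢ ℝ ℂ with hU
  -- The extension is the Fourier multiplier operator: Plancherel, multiplication by the bounded
  -- function `m`, and inverse Plancherel.
  refine ⟨(U.symm.toContinuousLinearEquiv : Lp ℂ 2 (volume : Measure ℝ) →L[ℂ] _) ∘L
    ((ContinuousLinearMap.mul ℂ ℂ).holderL volume ⊤ 2 2 mL) ∘L
    (U.toContinuousLinearEquiv : Lp ℂ 2 (volume : Measure ℝ) →L[ℂ] _), fun f => ?_⟩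
  set g : SchwartzMap ℝ ℂ := f.hasCompactSupport.toSchwartzMap f.contDiff with hg
  have hgf : ∀ x, g x = f x := fun _ => rfl
  have hF : Integrable (𝓕 (g : ℝ → ℂ)) := by
    rw [← SchwartzMap.fourier_coe]; exact (𝓕 g).integrable
  have hfg : testToL2 f = g.toLp 2 := rfl
  set H := (ContinuousLinearMap.mul ℂ ℂ).holder 2 mL ((𝓕 g).toLp 2) with hH
  have hHae : (H : ℝ → ℂ) =ᵐ[volume] fun ξ => m ξ * 𝓕 (g : ℝ → ℂ) ξ := by
    filter_upwards [ContinuousLinearMap.coeFn_holder (r := 2) (ContinuousLinearMap.mul ℂ ℂ) mL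
      ((𝓕 g).toLp 2), hmem.coeFn_toLp, (𝓕 g).coeFn_toLp 2 volume] with ξ h1 h2 h3
    rw [hH, h1, hmL, h2, h3]
    rfl
  have hmF : Integrable fun ξ => m ξ * 𝓕 (g : ℝ → ℂ) ξ :=
    hF.bdd_mul (c := D) hmc (Filter.Eventually.of_forall hmD)
  have hHint : Integrable (H : ℝ → ℂ) := hmF.congr hHae.symm
  have happ : ((U.symm.toContinuousLinearEquiv : Lp ℂ 2 (volume : Measure ℝ) →L[ℂ] _) ∘L
      ((ContinuousLinearMap.mul ℂ ℂ).holderL volume ⊤ 2 2 mL) ∘L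
      (U.toContinuousLinearEquiv : Lp ℂ 2 (volume : Measure ℝ) →L[ℂ] _)) (testToL2 f) =
      (𝓕⁻ H : Lp ℂ 2 (volume : Measure ℝ)) := by
    have h1 : U (testToL2 f) = (𝓕 g).toLp 2 := by
      rw [hfg]; exact SchwartzMap.toLp_fourier_eq g
    change U.symm ((ContinuousLinearMap.mul ℂ ℂ).holder 2 mL (U (testToL2 f))) = _
    rw [h1]
    rfl
  rw [happ]
  refine (coeFn_fourierInv_eq H hHint).trans (Filter.Eventually.of_forall fun x => ?_)
  have h2 : 𝓕⁻ (H : ℝ → ℂ) x =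
      ∫ ξ, cis (2 * Real.pi * ξ * x) * (m ξ * 𝓕 (g : ℝ → ℂ) ξ) := by
    rw [fourierInv_eq_integral_cis]
    refine integral_congr_ae ?_
    filter_upwards [hHae] with ξ h3
    rw [h3]
  rw [h2]
  set T : negLog flagSet → ℝ → ℂ := fun j ξ =>
    cis (2 * Real.pi * ξ * x) * (pieceMul p (ς j.1) j.1 ξ * 𝓕 (g : ℝ → ℂ) ξ) with hT
  have hTn : ∀ j ξ, ‖T j ξ‖ = ‖pieceMul p (ς j.1) j.1 ξ‖ * ‖𝓕 (g : ℝ → ℂ) ξ‖ := fun j ξ => by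
    rw [hT]; simp
  have hTint : ∀ j, Integrable (T j) := by
    intro j
    refine Integrable.bdd_mul (c := 1) (hF.bdd_mul (c := D)
      (continuous_pieceMul p (hc j.1 j.2) (hcs j.1 j.2) j.1).aestronglyMeasurable
      (Filter.Eventually.of_forall fun ξ => ?_))
      (by fun_prop : Continuous _).aestronglyMeasurable
      (Filter.Eventually.of_forall fun z => by simp)
    simpa using hD ξ {j}
  -- The uniform bound `D` on partial sums, against the integrable `𝓕 g`, justifies exchanging the
  -- sum over `j` with the integral in `ξ`.
  have hTs : Summable fun j => ∫ ξ, ‖T j ξ‖ := by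
    refine summable_of_sum_le (c := ∫ ξ, D * ‖𝓕 (g : ℝ → ℂ) ξ‖)
      (fun j => integral_nonneg fun _ => norm_nonneg _) fun F => ?_
    rw [← integral_finsetSum _ fun j _ => (hTint j).norm]
    refine integral_mono (integrable_finsetSum _ fun j _ => (hTint j).norm)
      (hF.norm.const_mul D) fun ξ => ?_
    simp only [hTn, ← Finset.sum_mul]
    exact mul_le_mul_of_nonneg_right (hD ξ F) (norm_nonneg _)
  have hsum := hasSum_integral_of_summable_integral_norm hTint hTs
  have hop := hasSum_opT hc hra hs hK p f x
  have hterm : ∀ j : negLog flagSet, ∫ t, ς j.1 t * f (x - phase p j.1 t) = ∫ ξ, T j ξ := by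
    intro j
    exact integral_mul_translate_eq (hc j.1 j.2) (hcs j.1 j.2) j.1 g x
  simp only [hterm] at hop
  rw [hop.unique hsum]
  congr 1; funext ξ
  simp only [hT]
  rw [tsum_mul_left, tsum_mul_right]

/-- Of the bounded family, only the sup norms of `ς_j` and of its first derivative enter. -/
theorem isL2Bounded_of_mem_kernelClass {p : MvPolynomial (Fin 2) ℝ} {b : ℕ} (hb : 0 < b)
    (hcb : p.coeff (Finsupp.single 1 b) ≠ 0) (hdeg : ∀ α ∈ p.support, b ≤ α 0 + α 1) :
    ∃ ε : ℝ, 0 < ε ∧ ∀ a₀ ≤ ε, ∀ K ∈ kernelClass 2 stdExp a₀ flagSet, IsL2Bounded a₀ p K := by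
  obtain ⟨ε, hε, -, H⟩ := exists_sum_norm_pieceMul_le hb hcb hdeg
  refine ⟨ε, hε, fun a₀ ha₀ K hK => ?_⟩
  obtain ⟨C, hC, ς, ⟨hsm, ⟨r, hr, hs⟩, hbd⟩, hcan, hsum⟩ := hK
  obtain ⟨M₀, hM₀⟩ := hbd 0
  obtain ⟨M₁, hM₁⟩ := hbd 1
  have h0 : (0 : Fin 2 → ℕ) ∈ negLog flagSet := mem_negLog_flagSet.2 le_rfl
  obtain ⟨D, hD⟩ := H ς C (max M₀ M₁) r hC (hr.trans_le ha₀)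
    (le_max_of_le_left ((norm_nonneg _).trans (hM₀ 0 h0 0))) hsm hs
    (fun j hj t => le_max_of_le_left (by simpa using hM₀ j hj t))
    (fun j hj t => le_max_of_le_right (by
      rw [← norm_iteratedFDeriv_one]; exact hM₁ j hj t)) hcan
  exact isL2Bounded_of_sum_norm_pieceMul_le (fun j hj => (hsm j hj).continuous) hr hs hsum p hD

end Fourier

/-! ### Kernels with prescribed coefficients -/

/-- A summable weight dominating `2^{-j₁}` on the flag. -/
noncomputable def flagWeight (j : Fin 2 → ℕ) : ℝ := (√2)⁻¹ ^ j 0 * (√2)⁻¹ ^ j 1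

lemma flagWeight_nonneg (j : Fin 2 → ℕ) : 0 ≤ flagWeight j := by unfold flagWeight; positivity

lemma summable_flagWeight : Summable flagWeight := by
  have h2 : (√2)⁻¹ < 1 := inv_lt_one_of_one_lt₀ (by
    rw [Real.lt_sqrt] <;> norm_num)
  have hg := summable_geometric_of_lt_one (by positivity : (0 : ℝ) ≤ (√2)⁻¹) h2
  have h := hg.mul_of_nonneg hg (fun _ => by positivity) (fun _ => by positivity)
  exact ((finTwoArrowEquiv ℕ).summable_iff
    (f := fun z : ℕ × ℕ => (√2)⁻¹ ^ z.1 * (√2)⁻¹ ^ z.2)).2 h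

/-- On the flag `j 0 ≥ (j 0 + j 1) / 2`, which trades decay in `j 0` alone for decay in both
indices. -/
lemma inv_two_pow_le_flagWeight {j : Fin 2 → ℕ} (hj : j 1 ≤ j 0) :
    ((2 : ℝ) ^ j 0)⁻¹ ≤ flagWeight j := by
  have h1 : (√2)⁻¹ ≤ 1 := inv_le_one_of_one_le₀ (by rw [Real.le_sqrt] <;> norm_num)
  have h2 : ((2 : ℝ) ^ j 0)⁻¹ = (√2)⁻¹ ^ (j 0 + j 0) := by
    rw [← two_mul, pow_mul, inv_pow (√2) 2, Real.sq_sqrt (by norm_num), inv_pow]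
  rw [h2, flagWeight, ← pow_add]
  exact pow_le_pow_of_le_one (by positivity) h1 (by omega)

lemma exists_lipschitz_on_unitBall {h : EuclideanSpace ℝ (Fin 2) → ℂ} (hh : ContDiff ℝ ∞ h) :
    ∃ Λ ≥ 0, ∀ x ∈ Metric.closedBall (0 : EuclideanSpace ℝ (Fin 2)) 1,
      ∀ y ∈ Metric.closedBall (0 : EuclideanSpace ℝ (Fin 2)) 1, ‖h x - h y‖ ≤ Λ * ‖x - y‖ := by
  obtain ⟨Λ, hΛ⟩ := (isCompact_closedBall
    (0 : EuclideanSpace ℝ (Fin 2)) 1).exists_bound_of_continuousOn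
    (hh.continuous_fderiv (by simp)).continuousOn
  refine ⟨Λ, (norm_nonneg _).trans (hΛ 0 (by simp)), fun x hx y hy => ?_⟩
  exact (convex_closedBall _ _).norm_image_sub_le_of_norm_fderiv_le
    (fun z _ => (hh.differentiable (by simp)) z) hΛ hy hx

/-- Cancellation in the first coordinate allows subtracting the value of `h` at first coordinate
`0`, which after contraction is at distance at most `2^{-j 0}`. -/
lemma norm_integral_mul_contract_le {ς : EuclideanSpace ℝ (Fin 2) → ℂ} {M Λ : ℝ}
    (hc : Continuous ς) (hs : tsupport ς ⊆ Metric.closedBall 0 1) (hM0 : 0 ≤ M)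
    (hM : ∀ t, ‖ς t‖ ≤ M) (hcan : CancelsIn {0} ς) {h : EuclideanSpace ℝ (Fin 2) → ℂ}
    (hh : Continuous h) (hΛ0 : 0 ≤ Λ)
    (hΛ : ∀ x ∈ Metric.closedBall (0 : EuclideanSpace ℝ (Fin 2)) 1,
      ∀ y ∈ Metric.closedBall (0 : EuclideanSpace ℝ (Fin 2)) 1, ‖h x - h y‖ ≤ Λ * ‖x - y‖)
    (j : Fin 2 → ℕ) :
    ‖∫ t, ς t * h (contract j t)‖ ≤ M * Λ * discVol * ((2 : ℝ) ^ j 0)⁻¹ := by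
  have hcs := hasCompactSupport_of_tsupport_subset hs
  have hcon := continuous_contract j
  have hpair : Continuous fun y : ℝ => (WithLp.toLp 2 ![0, y] : EuclideanSpace ℝ (Fin 2)) :=
    continuous_toLp_pair.comp (by fun_prop : Continuous fun y : ℝ => ((0 : ℝ), y))
  have h0 := integral_mul_eq_zero_of_cancelsIn_zero hcan hc hcs
    (g := fun y => h (contract j (WithLp.toLp 2 ![0, y]))) (by fun_prop)
  have hsub : ∫ t, ς t * h (contract j t) =
      ∫ t, ς t * (h (contract j t) - h (contract j (WithLp.toLp 2 ![0, t 1]))) := by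
    rw [← sub_zero (∫ t, ς t * h (contract j t)), ← h0, ← integral_sub]
    · congr 1; funext t; ring
    · exact Continuous.integrable_of_hasCompactSupport (by fun_prop) hcs.mul_right
    · refine Continuous.integrable_of_hasCompactSupport (hc.mul ?_) hcs.mul_right
      exact hh.comp (hcon.comp (hpair.comp (by fun_prop)))
  rw [hsub]
  refine (norm_integral_le_discVol (M := M * (Λ * ((2 : ℝ) ^ j 0)⁻¹)) (fun t ht => ?_)
    fun t ht => ?_).trans (le_of_eq (by ring))
  · rw [eq_zero_of_notMem_closedBall le_rfl hs t ht, zero_mul]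
  · have hdiff : t - WithLp.toLp 2 ![0, t 1] = EuclideanSpace.single 0 (t 0) := by
      ext i; fin_cases i <;> simp
    have hmem : (WithLp.toLp 2 ![0, t 1] : EuclideanSpace ℝ (Fin 2)) ∈
        Metric.closedBall (0 : EuclideanSpace ℝ (Fin 2)) 1 := by
      have h1 : (WithLp.toLp 2 ![0, t 1] : EuclideanSpace ℝ (Fin 2)) =
          EuclideanSpace.single 1 (t 1) := by
        ext i; fin_cases i <;> simp
      rw [h1, mem_closedBall_zero_iff, PiLp.norm_single]
      exact abs_coord_le ht 1
    have hball : ∀ x ∈ Metric.closedBall (0 : EuclideanSpace ℝ (Fin 2)) 1,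
        contract j x ∈ Metric.closedBall (0 : EuclideanSpace ℝ (Fin 2)) 1 := by
      intro x hx
      rw [mem_closedBall_zero_iff] at hx ⊢
      exact (norm_contract_le j x).trans hx
    have hdist : ‖contract j t - contract j (WithLp.toLp 2 ![0, t 1])‖ ≤ ((2 : ℝ) ^ j 0)⁻¹ := by
      have h1 : contract j t - contract j (WithLp.toLp 2 ![0, t 1]) =
          EuclideanSpace.single 0 (((2 : ℝ) ^ j 0)⁻¹ * t 0) := by
        ext i; fin_cases i <;> simp
      rw [h1, PiLp.norm_single, norm_mul, Real.norm_of_nonneg (by positivity)]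
      exact mul_le_of_le_one_right (by positivity) (abs_coord_le ht 0)
    rw [norm_mul]
    have := hΛ _ (hball t ht) _ (hball _ hmem)
    gcongr
    · exact hM t
    · exact this.trans (by gcongr)

/-- The family `ε_j ς`, for `j` in the interior of the flag. -/
noncomputable def interiorFamily (ς : EuclideanSpace ℝ (Fin 2) → ℂ) (ε : (Fin 2 → ℕ) → ℂ)
    (j : Fin 2 → ℕ) : EuclideanSpace ℝ (Fin 2) → ℂ :=
  (if 0 < j 1 ∧ j 1 < j 0 then ε j else 0) • ς

section InteriorFamily

variable {ς : EuclideanSpace ℝ (Fin 2) → ℂ} {ε : (Fin 2 → ℕ) → ℂ} {B r : ℝ}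

lemma norm_interior_coeff_le (hε : ∀ j, ‖ε j‖ ≤ B) (j : Fin 2 → ℕ) :
    ‖(if 0 < j 1 ∧ j 1 < j 0 then ε j else 0)‖ ≤ B := by
  split_ifs
  · exact hε j
  · simpa using (norm_nonneg _).trans (hε j)

lemma contDiff_interiorFamily (hς : ContDiff ℝ ∞ ς) (j : Fin 2 → ℕ) :
    ContDiff ℝ ∞ (interiorFamily ς ε j) := contDiff_const.smul hς

lemma tsupport_interiorFamily_subset (hs : tsupport ς ⊆ Metric.closedBall 0 r) (j : Fin 2 → ℕ) :
    tsupport (interiorFamily ς ε j) ⊆ Metric.closedBall 0 r :=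
  (closure_mono (Function.support_const_smul_subset _ _)).trans hs

lemma isBoundedFamily_interiorFamily {a : ℝ} (hς : ContDiff ℝ ∞ ς) (hra : r < a)
    (hs : tsupport ς ⊆ Metric.closedBall 0 r) (hε : ∀ j, ‖ε j‖ ≤ B) (J : Set (Fin 2 → ℕ)) :
    IsBoundedFamily a J (interiorFamily ς ε) := by
  refine ⟨fun j _ => contDiff_interiorFamily hς j,
    ⟨r, hra, fun j _ => tsupport_interiorFamily_subset hs j⟩, fun m => ?_⟩
  have hcs := hasCompactSupport_of_tsupport_subset hs
  have hB : 0 ≤ B := (norm_nonneg _).trans (hε 0)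
  obtain ⟨M, hM⟩ := (hς.continuous_iteratedFDeriv (m := m)
    (mod_cast le_top)).bounded_above_of_compact_support (hcs.iteratedFDeriv m)
  refine ⟨B * M, fun j _ t => ?_⟩
  rw [interiorFamily, iteratedFDeriv_const_smul_apply (hς.contDiffAt.of_le (mod_cast le_top)),
    norm_smul]
  gcongr
  · exact norm_interior_coeff_le hε j
  · exact hM t

lemma integral_interiorFamily_mul (g : EuclideanSpace ℝ (Fin 2) → ℂ) (j : Fin 2 → ℕ) :
    ∫ t, interiorFamily ς ε j t * g t =
      (if 0 < j 1 ∧ j 1 < j 0 then ε j else 0) * ∫ t, ς t * g t := by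
  rw [← integral_const_mul]
  congr 1; funext t
  simp only [interiorFamily, Pi.smul_apply, smul_eq_mul, mul_assoc]

lemma norm_integral_interiorFamily_le {M Λ : ℝ}
    (hc : Continuous ς) (hs : tsupport ς ⊆ Metric.closedBall 0 1) (hM0 : 0 ≤ M)
    (hM : ∀ t, ‖ς t‖ ≤ M) (hcan : CancelsIn {0} ς) (hε : ∀ j, ‖ε j‖ ≤ B)
    {h : EuclideanSpace ℝ (Fin 2) → ℂ} (hh : Continuous h) (hΛ0 : 0 ≤ Λ)
    (hΛ : ∀ x ∈ Metric.closedBall (0 : EuclideanSpace ℝ (Fin 2)) 1,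
      ∀ y ∈ Metric.closedBall (0 : EuclideanSpace ℝ (Fin 2)) 1, ‖h x - h y‖ ≤ Λ * ‖x - y‖)
    (j : negLog flagSet) :
    ‖∫ t, interiorFamily ς ε j.1 t * h (contract j.1 t)‖ ≤
      B * M * discVol * Λ * flagWeight j.1 := by
  have hB : 0 ≤ B := (norm_nonneg _).trans (hε 0)
  have hV := discVol_nonneg
  rw [integral_interiorFamily_mul (fun t => h (contract j.1 t)), norm_mul]
  calc _ ≤ B * (M * Λ * discVol * ((2 : ℝ) ^ j.1 0)⁻¹) := by
        gcongr
        · exact norm_interior_coeff_le hε j.1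
        · exact norm_integral_mul_contract_le hc hs hM0 hM hcan hh hΛ0 hΛ j.1
    _ ≤ B * (M * Λ * discVol * flagWeight j.1) := by
        gcongr
        exact inv_two_pow_le_flagWeight (mem_negLog_flagSet.1 j.2)
    _ = _ := by ring

/-- The dyadic sum converges absolutely against every test function, with a bound by the sup of its
first derivative, so it defines a distribution for any bounded choice of coefficients. -/
lemma exists_mem_kernelClass {a : ℝ} (hς : ContDiff ℝ ∞ ς) (hra : r < a) (hr1 : r ≤ 1)
    (hs : tsupport ς ⊆ Metric.closedBall 0 r) (hcan0 : CancelsIn {0} ς) (hcan1 : CancelsIn {1} ς)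
    (hε : ∀ j, ‖ε j‖ ≤ B) :
    ∃ K ∈ kernelClass 2 stdExp a flagSet, ∀ φ : 𝓓((⊤ : Opens (EuclideanSpace ℝ (Fin 2))), ℝ),
      HasSum (fun j : negLog flagSet =>
        ∫ t, dilFun stdExp j.1 (interiorFamily ς ε j.1) t * (φ t : ℂ)) (K φ) := by
  have hcs := hasCompactSupport_of_tsupport_subset hs
  have hs1 := hs.trans (Metric.closedBall_subset_closedBall hr1)
  obtain ⟨M, hM⟩ := hς.continuous.bounded_above_of_compact_support hcs
  have hM0 : 0 ≤ M := (norm_nonneg _).trans (hM 0)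
  have hB : 0 ≤ B := (norm_nonneg _).trans (hε 0)
  have hV := discVol_nonneg
  have hw : Summable fun j : negLog flagSet => flagWeight j.1 := summable_flagWeight.subtype _
  set D : 𝓓((⊤ : Opens (EuclideanSpace ℝ (Fin 2))), ℝ) → negLog flagSet → ℂ := fun φ j =>
    ∫ t, dilFun stdExp j.1 (interiorFamily ς ε j.1) t * (φ t : ℂ) with hD
  have hDle : ∀ (φ : 𝓓((⊤ : Opens (EuclideanSpace ℝ (Fin 2))), ℝ)) (Λ : ℝ), 0 ≤ Λ →
      (∀ x, ‖fderiv ℝ φ x‖ ≤ Λ) → ∀ j,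
      ‖D φ j‖ ≤ B * M * discVol * Λ * flagWeight j.1 := by
    intro φ Λ hΛ0 hΛ j
    simp only [hD]
    rw [integral_dilFun_mul j.1 _ (fun t => ((φ t : ℝ) : ℂ))]
    refine norm_integral_interiorFamily_le hς.continuous hs1 hM0 hM hcan0 hε
      (h := fun t => ((φ t : ℝ) : ℂ)) (Complex.continuous_ofReal.comp φ.continuous) hΛ0
      (fun x _ y _ => ?_) j
    rw [← Complex.ofReal_sub, Complex.norm_real]
    exact convex_univ.norm_image_sub_le_of_norm_fderiv_le
      (fun z _ => (φ.contDiff.differentiable (by simp)) z) (fun z _ => hΛ z) (Set.mem_univ y)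
      (Set.mem_univ x)
  have hDs : ∀ φ, Summable (D φ) := by
    intro φ
    obtain ⟨Λ, hΛ⟩ := (φ.contDiff.continuous_fderiv
      (by simp)).bounded_above_of_compact_support (φ.hasCompactSupport.fderiv ℝ)
    exact Summable.of_norm_bounded (hw.mul_left _)
      (hDle φ Λ ((norm_nonneg _).trans (hΛ 0)) hΛ)
  have hDint : ∀ (φ : 𝓓((⊤ : Opens (EuclideanSpace ℝ (Fin 2))), ℝ)) (j : negLog flagSet),
      Integrable fun t => interiorFamily ς ε j.1 t * ((φ (contract j.1 t) : ℝ) : ℂ) := by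
    intro φ j
    have h1 := φ.continuous
    have h2 := continuous_contract j.1
    have h3 := (contDiff_interiorFamily (ε := ε) hς j.1).continuous
    exact Continuous.integrable_of_hasCompactSupport (by fun_prop)
      (hasCompactSupport_of_tsupport_subset (tsupport_interiorFamily_subset hs j.1)).mul_right
  have hDc : ∀ φ j, D φ j =
      ∫ t, interiorFamily ς ε j.1 t * ((φ (contract j.1 t) : ℝ) : ℂ) := fun φ j =>
    integral_dilFun_mul j.1 _ (fun t => ((φ t : ℝ) : ℂ))
  have hadd : ∀ (φ ψ : 𝓓((⊤ : Opens (EuclideanSpace ℝ (Fin 2))), ℝ)) (j : negLog flagSet),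
       D (φ + ψ) j = D φ j + D ψ j := by
    intro φ ψ j
    rw [hDc, hDc, hDc, ← integral_add (hDint φ j) (hDint ψ j)]
    congr 1; funext t
    simp only [FunLike.coe_add, Pi.add_apply]
    push_cast
    ring
  have hsmul : ∀ (c : ℝ) (φ : 𝓓((⊤ : Opens (EuclideanSpace ℝ (Fin 2))), ℝ)) (j : negLog flagSet),
       D (c • φ) j = c • D φ j := by
    intro c φ j
    rw [hDc, hDc, ← integral_smul]
    congr 1; funext t
    simp only [FunLike.coe_smul, Pi.smul_apply, smul_eq_mul, Complex.real_smul]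
    push_cast
    ring
  have hTadd : ∀ φ ψ : 𝓓((⊤ : Opens (EuclideanSpace ℝ (Fin 2))), ℝ),
       ∑' j, D (φ + ψ) j = ∑' j, D φ j + ∑' j, D ψ j := by
    intro φ ψ
    simp only [hadd]
    exact (hDs φ).tsum_add (hDs ψ)
  have hTsmul : ∀ (c : ℝ) (φ : 𝓓((⊤ : Opens (EuclideanSpace ℝ (Fin 2))), ℝ)),
       ∑' j, D (c • φ) j = c • ∑' j, D φ j := by
    intro c φ
    simp only [hsmul]
    exact (hDs φ).tsum_const_smul c
  have hW : 0 ≤ ∑' j : negLog flagSet, flagWeight j.1 :=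
    tsum_nonneg fun j : negLog flagSet => flagWeight_nonneg j.1
  let K : 𝓓'((⊤ : Opens (EuclideanSpace ℝ (Fin 2))), ℂ) :=
    TestFunction.mkCLM ℝ (fun φ => ∑' j, D φ j) hTadd hTsmul fun Q hQ =>
      (ContDiffMapSupportedIn.mkCLMtoNormedSpace (𝕜 := ℝ)
        (fun φ => ∑' j, D (TestFunction.ofSupportedIn hQ φ) j)
        (fun φ ψ => hTadd (TestFunction.ofSupportedIn hQ φ) (TestFunction.ofSupportedIn hQ ψ))
        (fun c φ => hTsmul c (TestFunction.ofSupportedIn hQ φ))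
        ⟨{1}, (B * M * discVol) * ∑' j : negLog flagSet, flagWeight j.1,
          mul_nonneg (by positivity) hW, fun φ => by
          rw [Finset.sup_singleton]
          set Λ := ContDiffMapSupportedIn.seminorm ℝ (EuclideanSpace ℝ (Fin 2)) ℝ ⊤ Q 1 φ with hΛ
          have h1 := hDle (TestFunction.ofSupportedIn hQ φ) Λ (apply_nonneg _ _) (fun x => by
            rw [← norm_iteratedFDeriv_one]
            exact ContDiffMapSupportedIn.norm_iteratedFDeriv_apply_le_seminorm_top ℝ)
          refine (tsum_of_norm_bounded (hw.mul_left _).hasSum h1).trans (le_of_eq ?_)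
          rw [tsum_mul_left]
          ring⟩ : _ →L[ℝ] ℂ).continuous
  have hKs : ∀ φ, HasSum (D φ) (K φ) := fun φ => (hDs φ).hasSum
  refine ⟨K, ⟨1, le_rfl, interiorFamily ς ε, isBoundedFamily_interiorFamily hς hra hs hε _,
    fun j _ => ?_, hKs⟩, hKs⟩
  change HasClassCancellation stdExp flagSet 1 j (interiorFamily ς ε j)
  -- In the interior both index classes are singletons, so the two cancellations of `ς` suffice;
  -- elsewhere the family is zero.
  by_cases hj : 0 < j 1 ∧ j 1 < j 0
  · have hsm : ∀ S, CancelsIn S ς → CancelsIn S (interiorFamily ς ε j) := by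
      intro S h t
      simp only [interiorFamily, Pi.smul_apply, integral_smul, h t, smul_zero]
    exact hasClassCancellation_of_cancelsIn le_rfl hj.2 hj.1 (hsm _ hcan0) (hsm _ hcan1)
  · intro μ _ _ t
    simp [interiorFamily, hj]

end InteriorFamily

/-! ### The multiplier of a bounded operator is bounded -/

lemma _root_.ContDiff.cis {E : Type*} [NormedAddCommGroup E] [NormedSpace ℝ E] {g : E → ℝ}
    (hg : ContDiff ℝ ∞ g) : ContDiff ℝ ∞ fun x => cis (g x) := by
  have h : ContDiff ℝ ∞ fun x => (g x : ℂ) := Complex.ofRealCLM.contDiff.comp hg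
  exact (h.mul contDiff_const).cexp

/-- A bump function on the line, equal to `1` for `|x| ≤ R`. -/
noncomputable def lineBump (R : ℝ) (hR : 0 < R) : ContDiffBump (0 : ℝ) :=
  ⟨R, 2 * R, hR, by linarith⟩

lemma contDiff_lineBump_ofReal (R : ℝ) (hR : 0 < R) :
    ContDiff ℝ ∞ fun x => ((lineBump R hR x : ℝ) : ℂ) :=
  Complex.ofRealCLM.contDiff.comp (lineBump R hR).contDiff

/-- The character `e^{2πiξx}`, cut off to a compact set and equal to the character for `|x| ≤ R`. -/
noncomputable def cutoffChar (R : ℝ) (hR : 0 < R) (ξ : ℝ) : 𝓓((⊤ : Opens ℝ), ℂ) where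
  toFun x := ((lineBump R hR x : ℝ) : ℂ) * cis (2 * Real.pi * ξ * x)
  contDiff' := (contDiff_lineBump_ofReal R hR).mul
    (ContDiff.cis (by fun_prop : ContDiff ℝ ∞ fun x => 2 * Real.pi * ξ * x))
  hasCompactSupport' :=
    HasCompactSupport.mul_right ((lineBump R hR).hasCompactSupport.comp_left Complex.ofReal_zero)
  tsupport_subset' := by simp

lemma cutoffChar_apply {R : ℝ} (hR : 0 < R) (ξ x : ℝ) :
    cutoffChar R hR ξ x = ((lineBump R hR x : ℝ) : ℂ) * cis (2 * Real.pi * ξ * x) := rfl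

lemma cutoffChar_of_abs_le {R : ℝ} (hR : 0 < R) (ξ : ℝ) {x : ℝ} (hx : |x| ≤ R) :
    cutoffChar R hR ξ x = cis (2 * Real.pi * ξ * x) := by
  rw [cutoffChar_apply, ContDiffBump.one_of_mem_closedBall]
  · simp
  · simpa [lineBump] using hx

lemma norm_cutoffChar_le {R : ℝ} (hR : 0 < R) (ξ x : ℝ) :
    ‖cutoffChar R hR ξ x‖ ≤ ‖(Set.Icc (-(2 * R)) (2 * R)).indicator (fun _ => (1 : ℂ)) x‖ := by
  rw [cutoffChar_apply, norm_mul, norm_cis, mul_one, Complex.norm_real,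
    Real.norm_of_nonneg (ContDiffBump.nonneg _)]
  by_cases hx : x ∈ Set.Icc (-(2 * R)) (2 * R)
  · rw [Set.indicator_of_mem hx, norm_one]
    exact ContDiffBump.le_one _
  · rw [ContDiffBump.zero_of_le_dist]
    · positivity
    · rw [Real.dist_0_eq_abs]
      by_contra h
      exact hx (abs_le.1 (not_le.1 h).le)

/-- A bounded operator `T_K` has a bounded multiplier. -/
lemma norm_tsum_pieceMul_le {a r : ℝ}
    {ς : (Fin 2 → ℕ) → EuclideanSpace ℝ (Fin 2) → ℂ}
    {K : 𝓓'((⊤ : Opens (EuclideanSpace ℝ (Fin 2))), ℂ)}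
    (hc : ∀ j ∈ negLog flagSet, Continuous (ς j)) (hra : r < a) (hr1 : r ≤ 1)
    (hs : ∀ j ∈ negLog flagSet, tsupport (ς j) ⊆ Metric.closedBall 0 r)
    (hK : ∀ φ : 𝓓((⊤ : Opens (EuclideanSpace ℝ (Fin 2))), ℝ),
      HasSum (fun j : negLog flagSet => ∫ t, dilFun stdExp j.1 (ς j.1) t * (φ t : ℂ)) (K φ))
    {p : MvPolynomial (Fin 2) ℝ} (hb : IsL2Bounded a p K) :
    ∃ C, ∀ ξ, ‖∑' j : negLog flagSet, pieceMul p (ς j.1) j.1 ξ‖ ≤ C := by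
  obtain ⟨T, hT⟩ := hb
  obtain ⟨P, hP⟩ := (isCompact_closedBall
    (0 : EuclideanSpace ℝ (Fin 2)) 1).exists_bound_of_continuousOn
    (contDiff_eval p).continuous.continuousOn
  set Q := max P 1 with hQ
  have hQ0 : 0 < Q := lt_max_of_lt_right one_pos
  have hphase : ∀ j, ∀ t ∈ Metric.closedBall (0 : EuclideanSpace ℝ (Fin 2)) 1,
      |phase p j t| ≤ Q := by
    intro j t ht
    refine le_max_of_le_left (hP (contract j t) ?_)
    rw [mem_closedBall_zero_iff] at ht ⊢
    exact (norm_contract_le j t).trans ht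
  have hR : 0 < 2 * Q := by positivity
  refine ⟨2 * ‖T‖, fun ξ => ?_⟩
  set m := ∑' j : negLog flagSet, pieceMul p (ς j.1) j.1 ξ with hm
  -- For `|x| ≤ Q` the operator only sees `f` on `[-2Q, 2Q]`, where `f` is the pure character, an
  -- eigenfunction with eigenvalue `m`. Comparing `L²` norms on intervals of lengths `2Q` and `8Q`
  -- yields the factor `2`.
  set f := cutoffChar (2 * Q) hR ξ with hf
  have hop : ∀ x ∈ Set.Icc (-Q) Q, opT a p K f x = cis (2 * Real.pi * ξ * x) * m := by
    intro x hx
    rw [← (hasSum_opT hc hra hs hK p f x).tsum_eq, hm, ← tsum_mul_left]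
    congr 1; funext j
    rw [pieceMul, ← integral_const_mul]
    congr 1; funext t
    by_cases ht : t ∈ Metric.closedBall (0 : EuclideanSpace ℝ (Fin 2)) 1
    · have h1 := hphase j.1 t ht
      have h2 : |x - phase p j.1 t| ≤ 2 * Q := by
        rw [abs_le] at h1 ⊢
        constructor <;> linarith [hx.1, hx.2]
      have h3 : cis (2 * Real.pi * ξ * (x - phase p j.1 t)) =
          cis (2 * Real.pi * ξ * x) * cis (-(2 * Real.pi * ξ) * phase p j.1 t) := by
        rw [← cis_add]; congr 1; ring
      rw [hf, cutoffChar_of_abs_le hR ξ h2, h3]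
      ring
    · rw [eq_zero_of_notMem_closedBall hr1 (hs j.1 j.2) t ht]
      ring
  have hlow : ENNReal.ofReal (‖m‖ * (2 * Q) ^ (1 / 2 : ℝ)) ≤ eLpNorm (T (testToL2 f)) 2 volume := by
    have h1 : eLpNorm ((Set.Icc (-Q) Q).indicator fun _ => m) 2 volume ≤
        eLpNorm (T (testToL2 f)) 2 volume := by
      refine eLpNorm_mono_ae ?_
      filter_upwards [hT f] with x hx
      by_cases hxQ : x ∈ Set.Icc (-Q) Q
      · rw [Set.indicator_of_mem hxQ, hx, hop x hxQ, norm_mul, norm_cis, one_mul]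
      · rw [Set.indicator_of_notMem hxQ, norm_zero]; positivity
    refine le_trans (le_of_eq ?_) h1
    rw [eLpNorm_indicator_const measurableSet_Icc (by norm_num) (by norm_num), Real.volume_Icc,
      ENNReal.ofReal_mul (norm_nonneg _), ofReal_norm,
      ← ENNReal.ofReal_rpow_of_nonneg (by positivity) (by positivity)]
    congr 3
    ring
  have hup : eLpNorm (testToL2 f) 2 volume ≤ ENNReal.ofReal ((8 * Q) ^ (1 / 2 : ℝ)) := by
    have h0 : eLpNorm (testToL2 f) 2 volume = eLpNorm f 2 volume :=
      eLpNorm_congr_ae (MemLp.coeFn_toLp _)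
    rw [h0]
    refine (eLpNorm_mono (norm_cutoffChar_le hR ξ)).trans (le_of_eq ?_)
    rw [eLpNorm_indicator_const measurableSet_Icc (by norm_num) (by norm_num), Real.volume_Icc,
      enorm_one, one_mul, ← ENNReal.ofReal_rpow_of_nonneg (by positivity) (by positivity)]
    congr 2
    ring
  have hup' : ‖testToL2 f‖ ≤ (8 * Q) ^ (1 / 2 : ℝ) := by
    rw [Lp.norm_def]
    exact ENNReal.toReal_le_of_le_ofReal (by positivity) hup
  have hlow' : ‖m‖ * (2 * Q) ^ (1 / 2 : ℝ) ≤ ‖T (testToL2 f)‖ := by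
    rw [Lp.norm_def]
    exact (ENNReal.ofReal_le_iff_le_toReal (Lp.eLpNorm_ne_top _)).1 hlow
  have h8 : (8 * Q) ^ (1 / 2 : ℝ) = 2 * (2 * Q) ^ (1 / 2 : ℝ) := by
    rw [show 8 * Q = 4 * (2 * Q) by ring, Real.mul_rpow (by norm_num) (by positivity)]
    congr 1
    rw [← Real.sqrt_eq_rpow, show (4 : ℝ) = 2 ^ 2 by norm_num, Real.sqrt_sq (by norm_num)]
  have hpos : 0 < (2 * Q) ^ (1 / 2 : ℝ) := by positivity
  have hfin : ‖m‖ * (2 * Q) ^ (1 / 2 : ℝ) ≤ 2 * ‖T‖ * (2 * Q) ^ (1 / 2 : ℝ) := by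
    calc _ ≤ ‖T (testToL2 f)‖ := hlow'
      _ ≤ ‖T‖ * ‖testToL2 f‖ := T.le_opNorm _
      _ ≤ ‖T‖ * (2 * (2 * Q) ^ (1 / 2 : ℝ)) := by rw [← h8]; gcongr
      _ = _ := by ring
  exact le_of_mul_le_mul_right hfin hpos

/-- If all `T_K` are bounded, the multipliers of the interior dyadic pieces of a fixed product-type
bump are absolutely summable, uniformly in the frequency. -/
lemma exists_sum_norm_pieceMul_le_of_isL2Bounded {a r : ℝ} {p : MvPolynomial (Fin 2) ℝ}
    {ς : EuclideanSpace ℝ (Fin 2) → ℂ} (hς : ContDiff ℝ ∞ ς) (hra : r < a) (hr1 : r ≤ 1)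
    (hs : tsupport ς ⊆ Metric.closedBall 0 r) (hcan0 : CancelsIn {0} ς) (hcan1 : CancelsIn {1} ς)
    (hall : ∀ K ∈ kernelClass 2 stdExp a flagSet, IsL2Bounded a p K) :
    ∃ C, ∀ (ξ : ℝ) (F : Finset (Fin 2 → ℕ)), (∀ j ∈ F, 0 < j 1 ∧ j 1 < j 0) →
      ∑ j ∈ F, ‖pieceMul p ς j ξ‖ ≤ C := by
  classical
  have hcs := hasCompactSupport_of_tsupport_subset hs
  have hs1 := hs.trans (Metric.closedBall_subset_closedBall hr1)
  obtain ⟨M, hM⟩ := hς.continuous.bounded_above_of_compact_support hcs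
  have hM0 : 0 ≤ M := (norm_nonneg _).trans (hM 0)
  have hV := discVol_nonneg
  have hw : Summable fun j : negLog flagSet => flagWeight j.1 := summable_flagWeight.subtype _
  have hbound : ∀ ξ, ∃ Λ ≥ 0, ∀ (ε : (Fin 2 → ℕ) → ℂ) (B : ℝ), (∀ j, ‖ε j‖ ≤ B) →
      ∀ j : negLog flagSet, ‖pieceMul p (interiorFamily ς ε j.1) j.1 ξ‖ ≤
        B * M * discVol * Λ * flagWeight j.1 := by
    intro ξ
    set h : EuclideanSpace ℝ (Fin 2) → ℂ := fun t =>
      cis (-(2 * Real.pi * ξ) * MvPolynomial.eval (fun i => t i) p) with hh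
    have hsm : ContDiff ℝ ∞ h := ContDiff.cis (contDiff_const.mul (contDiff_eval p))
    obtain ⟨Λ, hΛ0, hΛ⟩ := exists_lipschitz_on_unitBall hsm
    exact ⟨Λ, hΛ0, fun ε B hε j => norm_integral_interiorFamily_le hς.continuous hs1 hM0 hM hcan0 hε
      hsm.continuous hΛ0 hΛ j⟩
  have hfam : ∀ (ε : (Fin 2 → ℕ) → ℂ) (j : Fin 2 → ℕ) ξ,
      pieceMul p (interiorFamily ς ε j) j ξ =
        (if 0 < j 1 ∧ j 1 < j 0 then ε j else 0) * pieceMul p ς j ξ := fun ε j ξ =>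
    integral_interiorFamily_mul _ j
  have hsummable : ∀ ξ (ε : lp (fun _ : Fin 2 → ℕ => ℂ) ⊤),
      Summable fun j : negLog flagSet => pieceMul p (interiorFamily ς ε j.1) j.1 ξ := by
    intro ξ ε
    obtain ⟨Λ, -, hΛ⟩ := hbound ξ
    exact Summable.of_norm_bounded (hw.mul_left _)
      (hΛ ε ‖ε‖ fun j => lp.norm_apply_le_norm ENNReal.top_ne_zero ε j)
  -- `L ξ` sends a coefficient sequence to the multiplier at `ξ` of its kernel. It is a bounded
  -- functional for each `ξ`, with a bound that may depend on `ξ`.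
  let L : ℝ → lp (fun _ : Fin 2 → ℕ => ℂ) ⊤ →ₗ[ℂ] ℂ := fun ξ =>
    { toFun := fun ε => ∑' j : negLog flagSet, pieceMul p (interiorFamily ς ε j.1) j.1 ξ
      map_add' := fun ε ε' => by
        rw [← (hsummable ξ ε).tsum_add (hsummable ξ ε')]
        congr 1; funext j
        simp only [hfam, lp.coeFn_add, Pi.add_apply]
        split_ifs <;> ring
      map_smul' := fun c ε => by
        simp only [hfam, lp.coeFn_smul, Pi.smul_apply, smul_eq_mul, RingHom.id_apply]
        rw [← tsum_mul_left]
        congr 1; funext j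
        split_ifs <;> ring }
  have hLb : ∀ ξ, ∃ C, ∀ ε, ‖L ξ ε‖ ≤ C * ‖ε‖ := by
    intro ξ
    obtain ⟨Λ, -, hΛ⟩ := hbound ξ
    refine ⟨M * discVol * Λ * ∑' j : negLog flagSet, flagWeight j.1, fun ε => ?_⟩
    refine (tsum_of_norm_bounded (hw.mul_left _).hasSum
      (hΛ ε ‖ε‖ fun j => lp.norm_apply_le_norm ENNReal.top_ne_zero ε j)).trans (le_of_eq ?_)
    rw [tsum_mul_left]
    ring
  choose CL hCL using hLb
  have hpt : ∀ ε, ∃ C, ∀ ξ, ‖(L ξ).mkContinuous (CL ξ) (hCL ξ) ε‖ ≤ C := by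
    intro ε
    have hε : ∀ j, ‖ε j‖ ≤ ‖ε‖ := fun j => lp.norm_apply_le_norm ENNReal.top_ne_zero ε j
    obtain ⟨K, hK, hKs⟩ := exists_mem_kernelClass hς hra hr1 hs hcan0 hcan1 hε
    exact norm_tsum_pieceMul_le
      (fun j _ => (contDiff_interiorFamily hς j).continuous) hra hr1
      (fun j _ => tsupport_interiorFamily_subset hs j) hKs (hall K hK)
  -- For each fixed sequence the values are bounded in `ξ`, because the corresponding operator is
  -- bounded on `L²`; hence the functionals are uniformly bounded.
  obtain ⟨C, hC⟩ := banach_steinhaus hpt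
  refine ⟨C, fun ξ F hF => ?_⟩
  -- Conjugate phases turn the sum into a sum of absolute values. Where the multiplier vanishes,
  -- division by zero gives `0`, which is harmless.
  set e : (Fin 2 → ℕ) → ℂ := fun j =>
    if j ∈ F then (starRingEnd ℂ) (pieceMul p ς j ξ) / ‖pieceMul p ς j ξ‖ else 0 with he
  have he1 : ∀ j, ‖e j‖ ≤ 1 := by
    intro j
    simp only [he]
    split_ifs
    · rw [norm_div, RCLike.norm_conj, Complex.norm_real, norm_norm]
      exact div_self_le_one _
    · simp
  have hmem : Memℓp e ⊤ := memℓp_infty ⟨1, by rintro _ ⟨j, rfl⟩; exact he1 j⟩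
  set E : lp (fun _ : Fin 2 → ℕ => ℂ) ⊤ := ⟨e, hmem⟩ with hE
  have hEn : ‖E‖ ≤ 1 := lp.norm_le_of_forall_le zero_le_one he1
  have hLE : L ξ E = ((∑ j ∈ F, ‖pieceMul p ς j ξ‖ : ℝ) : ℂ) := by
    change ∑' j : negLog flagSet, pieceMul p (interiorFamily ς e j.1) j.1 ξ = _
    have hz : ∀ j ∉ F, pieceMul p (interiorFamily ς e j) j ξ = 0 := by
      intro j hj
      rw [hfam]
      simp [he, hj]
    have hsub : ∀ j ∉ negLog flagSet, pieceMul p (interiorFamily ς e j) j ξ = 0 := by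
      intro j hj
      refine hz j fun hjF => hj (mem_negLog_flagSet.2 (hF j hjF).2.le)
    rw [tsum_subtype_eq_of_support_subset
      (f := fun j => pieceMul p (interiorFamily ς e j) j ξ)
      (fun j hj => by by_contra h; exact hj (hsub j h)), tsum_eq_sum hz, Complex.ofReal_sum]
    refine Finset.sum_congr rfl fun j hj => ?_
    rw [hfam, if_pos (hF j hj)]
    simp only [he, if_pos hj]
    rcases eq_or_ne (pieceMul p ς j ξ) 0 with h0 | h0
    · simp [h0]
    · have h1 : (‖pieceMul p ς j ξ‖ : ℂ) ≠ 0 := by simpa using h0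
      rw [div_mul_eq_mul_div, mul_comm, Complex.mul_conj, Complex.normSq_eq_norm_sq]
      push_cast
      field_simp
  have hfin := ((L ξ).mkContinuous (CL ξ) (hCL ξ)).le_opNorm E
  rw [LinearMap.mkContinuous_apply, hLE, Complex.norm_real,
    Real.norm_of_nonneg (Finset.sum_nonneg fun _ _ => norm_nonneg _)] at hfin
  refine hfin.trans ?_
  calc _ ≤ ‖(L ξ).mkContinuous (CL ξ) (hCL ξ)‖ * 1 := by gcongr
    _ ≤ C := by rw [mul_one]; exact hC ξ

/-! ### A product-type bump with cancellation in each variable -/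

/-- A compactly supported function on the line of vanishing integral and non-vanishing moments. -/
lemma exists_bump_deriv {ρ : ℝ} (hρ : 0 < ρ) :
    ∃ h : ℝ → ℝ, ContDiff ℝ ∞ h ∧ (∀ x, ρ < |x| → h x = 0) ∧ ∫ x, h x = 0 ∧
      ∀ m : ℕ, 0 < m → ∫ x, x ^ m * h x ≠ 0 := by
  -- The bump sits on the positive half-line, so that no moment of its derivative vanishes by
  -- parity: `∫ x^m φ' = -m ∫ x^{m-1} φ < 0`.
  set φ : ContDiffBump (ρ / 2) := ⟨ρ / 8, ρ / 4, by positivity, by linarith⟩ with hφ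
  have hφs : ContDiff ℝ ∞ φ := φ.contDiff
  have hφd : ∀ x, HasDerivAt φ (deriv φ x) x := fun x =>
    ((hφs.differentiable (by simp)) x).hasDerivAt
  have hdc : ContDiff ℝ ∞ (deriv φ) := ((contDiff_infty_iff_deriv (𝕜 := ℝ)).1 hφs).2
  have hcs : HasCompactSupport (φ : ℝ → ℝ) := φ.hasCompactSupport
  have hdcs : HasCompactSupport (deriv φ) := hcs.deriv
  have hsupp : tsupport (φ : ℝ → ℝ) ⊆ Metric.closedBall (ρ / 2) (ρ / 4) := by
    rw [φ.tsupport_eq]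
  refine ⟨deriv φ, hdc, fun x hx => ?_, ?_, fun m hm => ?_⟩
  · refine image_eq_zero_of_notMem_tsupport fun hmem => ?_
    have h1 := hsupp (tsupport_deriv_subset hmem)
    rw [Metric.mem_closedBall, Real.dist_eq, abs_le] at h1
    rcases lt_abs.1 hx with h | h <;> linarith [h1.1, h1.2]
  · exact integral_eq_zero_of_hasDerivAt_of_integrable hφd
      (hdc.continuous.integrable_of_hasCompactSupport hdcs)
      (hφs.continuous.integrable_of_hasCompactSupport hcs)
  · have hi1 : Integrable fun x : ℝ => (m : ℝ) * x ^ (m - 1) * φ x :=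
      Continuous.integrable_of_hasCompactSupport (by fun_prop) hcs.mul_left
    have hi2 : Integrable fun x : ℝ => x ^ m * deriv φ x :=
      Continuous.integrable_of_hasCompactSupport
        ((continuous_pow m).mul hdc.continuous) hdcs.mul_left
    have h0 : ∫ x : ℝ, ((m : ℝ) * x ^ (m - 1) * φ x + x ^ m * deriv φ x) = 0 :=
      integral_eq_zero_of_hasDerivAt_of_integrable (f := fun x => x ^ m * φ x)
        (fun x => (hasDerivAt_pow m x).mul (hφd x)) (hi1.add hi2)
        (Continuous.integrable_of_hasCompactSupport (by fun_prop) hcs.mul_left)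
    rw [integral_add hi1 hi2] at h0
    have hpos : 0 < ∫ x : ℝ, (m : ℝ) * x ^ (m - 1) * φ x := by
      refine Continuous.integral_pos_of_hasCompactSupport_nonneg_nonzero (x := ρ / 2)
        (by fun_prop) hcs.mul_left (fun x => ?_) ?_
      · by_cases hx : φ x = 0
        · simp [hx]
        · have h1 := hsupp (subset_tsupport _ hx)
          rw [Metric.mem_closedBall, Real.dist_eq, abs_le] at h1
          have h2 : 0 ≤ x := by linarith [h1.1]
          have h3 := φ.nonneg (x := x)
          positivity
      · have h1 : φ (ρ / 2) = 1 := φ.one_of_mem_closedBall (by simp; positivity)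
        rw [h1]
        positivity
    linarith

lemma exists_product_bump {r : ℝ} (hr : 0 < r) :
    ∃ ς : EuclideanSpace ℝ (Fin 2) → ℂ, ContDiff ℝ ∞ ς ∧
      tsupport ς ⊆ Metric.closedBall 0 r ∧ CancelsIn {0} ς ∧ CancelsIn {1} ς ∧
      ∀ m n : ℕ, 0 < m → 0 < n → ∫ t, ς t * ((t 0 ^ m * t 1 ^ n : ℝ) : ℂ) ≠ 0 := by
  obtain ⟨h, hh, hsupp, hint, hmom⟩ := exists_bump_deriv (half_pos hr)
  have hhC : ContDiff ℝ ∞ fun x => ((h x : ℝ) : ℂ) := Complex.ofRealCLM.contDiff.comp hh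
  have hς : ContDiff ℝ ∞ fun t : EuclideanSpace ℝ (Fin 2) => ((h (t 0) : ℝ) : ℂ) * (h (t 1) : ℂ) :=
    (hhC.comp (by fun_prop : ContDiff ℝ ∞ fun t : EuclideanSpace ℝ (Fin 2) => t 0)).mul
      (hhC.comp (by fun_prop : ContDiff ℝ ∞ fun t : EuclideanSpace ℝ (Fin 2) => t 1))
  have hs : tsupport (fun t : EuclideanSpace ℝ (Fin 2) => ((h (t 0) : ℝ) : ℂ) * (h (t 1) : ℂ)) ⊆
      Metric.closedBall 0 r := by
    refine closure_minimal (fun t ht => ?_) Metric.isClosed_closedBall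
    have h0 : |t 0| ≤ r / 2 := by
      by_contra hc
      exact ht (by simp [hsupp _ (not_le.1 hc)])
    have h1 : |t 1| ≤ r / 2 := by
      by_contra hc
      exact ht (by simp [hsupp _ (not_le.1 hc)])
    rw [mem_closedBall_zero_iff]
    have ht' : t = EuclideanSpace.single 0 (t 0) + EuclideanSpace.single 1 (t 1) := by
      ext i; fin_cases i <;> simp
    rw [ht']
    refine (norm_add_le _ _).trans ?_
    rw [PiLp.norm_single, PiLp.norm_single, Real.norm_eq_abs, Real.norm_eq_abs]
    linarith
  have hintC : ∫ x, ((h x : ℝ) : ℂ) = 0 := by rw [integral_complex_ofReal, hint]; simp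
  refine ⟨_, hς, hs, cancelsIn_zero_iff.2 fun y => ?_, cancelsIn_one_iff.2 fun x => ?_,
    fun m n hm hn => ?_⟩
  · simp [integral_mul_const, hintC]
  · simp [integral_const_mul, hintC]
  · rw [integral_plane_eq]
    · have heq : ∀ x : ℝ, ∫ y : ℝ, ((h x : ℝ) : ℂ) * (h y : ℂ) * ((x ^ m * y ^ n : ℝ) : ℂ) =
          ((x ^ m * h x : ℝ) : ℂ) * ((∫ y, y ^ n * h y : ℝ) : ℂ) := by
        intro x
        rw [← integral_complex_ofReal, ← integral_const_mul]
        congr 1; funext y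
        push_cast
        ring
      simp only [Matrix.cons_val_zero, Matrix.cons_val_one, heq]
      rw [integral_mul_const, integral_complex_ofReal]
      exact mul_ne_zero (by exact_mod_cast hmom m hm) (by exact_mod_cast hmom n hn)
    · refine Continuous.integrable_of_hasCompactSupport (hς.continuous.mul ?_)
        (hasCompactSupport_of_tsupport_subset hs).mul_right
      fun_prop

/-! ### Lower bounds for multipliers -/

lemma norm_cis_sub_one_sub_le {x : ℝ} (hx : |x| ≤ 1) :
    ‖cis x - 1 - (x : ℂ) * Complex.I‖ ≤ x ^ 2 := by
  have h := Complex.norm_exp_sub_one_sub_id_le (x := (x : ℂ) * Complex.I) (by simpa using hx)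
  simpa [cis] using h

/-- For small `y` the integral is `i y P + O(y²)`, the constant term being killed by cancellation;
the remainder cannot offset `y P` for the chosen `y`. -/
lemma exists_integral_cis_monomial_ne_zero {ς : EuclideanSpace ℝ (Fin 2) → ℂ}
    (hc : Continuous ς) (hs : tsupport ς ⊆ Metric.closedBall 0 1) (hcan : CancelsIn {1} ς)
    {m n : ℕ} (hP : ∫ t, ς t * ((t 0 ^ m * t 1 ^ n : ℝ) : ℂ) ≠ 0) :
    ∃ y : ℝ, 0 < y ∧ ∫ t, ς t * cis (y * (t 0 ^ m * t 1 ^ n)) ≠ 0 := by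
  have hcs := hasCompactSupport_of_tsupport_subset hs
  obtain ⟨M, hM⟩ := hc.bounded_above_of_compact_support hcs
  have hM0 : 0 ≤ M := (norm_nonneg _).trans (hM 0)
  have hV := discVol_nonneg
  set P := ∫ t, ς t * ((t 0 ^ m * t 1 ^ n : ℝ) : ℂ) with hPdef
  have hPpos : 0 < ‖P‖ := norm_pos_iff.2 hP
  set y := min 1 (‖P‖ / (2 * (M * discVol + 1))) with hy
  have hy0 : 0 < y := by positivity
  have hy1 : y ≤ 1 := min_le_left _ _
  have hyP : y * (M * discVol) ≤ ‖P‖ / 2 := by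
    have h1 : y ≤ ‖P‖ / (2 * (M * discVol + 1)) := min_le_right _ _
    rw [le_div_iff₀ (by positivity)] at h1
    nlinarith
  refine ⟨y, hy0, fun h0 => ?_⟩
  have hς0 := integral_eq_zero_of_cancelsIn_one hcan hc hcs
  have hi1 : Integrable fun t : EuclideanSpace ℝ (Fin 2) => ς t * cis (y * (t 0 ^ m * t 1 ^ n)) :=
    Continuous.integrable_of_hasCompactSupport (by fun_prop) hcs.mul_right
  have hi2 : Integrable fun t : EuclideanSpace ℝ (Fin 2) => ς t * ((t 0 ^ m * t 1 ^ n : ℝ) : ℂ) :=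
    Continuous.integrable_of_hasCompactSupport (by fun_prop) hcs.mul_right
  have hi3 : Integrable ς := hc.integrable_of_hasCompactSupport hcs
  have hrem : ∫ t, ς t * (cis (y * (t 0 ^ m * t 1 ^ n)) - 1 -
      ((y * (t 0 ^ m * t 1 ^ n) : ℝ) : ℂ) * Complex.I) = -((y : ℂ) * Complex.I) * P := by
    have h1 : ∀ t : EuclideanSpace ℝ (Fin 2), ς t * (cis (y * (t 0 ^ m * t 1 ^ n)) - 1 -
        ((y * (t 0 ^ m * t 1 ^ n) : ℝ) : ℂ) * Complex.I) =
        ς t * cis (y * (t 0 ^ m * t 1 ^ n)) - ς t -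
          ((y : ℂ) * Complex.I) * (ς t * ((t 0 ^ m * t 1 ^ n : ℝ) : ℂ)) := by
      intro t; push_cast; ring
    simp only [h1]
    have hi4 : Integrable fun t => ς t * cis (y * (t 0 ^ m * t 1 ^ n)) - ς t := hi1.sub hi3
    rw [integral_sub hi4 (hi2.const_mul _), integral_sub hi1 hi3, h0, hς0,
      integral_const_mul]
    ring
  have hle := norm_integral_le_discVol (M := M * y ^ 2)
    (F := fun t => ς t * (cis (y * (t 0 ^ m * t 1 ^ n)) - 1 -
      ((y * (t 0 ^ m * t 1 ^ n) : ℝ) : ℂ) * Complex.I))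
    (fun t ht => by rw [eq_zero_of_notMem_closedBall le_rfl hs t ht, zero_mul])
    (fun t ht => by
      have h1 := abs_monomial_le_one ht m n
      have h2 : |y * (t 0 ^ m * t 1 ^ n)| ≤ y := by
        rw [abs_mul, abs_of_pos hy0]; exact mul_le_of_le_one_right hy0.le h1
      rw [norm_mul]
      gcongr
      · exact hM t
      · refine (norm_cis_sub_one_sub_le (h2.trans hy1)).trans ?_
        rw [← sq_abs]
        gcongr)
  rw [hrem, norm_mul, norm_neg, norm_mul, Complex.norm_I, mul_one, Complex.norm_real,
    Real.norm_of_nonneg hy0.le] at hle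
  nlinarith

/-- If a monomial of `p` dominates the others at the scale `(2^{-k-l}, 2^{-k})`, then the multiplier
of the corresponding dyadic piece is not small at a suitable frequency. -/
lemma exists_le_norm_pieceMul {p : MvPolynomial (Fin 2) ℝ} {ς : EuclideanSpace ℝ (Fin 2) → ℂ}
    (hc : Continuous ς) (hs : tsupport ς ⊆ Metric.closedBall 0 1) (hcan : CancelsIn {1} ς)
    {β : Fin 2 →₀ ℕ} (hβ : β ∈ p.support)
    (hP : ∫ t, ς t * ((t 0 ^ β 0 * t 1 ^ β 1 : ℝ) : ℂ) ≠ 0) :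
    ∃ κ : ℝ, 0 < κ ∧ ∃ (y : ℝ) (G : ℕ), ∀ k l W : ℕ, (k + l) * β 0 + k * β 1 = W →
      (∀ α ∈ p.support, α ≠ β → W + G ≤ (k + l) * α 0 + k * α 1) →
      κ ≤ ‖pieceMul p ς ![k + l, k] (y * 2 ^ W)‖ := by
  have hcs := hasCompactSupport_of_tsupport_subset hs
  obtain ⟨M, hM⟩ := hc.bounded_above_of_compact_support hcs
  have hM0 : 0 ≤ M := (norm_nonneg _).trans (hM 0)
  have hV := discVol_nonneg
  have hS := coeffSum_nonneg p
  obtain ⟨y, hy, hI⟩ := exists_integral_cis_monomial_ne_zero hc hs hcan hP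
  set c := p.coeff β with hcdef
  have hc0 : c ≠ 0 := MvPolynomial.mem_support_iff.1 hβ
  have hcpos : 0 < |c| := abs_pos.2 hc0
  set I₀ := ∫ t, ς t * cis (y * (t 0 ^ β 0 * t 1 ^ β 1)) with hI₀
  have hIpos : 0 < ‖I₀‖ := norm_pos_iff.2 hI
  set A := M * (y / |c| * coeffSum p) * discVol with hA
  have hA0 : 0 ≤ A := by positivity
  -- `G` is the gap, in powers of two, after which the remaining monomials perturb the integral by
  -- at most half of `‖I₀‖`.
  obtain ⟨G, hG⟩ := exists_pow_lt_of_lt_one (show 0 < ‖I₀‖ / (2 * (A + 1)) by positivity)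
    (show (2 : ℝ)⁻¹ < 1 by norm_num)
  rw [lt_div_iff₀ (by positivity)] at hG
  have hAG : A * (2 : ℝ)⁻¹ ^ G ≤ ‖I₀‖ / 2 := by
    have : (0 : ℝ) < (2 : ℝ)⁻¹ ^ G := by positivity
    nlinarith
  have hpi := Real.pi_pos
  -- This frequency normalizes the dominant term of the phase to exactly `y t^β`.
  refine ⟨‖I₀‖ / 2, by positivity, -(y / (2 * Real.pi * c)), G, fun k l W hW hgap => ?_⟩
  set ξ := -(y / (2 * Real.pi * c)) * 2 ^ W with hξ
  have hξc : -(2 * Real.pi * ξ) = y / c * 2 ^ W := by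
    rw [hξ]; field_simp
  have hphase : ∀ t ∈ Metric.closedBall (0 : EuclideanSpace ℝ (Fin 2)) 1,
      |-(2 * Real.pi * ξ) * phase p ![k + l, k] t - y * (t 0 ^ β 0 * t 1 ^ β 1)| ≤
        y / |c| * coeffSum p * (2 : ℝ)⁻¹ ^ G := by
    intro t ht
    have h1 : phase p ![k + l, k] t = ∑ α ∈ p.support,
        p.coeff α * ((2 ^ ((k + l) * α 0 + k * α 1))⁻¹ * (t 0 ^ α 0 * t 1 ^ α 1)) := by
      rw [phase_eq_sum p 0]
      simp [scaledCoeff, mul_assoc]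
    have hmain : y / c * 2 ^ W * (p.coeff β * ((2 ^ ((k + l) * β 0 + k * β 1))⁻¹ *
        (t 0 ^ β 0 * t 1 ^ β 1))) = y * (t 0 ^ β 0 * t 1 ^ β 1) := by
      rw [hW, ← hcdef]
      field_simp
    rw [hξc, h1, ← Finset.add_sum_erase _ _ hβ, mul_add, hmain, add_sub_cancel_left, abs_mul,
      abs_mul, abs_div, abs_of_pos hy, abs_of_pos (by positivity : (0 : ℝ) < 2 ^ W), mul_assoc,
      mul_assoc]
    refine mul_le_mul_of_nonneg_left ?_ (by positivity)
    have h2 : |∑ α ∈ p.support.erase β,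
        p.coeff α * ((2 ^ ((k + l) * α 0 + k * α 1))⁻¹ * (t 0 ^ α 0 * t 1 ^ α 1))| ≤
        ∑ α ∈ p.support.erase β, |p.coeff α| * ((2 ^ W)⁻¹ * (2 : ℝ)⁻¹ ^ G) := by
      refine (Finset.abs_sum_le_sum_abs _ _).trans (Finset.sum_le_sum fun α hα => ?_)
      obtain ⟨hne, hmem⟩ := Finset.mem_erase.1 hα
      rw [abs_mul, abs_mul,
        abs_of_pos (by positivity : (0 : ℝ) < (2 ^ ((k + l) * α 0 + k * α 1))⁻¹)]
      refine mul_le_mul_of_nonneg_left ?_ (abs_nonneg _)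
      refine (mul_le_of_le_one_right (by positivity) (abs_monomial_le_one ht _ _)).trans ?_
      rw [inv_pow, ← mul_inv, ← pow_add]
      exact inv_anti₀ (by positivity) (pow_le_pow_right₀ (by norm_num) (hgap α hmem hne))
    calc _ ≤ (2 : ℝ) ^ W * ∑ α ∈ p.support.erase β, |p.coeff α| * ((2 ^ W)⁻¹ * (2 : ℝ)⁻¹ ^ G) :=
          mul_le_mul_of_nonneg_left h2 (by positivity)
      _ ≤ (2 : ℝ) ^ W * ∑ α ∈ p.support, |p.coeff α| * ((2 ^ W)⁻¹ * (2 : ℝ)⁻¹ ^ G) := by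
          refine mul_le_mul_of_nonneg_left ?_ (by positivity)
          exact Finset.sum_le_sum_of_subset_of_nonneg (Finset.erase_subset _ _)
            fun _ _ _ => by positivity
      _ = _ := by
          rw [← Finset.sum_mul, ← coeffSum, mul_left_comm, mul_inv_cancel_left₀ (by positivity)]
  have hdiff : ‖pieceMul p ς ![k + l, k] ξ - I₀‖ ≤ A * (2 : ℝ)⁻¹ ^ G := by
    rw [pieceMul, hI₀, ← integral_sub]
    · refine (norm_integral_le_discVol (M := M * (y / |c| * coeffSum p * (2 : ℝ)⁻¹ ^ G))
        (fun t ht => ?_) fun t ht => ?_).trans (le_of_eq (by rw [hA]; ring))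
      · rw [eq_zero_of_notMem_closedBall le_rfl hs t ht]; ring
      · rw [← mul_sub, norm_mul]
        gcongr
        · exact hM t
        · exact (norm_cis_sub_cis_le _ _).trans (hphase t ht)
    · exact Continuous.integrable_of_hasCompactSupport (by fun_prop) hcs.mul_right
    · exact Continuous.integrable_of_hasCompactSupport (by fun_prop) hcs.mul_right
  have h3 := norm_sub_norm_le I₀ (pieceMul p ς ![k + l, k] ξ)
  rw [norm_sub_rev] at h3
  linarith

/-! ### The Newton diagram -/

lemma onOrAboveLine_iff {b : ℕ} (hb : 0 < b) (α : Fin 2 →₀ ℕ) :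
    OnOrAboveLine ((b : ℝ), 0) (0, (b : ℝ)) α ↔ b ≤ α 0 + α 1 := by
  have hb' : (b : ℝ) ≠ 0 := by positivity
  have hline : ∀ x y : ℝ, (x, y) ∈ line[ℝ, ((b : ℝ), (0 : ℝ)), ((0 : ℝ), (b : ℝ))] ↔ x + y = b := by
    intro x y
    rw [mem_affineSpan_pair_iff_exists_lineMap_eq]
    constructor
    · rintro ⟨s, hs⟩
      rw [AffineMap.lineMap_apply] at hs
      simp at hs
      rw [← hs.1, ← hs.2]
      ring
    · intro h
      refine ⟨y / b, ?_⟩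
      rw [AffineMap.lineMap_apply]
      simp only [vsub_eq_sub, vadd_eq_add, Prod.mk_sub_mk, Prod.smul_mk, Prod.mk_add_mk,
        smul_eq_mul, Prod.mk.injEq]
      constructor
      · field_simp; linear_combination (-(b : ℝ)) * h
      · field_simp; ring
  simp only [OnOrAboveLine, hline]
  constructor
  · rintro ⟨y, h1, h2⟩
    have : (b : ℝ) ≤ α 0 + α 1 := by linarith
    exact_mod_cast this
  · intro h
    have : (b : ℝ) ≤ α 0 + α 1 := by exact_mod_cast h
    exact ⟨b - α 0, by ring, by linarith⟩

/-- If `p` has a monomial of degree less than `b`, some `T_K` is unbounded. -/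
theorem exists_not_isL2Bounded {p : MvPolynomial (Fin 2) ℝ} {a b : ℕ} (hba : b ≤ a)
    (ha : ∀ n, p.coeff (Finsupp.single 0 n) ≠ 0 → a ≤ n)
    (hb : ∀ n, p.coeff (Finsupp.single 1 n) ≠ 0 → b ≤ n)
    {γ : Fin 2 →₀ ℕ} (hγ : γ ∈ p.support) (hγb : γ 0 + γ 1 < b) {a₀ : ℝ} (ha₀ : 0 < a₀) :
    ∃ K ∈ kernelClass 2 stdExp a₀ flagSet, ¬ IsL2Bounded a₀ p K := by
  classical
  by_contra hcon
  push Not at hcon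
  obtain ⟨δ, hδ, hδmin⟩ := Finset.exists_min_image p.support (fun α => α 0 + α 1) ⟨γ, hγ⟩
  set d := δ 0 + δ 1 with hd
  -- Among the monomials of least degree, the one with least first exponent dominates when the first
  -- coordinate is contracted more strongly.
  obtain ⟨β, hβ', hβmin⟩ := Finset.exists_min_image (p.support.filter fun α => α 0 + α 1 = d)
    (fun α => α 0) ⟨δ, by simp [hδ, hd]⟩
  obtain ⟨hβ, hβd⟩ := Finset.mem_filter.1 hβ'
  have hdb : d < b := (hδmin γ hγ).trans_lt hγb
  have hβc := MvPolynomial.mem_support_iff.1 hβ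
  -- Pure powers have degree at least `b` in `t` and at least `a ≥ b` in `s`, so `β`, of degree `d <
  -- b`, is mixed. Hence its moment against the bump does not vanish.
  have hβ0 : 0 < β 0 := by
    by_contra h
    have h1 : β = Finsupp.single 1 d := by
      ext i; fin_cases i <;> simp <;> omega
    have := hb d (h1 ▸ hβc)
    omega
  have hβ1 : 0 < β 1 := by
    by_contra h
    have h1 : β = Finsupp.single 0 d := by
      ext i; fin_cases i <;> simp <;> omega
    have := ha d (h1 ▸ hβc)
    omega
  set r := min (a₀ / 2) 1 with hr
  have hr0 : 0 < r := by positivity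
  have hra : r < a₀ := (min_le_left _ _).trans_lt (by linarith)
  have hr1 : r ≤ 1 := min_le_right _ _
  obtain ⟨ς, hς, hs, hcan0, hcan1, hmom⟩ := exists_product_bump hr0
  obtain ⟨C, hC⟩ := exists_sum_norm_pieceMul_le_of_isL2Bounded hς hra hr1 hs hcan0 hcan1 hcon
  obtain ⟨κ, hκ, y, G, hlow⟩ := exists_le_norm_pieceMul hς.continuous
    (hs.trans (Metric.closedBall_subset_closedBall hr1)) hcan1 hβ (hmom _ _ hβ0 hβ1)
  obtain ⟨N, hN⟩ := exists_nat_gt (C / κ)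
  rw [div_lt_iff₀ hκ] at hN
  -- The pairs `k = R - β₀ u`, `l = d u` solve `k d + l β₀ = R d`, so the dominant monomial has the
  -- same size `2^{-Rd}` at all of them. `R` is large enough that `k > l β₀ + G` for the first `N`
  -- values `u = i + 1 + G`.
  set R := β 0 * (N + G + 1) + d * (N + G + 1) * β 0 + G + 1 with hR
  set l : ℕ → ℕ := fun i => d * (i + 1 + G) with hl
  set k : ℕ → ℕ := fun i => R - β 0 * (i + 1 + G) with hk
  have hkR : ∀ i < N, k i + β 0 * (i + 1 + G) = R ∧ l i * β 0 + G + 1 ≤ k i := by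
    intro i hi
    have h1 : β 0 * (i + 1 + G) ≤ β 0 * (N + G + 1) := Nat.mul_le_mul_left _ (by omega)
    have h2 : l i * β 0 ≤ d * (N + G + 1) * β 0 :=
      Nat.mul_le_mul_right _ (Nat.mul_le_mul_left _ (by omega))
    simp only [hk, hR]
    constructor <;> omega
  have hd0 : 0 < d := by omega
  have hlG : ∀ i, G + 1 ≤ l i := fun i =>
    le_trans (by omega) (Nat.le_mul_of_pos_left (i + 1 + G) hd0)
  set J : ℕ → Fin 2 → ℕ := fun i => ![k i + l i, k i] with hJ
  have hinj : Set.InjOn J (Finset.range N) := by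
    intro i _ i' _ h
    have e0 := congrFun h 0
    have e1 := congrFun h 1
    simp only [hJ, Matrix.cons_val_zero, Matrix.cons_val_one] at e0 e1
    have e2 : l i = l i' := by omega
    have := Nat.eq_of_mul_eq_mul_left hd0 e2
    omega
  have hsum := hC (y * 2 ^ (R * d)) ((Finset.range N).image J) (by
    intro j hj
    obtain ⟨i, hi, rfl⟩ := Finset.mem_image.1 hj
    have h1 := (hkR i (Finset.mem_range.1 hi)).2
    have h2 := hlG i
    simp only [hJ, Matrix.cons_val_zero, Matrix.cons_val_one]
    omega)
  rw [Finset.sum_image hinj] at hsum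
  have hpt : ∀ i ∈ Finset.range N, κ ≤ ‖pieceMul p ς (J i) (y * 2 ^ (R * d))‖ := by
    intro i hi
    obtain ⟨h1, h2⟩ := hkR i (Finset.mem_range.1 hi)
    have h3 := hlG i
    have hW : (k i + l i) * β 0 + k i * β 1 = R * d := by
      rw [← h1, ← hβd]
      simp only [hl, ← hβd]
      ring
    refine hlow (k i) (l i) (R * d) hW fun α hα hne => ?_
    rw [← hW]
    have hαd : d ≤ α 0 + α 1 := hδmin α hα
    -- In equal degree the larger first exponent gains at least `l ≥ G`; in higher degree the gain
    -- is at least `k - l β₀ ≥ G`.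
    rcases hαd.eq_or_lt with h4 | h4
    · have h5 : β 0 ≤ α 0 := hβmin α (Finset.mem_filter.2 ⟨hα, h4.symm⟩)
      have h6 : β 0 < α 0 := by
        refine lt_of_le_of_ne h5 fun h7 => hne ?_
        ext i
        fin_cases i <;> simp <;> omega
      have h8 : l i * (β 0 + 1) ≤ l i * α 0 := Nat.mul_le_mul_left _ h6
      have h9 : k i * (α 0 + α 1) = k i * (β 0 + β 1) := by rw [← h4, hβd]
      nlinarith
    · have h5 : k i * (β 0 + β 1 + 1) ≤ k i * (α 0 + α 1) := Nat.mul_le_mul_left _ (by omega)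
      nlinarith [Nat.zero_le (l i * α 0)]
  have := Finset.sum_le_sum hpt
  rw [Finset.sum_const, Finset.card_range, nsmul_eq_mul] at this
  linarith

end MultiParam

/-! ### The equivalence -/

theorem theorem17p11 (p : MvPolynomial (Fin 2) ℝ) (hp : MvPolynomial.constantCoeff p = 0)
    (a b : ℕ)
    (ha : IsLeast {n : ℕ | MvPolynomial.coeff (Finsupp.single 0 n) p ≠ 0} a)
    (hb : IsLeast {n : ℕ | MvPolynomial.coeff (Finsupp.single 1 n) p ≠ 0} b)
    (hba : b ≤ a) :
    ∃ ε : ℝ, 0 < ε ∧ ∀ a₀ : ℝ, 0 < a₀ → a₀ ≤ ε →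
      ((∀ K ∈ MultiParam.kernelClass 2 MultiParam.stdExp a₀ MultiParam.flagSet,
          MultiParam.IsL2Bounded a₀ p K) ↔
        ∀ α : Fin 2 →₀ ℕ, MvPolynomial.coeff α p ≠ 0 →
          MultiParam.OnOrAboveLine ((b : ℝ), 0) (0, (b : ℝ)) α) := by
  have hb0 : 0 < b := by
    refine Nat.pos_of_ne_zero fun h => hb.1 ?_
    rw [h, Finsupp.single_zero]
    exact hp
  simp only [MultiParam.onOrAboveLine_iff hb0]
  by_cases hdeg : ∀ α : Fin 2 →₀ ℕ, MvPolynomial.coeff α p ≠ 0 → b ≤ α 0 + α 1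
  · obtain ⟨ε, hε, H⟩ := MultiParam.isL2Bounded_of_mem_kernelClass hb0 hb.1
      fun α hα => hdeg α (MvPolynomial.mem_support_iff.1 hα)
    exact ⟨ε, hε, fun a₀ _ ha₀ => ⟨fun _ => hdeg, fun _ => H a₀ ha₀⟩⟩
  -- Necessity holds for every radius `a₀ > 0`, so any `ε` serves here.
  · refine ⟨1, one_pos, fun a₀ ha₀ _ => ⟨fun hall => ?_, fun h => absurd h hdeg⟩⟩
    push Not at hdeg
    obtain ⟨γ, hγ, hγb⟩ := hdeg
    obtain ⟨K, hK, hK'⟩ := MultiParam.exists_not_isL2Bounded hba (fun n hn => ha.2 hn)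
      (fun n hn => hb.2 hn) (MvPolynomial.mem_support_iff.2 hγ) hγb ha₀
    exact absurd (hall K hK) hK'
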